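/- **Proposition (Regularity of the resonant coefficients).** Write $\langle x\rangle=(1+|x|^2)^{1/2}$ and, for $s\in\mathbb R$, $L^2_s(\mathbb R^3)=\{f:\langle x\rangle^s f\in L^2(\mathbb R^3)\}$ with $\|f\|_{L^2_s}=\|\langle\cdot\rangle^s f\|_{L^2}$. Let $s>1/2$. There is a constant $C>0$, depending only on $s$, such that the following holds. Let $V\in C^\infty(\mathbb R^3;\mathbb R)$ satisfy $V(x)\ge c|x|-C_0$ for some $c,C_0>0$, and let $(\chi_k)_{k\in\mathbb N_0}$ be an orthonormal basis of $L^2(\mathbb R^3;\mathbb C)$ consisting of eigenfunctions of the self-adjoint operator $-\Delta+V$, with $(-\Delta+V)\chi_k=E_k\chi_k$. The inner product $\langle\cdot,\cdot\rangle$ of $L^2$ is conjugate-linear in the first variable, and $*$ denotes convolution on $\mathbb R^3$. 1. For all $k,k'$, $\ \langle\cdot\rangle^s\chi_k\overline{\chi_{k'}}\in L^1(\mathbb R^3)$. 2. Let $w\in L^2_s(\mathbb R^3)$. Then $w*(\overline{\chi_{k'}}\chi_k)$ is defined almost everywhere and belongs to $L^2(\mathbb R^3)$ for all $k,k'$. For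 $\eta>0$ and indices with $E_j\neq E_{j'}$ put $\Delta E:=E_j-E_{j'}$ and $$M^\eta_{k,k';j,j'}:=\Big\langle w*(\overline{\chi_{k'}}\chi_k),\ \frac{1}{|\nabla|-\Delta E+i\eta^2}\,w*(\overline{\chi_{j'}}\chi_j)\Big\rangle_{L^2},$$ where $(|\nabla|-\Delta E+i\eta^2)^{-1}$ is the Fourier multiplier on $L^2$ with symbol $(|\xi|-\Delta E+i\eta^2)^{-1}$ (with $-i\nabla\leftrightarrow\xi$). Then the limit $\lim_{\eta\to0^+}M^\eta_{k,k';j,j'}$ exists in $\mathbb C$, and $$\sup_{\eta>0}\big|M^\eta_{k,k';j,j'}\big|\le C\,\|w\|_{L^2_s}^2\,\|\langle\cdot\rangle^s\chi_k\overline{\chi_{k'}}\|_{L^1}\,\|\langle\cdot\rangle^s\chi_j\overline{\chi_{j'}}\|_{L^1};$$ the limit satisfies the same bound. 3. Let $v\in L^\infty(\mathbb R^3)$. For all $k,k',j,j'$ the convolution $v*(\overline{\chi_{j'}}\chi_j)$ is defined everywhere, the Hartree coefficient $$\Lambda^{\mathrm{Har}}_{k,k';j,j'}:=\big\langle\overline{\chi_{k'}}\chi_k,\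 v*(\overline{\chi_{j'}}\chi_j)\big\rangle=\int_{\mathbb R^3}\overline{\overline{\chi_{k'}}\chi_k}\;\big(v*(\overline{\chi_{j'}}\chi_j)\big)\,dx$$ is given by an absolutely convergent integral, and $|\Lambda^{\mathrm{Har}}_{k,k';j,j'}|\le\|v\|_{L^\infty}$. -/

import Mathlib

open MeasureTheory Filter Topology FourierTransform
open scoped ENNReal ContDiff

namespace ResonantCoefficients

/-- The Euclidean space `ℝ³`. -/
abbrev R3 : Type := EuclideanSpace ℝ (Fin 3)

/-- The Hilbert space `L²(ℝ³; ℂ)`; its inner product is conjugate-linear in the first variable. -/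
abbrev L2 : Type := Lp (α := R3) ℂ 2

/-- The bracket `⟨x⟩ = (1 + |x|²)^{1/2}`. -/
noncomputable def bracket (x : R3) : ℝ := Real.sqrt (1 + ‖x‖ ^ 2)

/-- The function `⟨·⟩^s f`. -/
noncomputable def weighted (s : ℝ) (f : R3 → ℂ) : R3 → ℂ :=
  fun x => ((bracket x ^ s : ℝ) : ℂ) * f x

/-- Membership in the weighted space `L²_s = {f : ⟨x⟩^s f ∈ L²}`. -/
def MemWeightedL2 (s : ℝ) (f : R3 → ℂ) : Prop := MemLp (weighted s f) 2 volume

/-- The norm `‖f‖_{L²_s} = ‖⟨·⟩^s f‖_{L²}` of `f ∈ L²_s`. -/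
noncomputable def weightedL2Norm (s : ℝ) (f : R3 → ℂ) : ℝ :=
  (eLpNorm (weighted s f) 2 volume).toReal

/-- The norm `‖⟨·⟩^s f‖_{L¹}` (meaningful when `⟨·⟩^s f` is in `L¹`). -/
noncomputable def weightedL1Norm (s : ℝ) (f : R3 → ℂ) : ℝ :=
  (eLpNorm (weighted s f) 1 volume).toReal

/-- A smooth real potential on `ℝ³` with `V x ≥ c |x| - C₀` for some `c, C₀ > 0`. -/
def IsConfining (V : R3 → ℝ) : Prop :=
  ContDiff ℝ ∞ V ∧ ∃ c C₀ : ℝ, 0 < c ∧ 0 < C₀ ∧ ∀ x, c * ‖x‖ - C₀ ≤ V x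

/-- The graph of `H₀ = -Δ + V` on `L²`: `H₀ f = g` with both functions in `L²`, where `-Δ + V` acts
in the sense of distributions. For smooth `V` bounded below, this operator with its maximal domain
is the self-adjoint realization of `-Δ + V`, since `-Δ + V` is essentially self-adjoint on the
compactly supported smooth functions. -/
def SchrodingerGraph (V : R3 → ℝ) (f g : L2) : Prop :=
  ∀ φ : R3 → ℂ, ContDiff ℝ ∞ φ → HasCompactSupport φ →
    ∫ x, f x * (-(Laplacian.laplacian φ x) + (V x : ℂ) * φ x) = ∫ x, g x * φ x

/-- `χ` is an orthonormal basis of `L²` made of eigenfunctions of `H₀ = -Δ + V`, with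
`H₀ χ_k = E_k χ_k`. -/
def IsEigenbasis (V : R3 → ℝ) (χ : HilbertBasis ℕ ℂ L2) (E : ℕ → ℝ) : Prop :=
  ∀ k, SchrodingerGraph V (χ k) ((E k : ℂ) • χ k)

/-- The product `conj(χ_{k'}) χ_k`. -/
noncomputable def transition (χ : HilbertBasis ℕ ℂ L2) (k k' : ℕ) : R3 → ℂ :=
  fun x => star (χ k' x) * χ k x

/-- The convolution `(f * g)(x) = ∫ f(y) g(x - y) dy`. -/
noncomputable def conv (f g : R3 → ℂ) : R3 → ℂ :=
  convolution f g (ContinuousLinearMap.mul ℝ ℂ) volume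

open Classical in
/-- The class in `L²` of a square-integrable function (and `0` for any other function). -/
noncomputable def toL2 (f : R3 → ℂ) : L2 :=
  if h : MemLp f 2 volume then h.toLp f else 0

/-- The Fourier multiplier `g ↦ 𝓕⁻¹(m 𝓕 g)` on `L²`. -/
noncomputable def fourierMultiplier (m : R3 → ℂ) (g : L2) : L2 :=
  𝓕⁻ (toL2 fun ξ => m ξ * (𝓕 g : L2) ξ)

/-- The resolvent `(|∇| - a + iε)⁻¹`, for `ε > 0`. The Fourier transform is normalized by
`𝓕 g(ξ) = ∫ e^{-2πi x·ξ} g(x) dx`, so that `|∇|` is multiplication by `2π|ξ|`. -/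
noncomputable def halfWaveResolvent (a ε : ℝ) (g : L2) : L2 :=
  fourierMultiplier
    (fun ξ => (((2 * Real.pi * ‖ξ‖ : ℝ) : ℂ) - (a : ℂ) + Complex.I * (ε : ℂ))⁻¹) g

/-- For `ε > 0` the multiplier `(2π|ξ| - a + iε)⁻¹` is bounded, hence acts on all of `L²`. -/
theorem memLp_halfWave_mul {a ε : ℝ} (hε : 0 < ε) (g : L2) :
    MemLp (fun ξ : R3 =>
      (((2 * Real.pi * ‖ξ‖ : ℝ) : ℂ) - (a : ℂ) + Complex.I * (ε : ℂ))⁻¹ * (𝓕 g : L2) ξ)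
      2 volume := by
  have hg : MemLp ((𝓕 g : L2) : R3 → ℂ) 2 volume := Lp.memLp _
  refine hg.of_le_mul (c := ε⁻¹) ?_ (Eventually.of_forall fun ξ => ?_)
  · refine AEStronglyMeasurable.mul ?_ hg.1
    exact (by fun_prop : Measurable fun ξ : R3 =>
      (((2 * Real.pi * ‖ξ‖ : ℝ) : ℂ) - (a : ℂ) + Complex.I * (ε : ℂ))⁻¹).aestronglyMeasurable
  · rw [norm_mul, norm_inv]
    gcongr
    have h := Complex.abs_im_le_norm
      (((2 * Real.pi * ‖ξ‖ : ℝ) : ℂ) - (a : ℂ) + Complex.I * (ε : ℂ))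
    simp only [Complex.add_im, Complex.sub_im, Complex.ofReal_im, Complex.mul_im, Complex.I_re,
      Complex.I_im, Complex.ofReal_re] at h
    rw [show (0 : ℝ) - 0 + (0 * 0 + 1 * ε) = ε by ring, abs_of_pos hε] at h
    exact h

/-- For `ε > 0`, applying `|∇| - a + iε` to `(|∇| - a + iε)⁻¹ g` gives back `g`. -/
theorem halfWaveResolvent_spec {a ε : ℝ} (hε : 0 < ε) (g : L2) :
    (fun ξ : R3 => (((2 * Real.pi * ‖ξ‖ : ℝ) : ℂ) - (a : ℂ) + Complex.I * (ε : ℂ)) *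
      (𝓕 (halfWaveResolvent a ε g) : L2) ξ) =ᵐ[volume] ((𝓕 g : L2) : R3 → ℂ) := by
  have h := memLp_halfWave_mul (a := a) hε g
  have e : (𝓕 (halfWaveResolvent a ε g) : L2) = h.toLp _ := by
    rw [halfWaveResolvent, fourierMultiplier, FourierTransform.fourier_fourierInv_eq, toL2,
      dif_pos h]
  rw [e]
  filter_upwards [h.coeFn_toLp] with ξ hξ
  rw [hξ, ← mul_assoc, mul_inv_cancel₀, one_mul]
  intro h0
  have := congrArg Complex.im h0
  simp at this
  exact hε.ne' this

/-- The regularized resonant coefficient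
`M^η_{k,k';j,j'} = ⟨w * (conj χ_{k'} χ_k), (|∇| - (E_j - E_{j'}) + iη²)⁻¹ w * (conj χ_{j'} χ_j)⟩`. -/
noncomputable def resonantCoeff (w : R3 → ℂ) (χ : HilbertBasis ℕ ℂ L2) (E : ℕ → ℝ)
    (k k' j j' : ℕ) (η : ℝ) : ℂ :=
  inner ℂ (toL2 (conv w (transition χ k k')))
    (halfWaveResolvent (E j - E j') (η ^ 2) (toL2 (conv w (transition χ j j'))))

/-- The integrand of the Hartree coefficient. -/
noncomputable def hartreeIntegrand (v : R3 → ℂ) (χ : HilbertBasis ℕ ℂ L2)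
    (k k' j j' : ℕ) : R3 → ℂ :=
  fun x => star (transition χ k k' x) * conv v (transition χ j j') x

/-- The Hartree coefficient `Λ_{k,k';j,j'} = ⟨conj χ_{k'} χ_k, v * (conj χ_{j'} χ_j)⟩`. -/
noncomputable def hartreeCoeff (v : R3 → ℂ) (χ : HilbertBasis ℕ ℂ L2) (k k' j j' : ℕ) : ℂ :=
  ∫ x, hartreeIntegrand v χ k k' j j' x

end ResonantCoefficients

namespace ResonantCoefficients

/-! ### Plancherel's identity for the Fourier integral of functions in L¹ ∩ L². -/

section Plancherel

variable {E : Type*} [NormedAddCommGroup E] [InnerProductSpace ℝ E] [FiniteDimensional ℝ E]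
  [MeasurableSpace E] [BorelSpace E]

/-! Weighted integrability of products of eigenfunctions comes from decay of a single eigenfunction
`f`. Testing the weak equation against a cutoff times a plane wave and using Plancherel gives an
energy inequality (`energy_inequality`): ∫ (V - E) ψ² |f|² ≤ ∫ (ψ Δψ + |∇ψ|²) |f|². It needs no
regularity of `f` beyond L². As V grows at infinity, annular cutoffs show that doubling the radius
multiplies the exterior mass of `f` by a factor as small as desired (`tailMass_double_le`). All
moments of |f|² are therefore finite, and the products follow by the arithmetic-geometric mean
inequality.

The resonant coefficients are bounded by a limiting absorption principle. A weighted Young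
inequality (`weighted_conv`) puts w * (conj χ_{k'} χ_k) in L²_s, so it suffices to bound ⟨g, (|∇| -
a + iε)⁻¹ h⟩ for g, h in L²_s. Writing the resolvent as -i ∫₀^∞ e^{it(|∇| - a + iε)} dt, everything
reduces to integrability in t of K(t) = ⟨g, e^{it|∇|} h⟩: the phase e^{-iat} and the damping e^{-εt}
have modulus at most 1, so ‖K‖_{L¹} is a bound uniform in ε and a, and dominated convergence gives
the limit (`resolvent_limit`).

For g, h supported in balls of radii R₁, R₂, polar coordinates on the Fourier side exhibit K as an
average over directions θ of one-dimensional Fourier transforms of r² conj(ĝ(rθ)) ĥ(rθ). Compact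
support costs a factor R per derivative of ĝ, and the Carlson-Beurling inequality
`lintegral_fourier_le` yields ‖K‖_{L¹} ≤ C √(R₁R₂) ‖g‖ ‖h‖ (`integrable_wavePairing`). Cutting
general g, h into dyadic shells, the (j,k) term is of size (√2 · 2^{-s})^{j+k}, which is summable
exactly when s > 1/2 (`limiting_absorption`).

The Hartree bound is the L^∞-L¹ estimate together with ‖χ_k χ_{k'}‖_{L¹} ≤ 1. -/

theorem integral_fourier_mul_eq {f g : E → ℂ} (hf : Integrable f) (hg : Integrable g) :
    ∫ x, 𝓕 f x * g x = ∫ x, f x * 𝓕 g x := by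
  simpa using! (VectorFourier.integral_fourierIntegral_smul_eq_flip (L := innerₗ E)
    Real.continuous_fourierChar continuous_inner hf hg)

/-- Links the L² transform to the Fourier integral: both are locally integrable, and against a test
function each moves the transform onto that function, one by the definition of the distributional
transform, the other by Fubini. -/
theorem fourier_toLp_ae_eq {g : E → ℂ} (h1 : Integrable g) (h2 : MemLp g 2) :
    ((𝓕 (h2.toLp g) : Lp (α := E) ℂ 2 volume) : E → ℂ) =ᵐ[volume] 𝓕 g := by
  have hcont : Continuous (𝓕 g) := VectorFourier.fourierIntegral_continuous
    Real.continuous_fourierChar continuous_inner h1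
  have hloc : LocallyIntegrable ((𝓕 (h2.toLp g) : Lp (α := E) ℂ 2 volume) : E → ℂ) volume :=
    (Lp.memLp _).locallyIntegrable (by norm_num)
  refine ae_eq_of_integral_contDiff_smul_eq hloc hcont.locallyIntegrable ?_
  intro φ hφ hφc
  set ψ : SchwartzMap E ℂ := HasCompactSupport.toSchwartzMap (f := fun x => (φ x : ℂ))
    (hφc.comp_left (g := ((↑) : ℝ → ℂ)) rfl) (Complex.ofRealCLM.contDiff.comp hφ) with hψ
  have key := congrArg (fun T => T ψ) (Lp.fourier_toTemperedDistribution_eq (h2.toLp g))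
  simp only [TemperedDistribution.fourier_apply, Lp.toTemperedDistribution_apply] at key
  have e1 : ∫ x, φ x • ((𝓕 (h2.toLp g) : Lp (α := E) ℂ 2 volume) : E → ℂ) x =
      ∫ x, ψ x • ((𝓕 (h2.toLp g) : Lp (α := E) ℂ 2 volume) : E → ℂ) x := by
    refine integral_congr_ae (Eventually.of_forall fun x => ?_)
    exact (Complex.real_smul).trans rfl
  have e2 : ∫ x, φ x • 𝓕 g x = ∫ x, ψ x • 𝓕 g x := by
    refine integral_congr_ae (Eventually.of_forall fun x => ?_)
    exact (Complex.real_smul).trans rfl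
  rw [e1, e2, ← key]
  have e3 : ∫ x, (𝓕 ψ) x • (h2.toLp g : E → ℂ) x = ∫ x, (𝓕 ψ) x • g x := by
    refine integral_congr_ae ?_
    filter_upwards [h2.coeFn_toLp] with x hx
    rw [hx]
  rw [e3]
  simp only [smul_eq_mul]
  rw [SchwartzMap.fourier_coe]
  exact integral_fourier_mul_eq ψ.integrable h1

theorem memLp_fourier {g : E → ℂ} (h1 : Integrable g) (h2 : MemLp g 2) : MemLp (𝓕 g) 2 :=
  (memLp_congr_ae (fourier_toLp_ae_eq h1 h2)).1 (Lp.memLp _)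

theorem integral_conj_fourier_mul_fourier {f g : E → ℂ} (hf1 : Integrable f) (hf2 : MemLp f 2)
    (hg1 : Integrable g) (hg2 : MemLp g 2) :
    ∫ x, star (𝓕 f x) * 𝓕 g x = ∫ x, star (f x) * g x := by
  have h := Lp.inner_fourier_eq (hf2.toLp f) (hg2.toLp g)
  rw [L2.inner_def, L2.inner_def] at h
  refine Eq.trans (integral_congr_ae ?_) (h.trans (integral_congr_ae ?_))
  · filter_upwards [fourier_toLp_ae_eq hf1 hf2, fourier_toLp_ae_eq hg1 hg2] with x h1 h2
    rw [h1, h2, RCLike.inner_apply, mul_comm]; rfl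
  · filter_upwards [hf2.coeFn_toLp, hg2.coeFn_toLp] with x h1 h2
    rw [h1, h2, RCLike.inner_apply, mul_comm]; rfl

theorem integrable_conj_mul {α : Type*} [MeasurableSpace α] {μ : Measure α} {f g : α → ℂ}
    (hf : MemLp f 2 μ) (hg : MemLp g 2 μ) : Integrable (fun x => star (f x) * g x) μ :=
  hf.star.integrable_mul hg

theorem integral_norm_sq_fourier {f : E → ℂ} (hf1 : Integrable f) (hf2 : MemLp f 2) :
    ∫ x, ‖𝓕 f x‖ ^ 2 = ∫ x, ‖f x‖ ^ 2 := by
  have h := integral_conj_fourier_mul_fourier hf1 hf2 hf1 hf2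
  have e : ∀ z : ℂ, star z * z = ((‖z‖ ^ 2 : ℝ) : ℂ) := fun z => by
    rw [Complex.star_def, mul_comm, Complex.mul_conj, Complex.normSq_eq_norm_sq]
  simp only [e] at h
  rw [integral_complex_ofReal, integral_complex_ofReal] at h
  exact_mod_cast h

end Plancherel

/-! ### Derivatives of a cutoff multiplied by a plane wave. -/

section TestFunctions

/-- The plane wave `x ↦ e^{-2πi x·ξ}`. -/
noncomputable def planeWave (ξ x : R3) : ℂ :=
  Complex.exp (((-2 * Real.pi * inner ℝ x ξ : ℝ) : ℂ) * Complex.I)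

/-- The derivative along the `l`-th coordinate. -/
noncomputable def pderiv (l : Fin 3) (ψ : R3 → ℝ) (x : R3) : ℝ :=
  fderiv ℝ ψ x (EuclideanSpace.basisFun (Fin 3) ℝ l)

theorem fourier_eq_integral_planeWave (f : R3 → ℂ) (ξ : R3) :
    𝓕 f ξ = ∫ x, planeWave ξ x * f x := by
  rw [Real.fourier_eq']; rfl

theorem hasFDerivAt_planeWave (ξ x : R3) :
    HasFDerivAt (planeWave ξ)
      ((planeWave ξ x) • ((Complex.I * (-2 * Real.pi : ℂ)) •
        (Complex.ofRealCLM.comp (innerSL ℝ ξ)))) x := by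
  have h1 : HasFDerivAt (fun y : R3 => inner ℝ y ξ) (innerSL ℝ ξ : R3 →L[ℝ] ℝ) x := by
    have := (innerSL ℝ ξ : R3 →L[ℝ] ℝ).hasFDerivAt (x := x)
    refine this.congr_of_eventuallyEq (Eventually.of_forall fun y => ?_)
    simp [real_inner_comm]
  have h2 := ((Complex.ofRealCLM.hasFDerivAt.comp x (h1.const_mul (-2 * Real.pi))).mul_const
    Complex.I).cexp
  refine h2.congr_fderiv ?_
  ext v
  simp [planeWave]
  ring_nf

theorem contDiff_planeWave (ξ : R3) : ContDiff ℝ ∞ (planeWave ξ) := by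
  unfold planeWave
  refine ContDiff.cexp (ContDiff.mul (Complex.ofRealCLM.contDiff.comp ?_) contDiff_const)
  exact contDiff_const.mul (contDiff_id.inner ℝ contDiff_const)

theorem fderiv_mul_planeWave {p : R3 → ℝ} {x : R3} (hp : DifferentiableAt ℝ p x) (ξ : R3)
    (l : Fin 3) :
    HasFDerivAt (fun y => (p y : ℂ) * planeWave ξ y)
      (fderiv ℝ (fun y => (p y : ℂ) * planeWave ξ y) x) x ∧
    fderiv ℝ (fun y => (p y : ℂ) * planeWave ξ y) x (EuclideanSpace.basisFun (Fin 3) ℝ l) =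
      ((pderiv l p x : ℂ) - 2 * Real.pi * Complex.I * ξ l * p x) * planeWave ξ x := by
  have h := (Complex.ofRealCLM.hasFDerivAt.comp x hp.hasFDerivAt).mul (hasFDerivAt_planeWave ξ x)
  have h' : HasFDerivAt (fun y => (p y : ℂ) * planeWave ξ y) _ x := h
  refine ⟨h'.differentiableAt.hasFDerivAt, ?_⟩
  rw [h'.fderiv]
  simp [pderiv, EuclideanSpace.inner_single_right]
  ring

theorem pderiv_contDiff {ψ : R3 → ℝ} (hψ : ContDiff ℝ ∞ ψ) (l : Fin 3) :
    ContDiff ℝ ∞ (pderiv l ψ) :=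
  (hψ.fderiv_right (m := ∞) (by simp)).clm_apply contDiff_const

/-- Conjugation by the plane wave turns ∂_l into ∂_l - 2πi ξ_l; the summands are the squares of
these operators applied to ψ. -/
theorem laplacian_mul_planeWave {ψ : R3 → ℝ} (hψ : ContDiff ℝ ∞ ψ) (ξ x : R3) :
    Laplacian.laplacian (fun y => (ψ y : ℂ) * planeWave ξ y) x =
      ∑ l, ((pderiv l (pderiv l ψ) x : ℂ) - 4 * Real.pi * Complex.I * ξ l * pderiv l ψ x
        - 4 * Real.pi ^ 2 * ξ l ^ 2 * ψ x) * planeWave ξ x := by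
  have hφ : ContDiff ℝ ∞ (fun y => (ψ y : ℂ) * planeWave ξ y) :=
    (Complex.ofRealCLM.contDiff.comp hψ).mul (contDiff_planeWave ξ)
  rw [InnerProductSpace.laplacian_eq_iteratedFDeriv_orthonormalBasis _
    (EuclideanSpace.basisFun (Fin 3) ℝ)]
  refine Finset.sum_congr rfl fun l _ => ?_
  rw [iteratedFDeriv_two_apply]
  have hd : DifferentiableAt ℝ (fderiv ℝ (fun y => (ψ y : ℂ) * planeWave ξ y)) x :=
    ((hφ.fderiv_right (m := ∞) (by simp)).differentiable (by simp)) x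
  have e1 : fderiv ℝ (fderiv ℝ (fun y => (ψ y : ℂ) * planeWave ξ y)) x
      (EuclideanSpace.basisFun (Fin 3) ℝ l) (EuclideanSpace.basisFun (Fin 3) ℝ l) =
      fderiv ℝ (fun y => fderiv ℝ (fun y => (ψ y : ℂ) * planeWave ξ y) y
        (EuclideanSpace.basisFun (Fin 3) ℝ l)) x (EuclideanSpace.basisFun (Fin 3) ℝ l) := by
    rw [fderiv_clm_apply hd (differentiableAt_const _)]
    simp
  have hd1 := hψ.differentiable (by simp)
  have hd2 := (pderiv_contDiff hψ l).differentiable (by simp)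
  have e2 : (fun y => fderiv ℝ (fun y => (ψ y : ℂ) * planeWave ξ y) y
        (EuclideanSpace.basisFun (Fin 3) ℝ l)) =
      fun y => (pderiv l ψ y : ℂ) * planeWave ξ y -
        (2 * Real.pi * Complex.I * ξ l) * ((ψ y : ℂ) * planeWave ξ y) := by
    funext y
    rw [(fderiv_mul_planeWave (hd1 y) ξ l).2]
    ring
  have e3 := ((fderiv_mul_planeWave (hd2 x) ξ l).1.sub
    ((fderiv_mul_planeWave (hd1 x) ξ l).1.const_mul (2 * Real.pi * Complex.I * ξ l))).fderiv
  simp only [Matrix.cons_val_zero, Matrix.cons_val_one]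
  rw [e1, e2]
  erw [e3]
  rw [sub_apply, smul_apply,
    (fderiv_mul_planeWave (hd2 x) ξ l).2, (fderiv_mul_planeWave (hd1 x) ξ l).2, smul_eq_mul]
  ring_nf
  simp only [Complex.I_sq]
  ring

end TestFunctions

/-! ### The localized energy inequality for a weak eigenfunction. -/

section EnergyInequality

theorem memLp_mul_of_hasCompactSupport {f : R3 → ℂ} (hf : MemLp f 2) {k : R3 → ℝ}
    (hk : Continuous k) (hkc : HasCompactSupport k) :
    MemLp (fun x => f x * (k x : ℂ)) 2 ∧ Integrable (fun x => f x * (k x : ℂ)) := by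
  have h1 : Continuous (fun x => (k x : ℂ)) := Complex.continuous_ofReal.comp hk
  have h2 : HasCompactSupport (fun x => (k x : ℂ)) :=
    hkc.comp_left (g := ((↑) : ℝ → ℂ)) rfl
  refine ⟨?_, ?_⟩
  · exact MemLp.mul (p := 2) (q := ∞) (r := 2) (h1.memLp_top_of_hasCompactSupport h2 volume) hf
  · exact hf.integrable_mul (q := 2) (h1.memLp_of_hasCompactSupport h2)

/-- Completing the square: expand 0 ≤ |P_l - 2πi ξ_l u|² for each l. With u and P_l the transforms
of ψf and f ∂_lψ, the difference in this square is formally minus the transform of ψ ∂_l f. -/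
theorem re_star_mul_le (u W L : ℂ) (P : Fin 3 → ℂ) (ξ : Fin 3 → ℝ)
    (h : W = L - ∑ l, (4 * Real.pi * Complex.I * ξ l * P l + 4 * Real.pi ^ 2 * ξ l ^ 2 * u)) :
    (star u * W).re ≤ (star u * L).re + ∑ l, ‖P l‖ ^ 2 := by
  have key : ∀ l, -(star u * (4 * Real.pi * Complex.I * ξ l * P l
      + 4 * Real.pi ^ 2 * ξ l ^ 2 * u)).re ≤ ‖P l‖ ^ 2 := by
    intro l
    have h0 := sq_nonneg ‖P l - Complex.I * ((2 * Real.pi * ξ l : ℝ) : ℂ) * u‖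
    rw [Complex.sq_norm, Complex.normSq_apply] at h0 ⊢
    simp [pow_two] at h0 ⊢
    nlinarith
  rw [h, mul_sub, Complex.sub_re, Finset.mul_sum, Complex.re_sum, sub_eq_add_neg,
    ← Finset.sum_neg_distrib]
  gcongr with l
  exact key l

theorem pderiv_hasCompactSupport {ψ : R3 → ℝ} (hc : HasCompactSupport ψ) (l : Fin 3) :
    HasCompactSupport (pderiv l ψ) :=
  (hc.fderiv ℝ).comp_left (g := fun T : R3 →L[ℝ] ℝ => T (EuclideanSpace.basisFun (Fin 3) ℝ l))
    (by simp)

theorem norm_planeWave (ξ x : R3) : ‖planeWave ξ x‖ = 1 := Complex.norm_exp_ofReal_mul_I _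

/-- The weak equation tested with ψ times a plane wave. All derivatives fall on the test function,
so `f` is only required to be in L². -/
theorem fourier_schrodinger_eq {V : R3 → ℝ} (hV : Continuous V) {f : R3 → ℂ} (hf : MemLp f 2)
    {E : ℝ} (hweak : ∀ φ : R3 → ℂ, ContDiff ℝ ∞ φ → HasCompactSupport φ →
      ∫ x, f x * (-(Laplacian.laplacian φ x) + (V x : ℂ) * φ x) = ∫ x, (E : ℂ) * f x * φ x)
    {ψ : R3 → ℝ} (hψ : ContDiff ℝ ∞ ψ) (hc : HasCompactSupport ψ) (ξ : R3) :
    𝓕 (fun x => f x * (((V x - E) * ψ x : ℝ) : ℂ)) ξ =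
      𝓕 (fun x => f x * ((∑ l, pderiv l (pderiv l ψ) x : ℝ) : ℂ)) ξ -
      ∑ l, (4 * Real.pi * Complex.I * ξ l * 𝓕 (fun x => f x * (pderiv l ψ x : ℂ)) ξ +
        4 * Real.pi ^ 2 * ξ l ^ 2 * 𝓕 (fun x => f x * (ψ x : ℂ)) ξ) := by
  have hint : ∀ k : R3 → ℝ, Continuous k → HasCompactSupport k →
      Integrable (fun x => planeWave ξ x * (f x * (k x : ℂ))) := fun k h1 h2 =>
    ((memLp_mul_of_hasCompactSupport hf h1 h2).2).bdd_mul (c := 1)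
      (contDiff_planeWave ξ).continuous.aestronglyMeasurable
      (Eventually.of_forall fun x => (norm_planeWave ξ x).le)
  have hd := fun l => pderiv_contDiff hψ l
  have hdd := fun l => pderiv_contDiff (hd l) l
  have hdc := fun l => pderiv_hasCompactSupport hc l
  have hddc := fun l => pderiv_hasCompactSupport (hdc l) l
  have hi0 := hint ψ hψ.continuous hc
  have hi1 := fun l => hint _ (hd l).continuous (hdc l)
  have hi2 := fun l => hint _ (hdd l).continuous (hddc l)
  have hiV := hint (fun x => (V x - E) * ψ x) (by fun_prop) hc.mul_left
  have hiV' := hint (fun x => V x * ψ x) (by fun_prop) hc.mul_left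
  have e := hweak (fun y => (ψ y : ℂ) * planeWave ξ y)
    ((Complex.ofRealCLM.contDiff.comp hψ).mul (contDiff_planeWave ξ))
    ((hc.comp_left (g := ((↑) : ℝ → ℂ)) rfl).mul_right)
  simp only [fourier_eq_integral_planeWave]
  have e1 : ∀ x, f x * (-(Laplacian.laplacian (fun y => (ψ y : ℂ) * planeWave ξ y) x)
      + (V x : ℂ) * ((ψ x : ℂ) * planeWave ξ x)) =
      planeWave ξ x * (f x * ((V x * ψ x : ℝ) : ℂ)) -
      ∑ l, (planeWave ξ x * (f x * (pderiv l (pderiv l ψ) x : ℂ)) -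
        (4 * Real.pi * Complex.I * ξ l * (planeWave ξ x * (f x * (pderiv l ψ x : ℂ))) +
        4 * Real.pi ^ 2 * ξ l ^ 2 * (planeWave ξ x * (f x * (ψ x : ℂ))))) := by
    intro x
    rw [laplacian_mul_planeWave hψ]
    simp only [Fin.sum_univ_three]
    push_cast
    ring
  simp only [e1] at e
  have hI : ∀ l ∈ (Finset.univ : Finset (Fin 3)), Integrable (fun x =>
      planeWave ξ x * (f x * (pderiv l (pderiv l ψ) x : ℂ)) -
        (4 * Real.pi * Complex.I * ξ l * (planeWave ξ x * (f x * (pderiv l ψ x : ℂ))) +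
        4 * Real.pi ^ 2 * ξ l ^ 2 * (planeWave ξ x * (f x * (ψ x : ℂ))))) := fun l _ =>
    (hi2 l).sub (((hi1 l).const_mul _).add (hi0.const_mul _))
  rw [integral_sub hiV' (integrable_finsetSum _ hI), integral_finsetSum _ hI] at e
  have e2 : ∀ l, ∫ x, (planeWave ξ x * (f x * (pderiv l (pderiv l ψ) x : ℂ)) -
        (4 * Real.pi * Complex.I * ξ l * (planeWave ξ x * (f x * (pderiv l ψ x : ℂ))) +
        4 * Real.pi ^ 2 * ξ l ^ 2 * (planeWave ξ x * (f x * (ψ x : ℂ))))) =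
      (∫ x, planeWave ξ x * (f x * (pderiv l (pderiv l ψ) x : ℂ))) -
      (4 * Real.pi * Complex.I * ξ l * (∫ x, planeWave ξ x * (f x * (pderiv l ψ x : ℂ))) +
        4 * Real.pi ^ 2 * ξ l ^ 2 * ∫ x, planeWave ξ x * (f x * (ψ x : ℂ))) := by
    intro l
    have hadd : Integrable (fun x =>
        4 * Real.pi * Complex.I * ξ l * (planeWave ξ x * (f x * (pderiv l ψ x : ℂ))) +
        4 * Real.pi ^ 2 * ξ l ^ 2 * (planeWave ξ x * (f x * (ψ x : ℂ)))) :=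
      ((hi1 l).const_mul _).add (hi0.const_mul _)
    rw [integral_sub (hi2 l) hadd, integral_add ((hi1 l).const_mul _) (hi0.const_mul _), integral_const_mul, integral_const_mul]
  simp only [e2] at e
  have e3 : ∫ x, planeWave ξ x * (f x * (((V x - E) * ψ x : ℝ) : ℂ)) =
      (∫ x, planeWave ξ x * (f x * ((V x * ψ x : ℝ) : ℂ))) -
        ∫ x, (E : ℂ) * f x * ((ψ x : ℂ) * planeWave ξ x) := by
    rw [← integral_sub hiV']
    · congr 1; funext x; push_cast; ring
    · refine (hi0.const_mul (E : ℂ)).congr (Eventually.of_forall fun x => ?_)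
      simp only
      ring
  have e4 : ∫ x, planeWave ξ x * (f x * ((∑ l, pderiv l (pderiv l ψ) x : ℝ) : ℂ)) =
      ∑ l, ∫ x, planeWave ξ x * (f x * (pderiv l (pderiv l ψ) x : ℂ)) := by
    rw [← integral_finsetSum _ fun l _ => hi2 l]
    congr 1; funext x; push_cast; rw [Finset.mul_sum, Finset.mul_sum]
  rw [e3, e4, ← e, Finset.sum_sub_distrib]
  ring

/-- Formally this is the identity for ψ²f with the nonnegative term ∫ |ψ∇f|² dropped. Here it is
obtained by integrating the frequencywise inequality `re_star_mul_le` and returning to x by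
Plancherel, which avoids ∇f. -/
theorem energy_inequality {V : R3 → ℝ} (hV : Continuous V) {f : R3 → ℂ} (hf : MemLp f 2)
    {E : ℝ} (hweak : ∀ φ : R3 → ℂ, ContDiff ℝ ∞ φ → HasCompactSupport φ →
      ∫ x, f x * (-(Laplacian.laplacian φ x) + (V x : ℂ) * φ x) = ∫ x, (E : ℂ) * f x * φ x)
    {ψ : R3 → ℝ} (hψ : ContDiff ℝ ∞ ψ) (hc : HasCompactSupport ψ) :
    ∫ x, (V x - E) * ψ x ^ 2 * ‖f x‖ ^ 2 ≤
      ∫ x, ((ψ x * ∑ l, pderiv l (pderiv l ψ) x) + ∑ l, pderiv l ψ x ^ 2) * ‖f x‖ ^ 2 := by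
  have hd := fun l => pderiv_contDiff hψ l
  have hdd := fun l => pderiv_contDiff (hd l) l
  have hdc := fun l => pderiv_hasCompactSupport hc l
  have hddc := fun l => pderiv_hasCompactSupport (hdc l) l
  have hm := fun (k : R3 → ℝ) h1 h2 => memLp_mul_of_hasCompactSupport hf (k := k) h1 h2
  have hLc : HasCompactSupport (fun x => ∑ l, pderiv l (pderiv l ψ) x) := by
    simp only [Fin.sum_univ_three]
    exact ((hddc 0).add (hddc 1)).add (hddc 2)
  have hLcont : Continuous (fun x => ∑ l, pderiv l (pderiv l ψ) x) :=
    continuous_finsetSum _ fun l _ => (hdd l).continuous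
  obtain ⟨u2, u1⟩ := hm ψ hψ.continuous hc
  obtain ⟨W2, W1⟩ := hm (fun x => (V x - E) * ψ x) (by fun_prop) hc.mul_left
  obtain ⟨L2', L1⟩ := hm _ hLcont hLc
  have P := fun l => hm _ (hd l).continuous (hdc l)
  have hpt := fun ξ : R3 => re_star_mul_le _ _ _ _ _ (fourier_schrodinger_eq hV hf hweak hψ hc ξ)
  have iW := integrable_conj_mul (memLp_fourier u1 u2) (memLp_fourier W1 W2)
  have iL := integrable_conj_mul (memLp_fourier u1 u2) (memLp_fourier L1 L2')
  have iP := fun l => (memLp_fourier (P l).2 (P l).1).integrable_norm_pow (by norm_num)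
  have hint := integral_mono iW.re (iL.re.add (integrable_finsetSum Finset.univ fun l _ => iP l))
    hpt
  have hre : ∀ {F : R3 → ℂ}, Integrable F → ∫ x, (F x).re = (∫ x, F x).re := fun hF =>
    integral_re hF
  have hof : ∀ k₁ k₂ : R3 → ℝ, (∫ x, star (f x * (k₁ x : ℂ)) * (f x * (k₂ x : ℂ))).re =
      ∫ x, k₁ x * k₂ x * ‖f x‖ ^ 2 := by
    intro k₁ k₂
    rw [← Complex.ofReal_re (∫ x, k₁ x * k₂ x * ‖f x‖ ^ 2), ← integral_complex_ofReal]
    congr 2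
    funext x
    rw [Complex.sq_norm]
    push_cast
    rw [← Complex.mul_conj]
    simp
    ring
  simp only [Pi.add_apply] at hint
  rw [integral_add iL.re (integrable_finsetSum Finset.univ fun l _ => iP l),
    integral_finsetSum _ fun l _ => iP l] at hint
  have q1 := (hre iW).trans (congrArg Complex.re (integral_conj_fourier_mul_fourier u1 u2 W1 W2))
  have q2 := (hre iL).trans (congrArg Complex.re (integral_conj_fourier_mul_fourier u1 u2 L1 L2'))
  rw [hof] at q1 q2
  have q3 : ∀ l, ∫ ξ, ‖𝓕 (fun x => f x * (pderiv l ψ x : ℂ)) ξ‖ ^ 2 =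
      ∫ x, pderiv l ψ x ^ 2 * ‖f x‖ ^ 2 := by
    intro l
    rw [integral_norm_sq_fourier (P l).2 (P l).1]
    congr 1; funext x
    rw [norm_mul, mul_pow, Complex.norm_real, Real.norm_eq_abs, sq_abs, mul_comm]
  have hbi : ∀ k : R3 → ℝ, Continuous k → HasCompactSupport k →
      Integrable (fun x => k x * ‖f x‖ ^ 2) := by
    intro k h1 h2
    obtain ⟨C, hC⟩ := h2.exists_bound_of_continuous h1
    exact (hf.integrable_norm_pow (by norm_num)).bdd_mul (c := C) h1.aestronglyMeasurable
      (Eventually.of_forall hC)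
  have r1 : ∫ x, ((ψ x * ∑ l, pderiv l (pderiv l ψ) x) + ∑ l, pderiv l ψ x ^ 2) * ‖f x‖ ^ 2 =
      (∫ x, ψ x * (∑ l, pderiv l (pderiv l ψ) x) * ‖f x‖ ^ 2) +
        ∑ l, ∫ x, pderiv l ψ x ^ 2 * ‖f x‖ ^ 2 := by
    have hi3 : ∀ l ∈ (Finset.univ : Finset (Fin 3)),
        Integrable (fun x => pderiv l ψ x ^ 2 * ‖f x‖ ^ 2) := fun l _ =>
      hbi _ ((hd l).continuous.pow 2) ((hdc l).comp_left (g := fun t => t ^ 2) (by simp))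
    rw [← integral_finsetSum _ hi3, ← integral_add]
    · congr 1; funext x; rw [add_mul, Finset.sum_mul]
    · exact hbi (fun x => ψ x * ∑ l, pderiv l (pderiv l ψ) x) (hψ.continuous.mul hLcont)
        hc.mul_right
    · exact integrable_finsetSum _ hi3
  have r2 : ∫ x, (V x - E) * ψ x ^ 2 * ‖f x‖ ^ 2 =
      ∫ x, ψ x * ((V x - E) * ψ x) * ‖f x‖ ^ 2 := by
    congr 1; funext x; ring
  rw [r1, r2, ← q1, ← q2]
  simp only [← q3]
  exact hint

end EnergyInequality

/-! ### Decay of the exterior mass of an eigenfunction. -/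

section Decay

theorem pderiv_comp_smul {b : R3 → ℝ} (hb : Differentiable ℝ b) (r : ℝ) (l : Fin 3) :
    pderiv l (fun x => b (r • x)) = fun x => r * pderiv l b (r • x) := by
  funext x
  have h : HasFDerivAt (fun y : R3 => b (r • y)) _ x :=
    (hb (r • x)).hasFDerivAt.comp x ((hasFDerivAt_id x).const_smul r)
  rw [pderiv, h.fderiv]
  simp [pderiv]

theorem pderiv_sub {a b : R3 → ℝ} (ha : Differentiable ℝ a) (hb : Differentiable ℝ b)
    (l : Fin 3) : pderiv l (fun x => a x - b x) = fun x => pderiv l a x - pderiv l b x := by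
  funext x
  have h : HasFDerivAt (fun y : R3 => a y - b y) _ x :=
    (ha x).hasFDerivAt.sub (hb x).hasFDerivAt
  rw [pderiv, h.fderiv]
  rfl

theorem pderiv_const_mul {a : R3 → ℝ} (ha : Differentiable ℝ a) (c : ℝ)
    (l : Fin 3) : pderiv l (fun x => c * a x) = fun x => c * pderiv l a x := by
  funext x
  have h : HasFDerivAt (fun y : R3 => c * a y) _ x := (ha x).hasFDerivAt.const_mul c
  rw [pderiv, h.fderiv]
  rfl

/-- The difference of two dilates of one bump. Dilation by radii at least 1 does not increase
derivatives, so one `K` serves all R and N. Below R the cutoff vanishes on an open set, hence so do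
its derivatives. -/
theorem exists_annular_cutoff : ∃ K : ℝ, 0 < K ∧ ∀ R N : ℝ, 1 ≤ R → 2 * R ≤ N →
    ∃ ψ : R3 → ℝ, ContDiff ℝ ∞ ψ ∧ HasCompactSupport ψ ∧
      (∀ x, 2 * R ≤ ‖x‖ → ‖x‖ ≤ N → ψ x = 1) ∧ (∀ x, ‖x‖ < R → ψ x = 0) ∧
      (∀ x, ‖x‖ < R → (ψ x * ∑ l, pderiv l (pderiv l ψ) x) + ∑ l, pderiv l ψ x ^ 2 = 0) ∧
      ∀ x, (ψ x * ∑ l, pderiv l (pderiv l ψ) x) + ∑ l, pderiv l ψ x ^ 2 ≤ K := by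
  let β : ContDiffBump (0 : R3) := ⟨1, 2, one_pos, one_lt_two⟩
  have hβ : ContDiff ℝ ∞ β := β.contDiff
  have hβc : HasCompactSupport β := β.hasCompactSupport
  have hb1 : ∀ l, ∃ C, ∀ x, ‖pderiv l β x‖ ≤ C := fun l =>
    (pderiv_hasCompactSupport hβc l).exists_bound_of_continuous (pderiv_contDiff hβ l).continuous
  have hb2 : ∀ l, ∃ C, ∀ x, ‖pderiv l (pderiv l β) x‖ ≤ C := fun l =>
    (pderiv_hasCompactSupport (pderiv_hasCompactSupport hβc l) l).exists_bound_of_continuous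
      (pderiv_contDiff (pderiv_contDiff hβ l) l).continuous
  choose C1 hC1 using hb1
  choose C2 hC2 using hb2
  have hC1p : ∀ l, 0 ≤ C1 l := fun l => (norm_nonneg _).trans (hC1 l 0)
  have hC2p : ∀ l, 0 ≤ C2 l := fun l => (norm_nonneg _).trans (hC2 l 0)
  -- Each derivative of ψ is a difference of two dilated derivatives, whence the factors 2; |ψ| ≤ 1
  -- takes care of the factor ψ, and the 1 ensures positivity.
  refine ⟨1 + ((∑ l, 2 * C2 l) + ∑ l, (2 * C1 l) ^ 2), ?_, ?_⟩
  · have : 0 ≤ (∑ l, 2 * C2 l) := Finset.sum_nonneg fun l _ => by linarith [hC2p l]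
    have : 0 ≤ (∑ l, (2 * C1 l) ^ 2) := Finset.sum_nonneg fun l _ => sq_nonneg _
    linarith
  intro R N hR hN
  have hR0 : 0 < R := by linarith
  have hN0 : 0 < N := by linarith
  have hsm : ∀ r : ℝ, ContDiff ℝ ∞ (fun x : R3 => β (r • x)) := fun r =>
    hβ.comp (contDiff_const_smul r)
  have hsd := fun r => (hsm r).differentiable (by simp)
  have hβd := hβ.differentiable (by simp)
  have hβd' := fun l => (pderiv_contDiff hβ l).differentiable (by simp)
  have hsc : ∀ r : ℝ, r ≠ 0 → HasCompactSupport (fun x : R3 => β (r • x)) := fun r hr =>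
    hβc.comp_smul hr
  have hone : ∀ r : ℝ, 0 < r → ∀ x : R3, ‖x‖ ≤ r → β (r⁻¹ • x) = 1 := fun r hr x hx =>
    β.one_of_mem_closedBall (by
      rw [mem_closedBall_zero_iff, norm_smul, norm_inv, Real.norm_of_nonneg hr.le]
      show r⁻¹ * ‖x‖ ≤ 1
      rw [inv_mul_le_iff₀ hr]; linarith)
  have hzero : ∀ r : ℝ, 0 < r → ∀ x : R3, 2 * r ≤ ‖x‖ → β (r⁻¹ • x) = 0 := fun r hr x hx =>
    β.zero_of_le_dist (by
      rw [dist_zero_right, norm_smul, norm_inv, Real.norm_of_nonneg hr.le]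
      show 2 ≤ r⁻¹ * ‖x‖
      rw [le_inv_mul_iff₀ hr]; linarith)
  set ψ : R3 → ℝ := fun x => β (N⁻¹ • x) - β (R⁻¹ • x) with hψ
  have hψz : ∀ x, ‖x‖ < R → ψ x = 0 := fun x hx => by
    simp only [hψ]; rw [hone N hN0 x (by linarith), hone R hR0 x hx.le, sub_self]
  have hD : ∀ l, pderiv l ψ = fun x => N⁻¹ * pderiv l β (N⁻¹ • x) - R⁻¹ * pderiv l β (R⁻¹ • x) := by
    intro l
    rw [hψ, pderiv_sub (hsd _) (hsd _), pderiv_comp_smul hβd, pderiv_comp_smul hβd]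
  have hDD : ∀ l, pderiv l (pderiv l ψ) = fun x => N⁻¹ * (N⁻¹ * pderiv l (pderiv l β) (N⁻¹ • x)) -
      R⁻¹ * (R⁻¹ * pderiv l (pderiv l β) (R⁻¹ • x)) := by
    intro l
    have hd : ∀ r : ℝ, Differentiable ℝ (fun x : R3 => pderiv l β (r • x)) := fun r =>
      (hβd' l).comp (differentiable_id.const_smul r)
    rw [hD, pderiv_sub ((hd _).const_mul _) ((hd _).const_mul _), pderiv_const_mul (hd _),
      pderiv_const_mul (hd _), pderiv_comp_smul (hβd' l), pderiv_comp_smul (hβd' l)]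
  have hNi : |N⁻¹| ≤ 1 := by rw [abs_of_pos (by positivity)]; exact inv_le_one_of_one_le₀ (by linarith)
  have hRi : |R⁻¹| ≤ 1 := by rw [abs_of_pos (by positivity)]; exact inv_le_one_of_one_le₀ hR
  have hm : ∀ a b C : ℝ, |a| ≤ 1 → |b| ≤ C → |a * b| ≤ C := fun a b C ha hb => by
    rw [abs_mul]
    calc |a| * |b| ≤ 1 * |b| := by gcongr
      _ ≤ C := by rwa [one_mul]
  refine ⟨ψ, (hsm _).sub (hsm _), (hsc _ (by positivity)).sub (hsc _ (by positivity)), ?_, hψz,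
    ?_, ?_⟩
  · intro x h1 h2
    simp only [hψ]; rw [hone N hN0 x h2, hzero R hR0 x h1, sub_zero]
  · intro x hx
    rw [hψz x hx, zero_mul, zero_add]
    refine Finset.sum_eq_zero fun l _ => ?_
    have : ψ =ᶠ[𝓝 x] fun _ => 0 := by
      filter_upwards [(isOpen_lt continuous_norm continuous_const).mem_nhds hx] with y hy
      exact hψz y hy
    rw [pderiv, this.fderiv_eq]
    simp
  · intro x
    have h1 : |ψ x| ≤ 1 := by
      have := β.nonneg (x := N⁻¹ • x)
      have := β.nonneg (x := R⁻¹ • x)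
      have := β.le_one (x := N⁻¹ • x)
      have := β.le_one (x := R⁻¹ • x)
      simp only [hψ]
      rw [abs_le]; constructor <;> linarith
    have h2 : |∑ l, pderiv l (pderiv l ψ) x| ≤ ∑ l, 2 * C2 l := by
      refine (Finset.abs_sum_le_sum_abs _ _).trans (Finset.sum_le_sum fun l _ => ?_)
      rw [hDD]
      refine (abs_sub _ _).trans ?_
      have := hm _ _ _ hNi (hm _ _ _ hNi (hC2 l (N⁻¹ • x)))
      have := hm _ _ _ hRi (hm _ _ _ hRi (hC2 l (R⁻¹ • x)))
      linarith
    have h3 : ∀ l, pderiv l ψ x ^ 2 ≤ (2 * C1 l) ^ 2 := by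
      intro l
      rw [← sq_abs]
      gcongr
      rw [hD]
      refine (abs_sub _ _).trans ?_
      have := hm _ _ _ hNi (hC1 l (N⁻¹ • x))
      have := hm _ _ _ hRi (hC1 l (R⁻¹ • x))
      linarith
    have h4 := le_of_abs_le (hm _ _ _ h1 h2)
    have h5 := Finset.sum_le_sum fun l (_ : l ∈ (Finset.univ : Finset (Fin 3))) => h3 l
    linarith

/-- The mass of `f` outside the ball of radius `R`. -/
noncomputable def tailMass (f : R3 → ℂ) (R : ℝ) : ℝ := ∫ x in {x : R3 | R ≤ ‖x‖}, ‖f x‖ ^ 2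

/-- For large R, V - E ≥ K/δ wherever the cutoff is nonzero, while the right side of the energy
inequality lives in ‖x‖ ≥ R and is at most K times the mass there. Dividing by K/δ gives the factor
δ. -/
theorem tailMass_double_le {V : R3 → ℝ} (hV : IsConfining V) {f : R3 → ℂ} (hf : MemLp f 2)
    {E : ℝ} (hweak : ∀ φ : R3 → ℂ, ContDiff ℝ ∞ φ → HasCompactSupport φ →
      ∫ x, f x * (-(Laplacian.laplacian φ x) + (V x : ℂ) * φ x) = ∫ x, (E : ℂ) * f x * φ x)
    {δ : ℝ} (hδ : 0 < δ) :
    ∃ R₀ : ℝ, 1 ≤ R₀ ∧ ∀ R, R₀ ≤ R → tailMass f (2 * R) ≤ δ * tailMass f R := by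
  obtain ⟨hVs, c, C₀, hc, hC₀, hVb⟩ := hV
  obtain ⟨K, hK, hcut⟩ := exists_annular_cutoff
  -- This radius makes cR - C₀ - |E| ≥ K/δ.
  refine ⟨max 1 ((C₀ + |E| + K / δ) / c), le_max_left _ _, fun R hR => ?_⟩
  have hR1 : 1 ≤ R := (le_max_left _ _).trans hR
  have hR2 : C₀ + |E| + K / δ ≤ c * R := by
    have := (le_max_right _ _).trans hR
    rwa [div_le_iff₀ hc, mul_comm] at this
  have hi : Integrable (fun x => ‖f x‖ ^ 2) := hf.integrable_norm_pow (by norm_num)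
  have hmR : ∀ r : ℝ, MeasurableSet {x : R3 | r ≤ ‖x‖} := fun r =>
    (isClosed_le continuous_const continuous_norm).measurableSet
  have hVR : ∀ x : R3, R ≤ ‖x‖ → K / δ ≤ V x - E := fun x hx => by
    have := hVb x
    have := le_abs_self E
    have : c * R ≤ c * ‖x‖ := by gcongr
    linarith
  have hKδ : 0 < K / δ := by positivity
  have hann : ∀ n : ℕ, K / δ * ∫ x in {x : R3 | 2 * R ≤ ‖x‖ ∧ ‖x‖ ≤ n}, ‖f x‖ ^ 2
      ≤ K * tailMass f R := by
    intro n
    have hmA : MeasurableSet {x : R3 | 2 * R ≤ ‖x‖ ∧ ‖x‖ ≤ n} :=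
      (hmR (2 * R)).inter (isClosed_le continuous_norm continuous_const).measurableSet
    -- The cutoff needs outer radius at least 2R; for n < 2R the annulus in question is empty and
    -- nothing is lost.
    obtain ⟨ψ, h1, h2, h3, h4, h5, h6⟩ := hcut R (max (2 * R) n) hR1 (le_max_left _ _)
    have hb : Integrable (fun x => (V x - E) * ψ x ^ 2 * ‖f x‖ ^ 2) := by
      have hcont : Continuous (fun x => (V x - E) * ψ x ^ 2) := by
        have := hVs.continuous
        have := h1.continuous
        fun_prop
      have hcs : HasCompactSupport (fun x => (V x - E) * ψ x ^ 2) :=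
        (h2.comp_left (g := fun t => t ^ 2) (by simp)).mul_left
      obtain ⟨C, hC⟩ := hcs.exists_bound_of_continuous hcont
      exact hi.bdd_mul (c := C) hcont.aestronglyMeasurable (Eventually.of_forall hC)
    calc K / δ * ∫ x in {x : R3 | 2 * R ≤ ‖x‖ ∧ ‖x‖ ≤ n}, ‖f x‖ ^ 2
        = ∫ x, {x : R3 | 2 * R ≤ ‖x‖ ∧ ‖x‖ ≤ n}.indicator (fun x => K / δ * ‖f x‖ ^ 2) x := by
          rw [integral_indicator hmA, integral_const_mul]
      _ ≤ ∫ x, (V x - E) * ψ x ^ 2 * ‖f x‖ ^ 2 := by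
          refine integral_mono ((hi.const_mul _).indicator hmA) hb fun x => ?_
          by_cases hx : x ∈ {x : R3 | 2 * R ≤ ‖x‖ ∧ ‖x‖ ≤ n}
          · rw [Set.indicator_of_mem hx]
            simp only
            rw [h3 x hx.1 (hx.2.trans (le_max_right _ _)), one_pow, mul_one]
            gcongr
            exact hVR x (by linarith [hx.1])
          · rw [Set.indicator_of_notMem hx]
            by_cases hxR : R ≤ ‖x‖
            · have := hKδ.le.trans (hVR x hxR)
              positivity
            · rw [h4 x (not_le.1 hxR)]; simp
      _ ≤ _ := energy_inequality hVs.continuous hf hweak h1 h2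
      _ ≤ ∫ x, {x : R3 | R ≤ ‖x‖}.indicator (fun x => K * ‖f x‖ ^ 2) x := by
          have hnn : ∀ x, 0 ≤ {x : R3 | R ≤ ‖x‖}.indicator (fun x => K * ‖f x‖ ^ 2) x :=
            Set.indicator_nonneg fun x _ => by positivity
          by_cases hI : Integrable (fun x => ((ψ x * ∑ l, pderiv l (pderiv l ψ) x)
            + ∑ l, pderiv l ψ x ^ 2) * ‖f x‖ ^ 2)
          · refine integral_mono hI ((hi.const_mul _).indicator (hmR R)) fun x => ?_
            by_cases hx : R ≤ ‖x‖
            · rw [Set.indicator_of_mem (show x ∈ {x : R3 | R ≤ ‖x‖} from hx)]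
              simp only
              gcongr
              exact h6 x
            · simp only
              rw [h5 x (not_le.1 hx), zero_mul]
              exact hnn x
          -- A non-integrable integrand has integral 0 by convention, so the bound holds in this
          -- case as well.
          · rw [integral_undef hI]
            exact integral_nonneg hnn
      _ = K * tailMass f R := by
          rw [integral_indicator (hmR R), integral_const_mul]; rfl
  -- The outer radius was finite only to keep ψ compactly supported; it is now sent to infinity.
  have hlim : Tendsto (fun n : ℕ => ∫ x in {x : R3 | 2 * R ≤ ‖x‖ ∧ ‖x‖ ≤ n}, ‖f x‖ ^ 2) atTop
      (𝓝 (tailMass f (2 * R))) := by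
    have hU : (⋃ n : ℕ, {x : R3 | 2 * R ≤ ‖x‖ ∧ ‖x‖ ≤ n}) = {x : R3 | 2 * R ≤ ‖x‖} := by
      ext x
      simp only [Set.mem_iUnion, Set.mem_ofPred_eq]
      exact ⟨fun ⟨n, h⟩ => h.1, fun h => ⟨_, h, (Nat.le_ceil ‖x‖)⟩⟩
    rw [tailMass, ← hU]
    refine tendsto_setIntegral_of_monotone (fun n => (hmR (2 * R)).inter
      (isClosed_le continuous_norm continuous_const).measurableSet) ?_ hi.integrableOn
    intro m n hmn x hx
    exact ⟨hx.1, hx.2.trans (by exact_mod_cast hmn)⟩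
  have hfin := le_of_tendsto' (hlim.const_mul (K / δ)) hann
  have : K / δ * tailMass f (2 * R) ≤ K / δ * (δ * tailMass f R) := by
    refine hfin.trans (le_of_eq ?_)
    field_simp
  exact le_of_mul_le_mul_left this hKδ

end Decay

/-! ### Finite moments of eigenfunctions and weighted integrability of their products. -/

section Moments

/-- Where ‖x‖ lies between 2^j R₀ and 2^{j+1} R₀, the weight is at most (2^{j+1} R₀)^p, and iterated
doubling bounds the mass by 2^{-(p+1)j} times a constant. -/
theorem integrable_pow_mul_of_tailMass {f : R3 → ℂ} (hf : MemLp f 2)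
    (h : ∀ δ : ℝ, 0 < δ → ∃ R₀ : ℝ, 1 ≤ R₀ ∧ ∀ R, R₀ ≤ R → tailMass f (2 * R) ≤ δ * tailMass f R)
    (p : ℕ) : Integrable (fun x => ‖x‖ ^ p * ‖f x‖ ^ 2) := by
  -- One power beyond p leaves a geometric series of ratio 1/2 after the weight is absorbed.
  obtain ⟨R₀, hR₀, hT⟩ := h ((1 / 2) ^ (p + 1)) (by positivity)
  have hR0 : 0 < R₀ := by linarith
  have hi : Integrable (fun x => ‖f x‖ ^ 2) := hf.integrable_norm_pow (by norm_num)
  have hmR : ∀ r : ℝ, MeasurableSet {x : R3 | r ≤ ‖x‖} := fun r =>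
    (isClosed_le continuous_const continuous_norm).measurableSet
  have hTj : ∀ j : ℕ, tailMass f (2 ^ j * R₀) ≤ ((1 / 2) ^ (p + 1)) ^ j * tailMass f R₀ := by
    intro j
    induction j with
    | zero => simp
    | succ j ih =>
      have h1 : R₀ ≤ 2 ^ j * R₀ := le_mul_of_one_le_left hR0.le (one_le_pow₀ (by norm_num))
      calc tailMass f (2 ^ (j + 1) * R₀) = tailMass f (2 * (2 ^ j * R₀)) := by ring_nf
        _ ≤ (1 / 2) ^ (p + 1) * tailMass f (2 ^ j * R₀) := hT _ h1
        _ ≤ (1 / 2) ^ (p + 1) * (((1 / 2) ^ (p + 1)) ^ j * tailMass f R₀) := by gcongr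
        _ = _ := by ring
  have hT0 : 0 ≤ tailMass f R₀ := integral_nonneg fun x => by positivity
  refine ⟨(continuous_norm.pow p).aestronglyMeasurable.mul hi.1, ?_⟩
  rw [hasFiniteIntegral_iff_ofReal (Eventually.of_forall fun x => by positivity)]
  set A : ℕ → Set R3 := fun j => {x : R3 | 2 ^ j * R₀ ≤ ‖x‖} with hA
  -- Each point beyond R₀ lies in one dyadic shell; using the nested exteriors `A j` instead of
  -- shells only overcounts.
  have hpt : ∀ x : R3, ENNReal.ofReal (‖x‖ ^ p * ‖f x‖ ^ 2) ≤
      ENNReal.ofReal (R₀ ^ p * ‖f x‖ ^ 2) +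
      ∑' j, (A j).indicator (fun x => ENNReal.ofReal ((2 ^ (j + 1) * R₀) ^ p * ‖f x‖ ^ 2)) x := by
    intro x
    by_cases hx : ‖x‖ ≤ R₀
    · refine le_add_right (ENNReal.ofReal_le_ofReal ?_)
      gcongr
    · push Not at hx
      obtain ⟨j, hj1, hj2⟩ := exists_nat_pow_near (x := ‖x‖ / R₀) (y := (2 : ℝ))
        (by rw [le_div_iff₀ hR0]; linarith) (by norm_num)
      rw [le_div_iff₀ hR0] at hj1
      rw [div_lt_iff₀ hR0] at hj2
      refine le_add_left (le_trans ?_ (ENNReal.le_tsum j))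
      rw [Set.indicator_of_mem (show x ∈ A j from hj1)]
      refine ENNReal.ofReal_le_ofReal ?_
      gcongr
  have hmeas : ∀ c : ℝ, AEMeasurable (fun x => ENNReal.ofReal (c * ‖f x‖ ^ 2)) volume := fun c =>
    (hi.1.const_mul c).aemeasurable.ennreal_ofReal
  refine (lintegral_mono hpt).trans_lt ?_
  rw [lintegral_add_left' (hmeas _), lintegral_tsum fun j => (hmeas _).indicator (hmR _)]
  refine ENNReal.add_lt_top.2 ⟨?_, ?_⟩
  · exact (hasFiniteIntegral_iff_ofReal (Eventually.of_forall fun x => by positivity)).1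
      (hi.const_mul (R₀ ^ p)).2
  · have hterm : ∀ j, ∫⁻ x, (A j).indicator
        (fun x => ENNReal.ofReal ((2 ^ (j + 1) * R₀) ^ p * ‖f x‖ ^ 2)) x ≤
        ENNReal.ofReal ((2 * R₀) ^ p * tailMass f R₀ * (1 / 2) ^ j) := by
      intro j
      rw [lintegral_indicator (hmR _), ← ofReal_integral_eq_lintegral_ofReal
        (hi.const_mul _).integrableOn (Eventually.of_forall fun x => by positivity)]
      refine ENNReal.ofReal_le_ofReal ?_
      rw [integral_const_mul]
      calc (2 ^ (j + 1) * R₀) ^ p * tailMass f (2 ^ j * R₀)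
          ≤ (2 ^ (j + 1) * R₀) ^ p * (((1 / 2) ^ (p + 1)) ^ j * tailMass f R₀) := by
            gcongr; exact hTj j
        _ = (2 * R₀) ^ p * tailMass f R₀ * (1 / 2) ^ j * ((2 ^ j) ^ p * ((1 / 2) ^ p) ^ j) := by
            ring
        _ = _ := by
            rw [← pow_mul, ← pow_mul, mul_comm j p, ← mul_pow]; norm_num
    refine (ENNReal.tsum_le_tsum hterm).trans_lt ?_
    refine lt_top_iff_ne_top.2 (Summable.tsum_ofReal_ne_top ?_)
    exact (summable_geometric_of_lt_one (by norm_num) (by norm_num)).mul_left _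

theorem one_le_bracket (x : R3) : 1 ≤ bracket x := by
  rw [bracket, Real.one_le_sqrt]; nlinarith [norm_nonneg x]

theorem bracket_pos (x : R3) : 0 < bracket x := zero_lt_one.trans_le (one_le_bracket x)

theorem continuous_bracket : Continuous bracket := by
  unfold bracket; fun_prop

theorem continuous_bracket_rpow (s : ℝ) : Continuous fun x => bracket x ^ s :=
  continuous_bracket.rpow_const fun x => Or.inl (bracket_pos x).ne'

theorem bracket_le (x : R3) : bracket x ≤ 1 + ‖x‖ := by
  rw [bracket]
  apply Real.sqrt_le_iff.2
  constructor
  · positivity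
  · nlinarith [norm_nonneg x]

theorem integrable_bracket_mul_of_moments {f : R3 → ℂ} (hf : MemLp f 2)
    (h : ∀ p : ℕ, Integrable (fun x => ‖x‖ ^ p * ‖f x‖ ^ 2)) (s : ℝ) :
    Integrable (fun x => bracket x ^ s * ‖f x‖ ^ 2) := by
  obtain ⟨p, hp⟩ := exists_nat_ge s
  have hi : Integrable (fun x => ‖f x‖ ^ 2) := hf.integrable_norm_pow (by norm_num)
  refine ((hi.add (h p)).const_mul (2 ^ p)).mono'
    ((continuous_bracket_rpow s).aestronglyMeasurable.mul hi.1) (Eventually.of_forall fun x => ?_)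
  have hb := bracket_pos x
  rw [Real.norm_of_nonneg (by positivity)]
  have h1 : bracket x ^ s ≤ 2 ^ p * (1 + ‖x‖ ^ p) := by
    calc bracket x ^ s ≤ bracket x ^ (p : ℝ) :=
          Real.rpow_le_rpow_of_exponent_le (one_le_bracket x) hp
      _ = bracket x ^ p := Real.rpow_natCast _ _
      _ ≤ (1 + ‖x‖) ^ p := by gcongr; exact bracket_le x
      -- For p = 0 the truncated exponent is 0 and the bound reads 1 ≤ 2.
      _ ≤ 2 ^ (p - 1) * (1 ^ p + ‖x‖ ^ p) := add_pow_le zero_le_one (norm_nonneg _) p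
      _ ≤ 2 ^ p * (1 + ‖x‖ ^ p) := by
        rw [one_pow]
        gcongr
        · norm_num
        · omega
  calc bracket x ^ s * ‖f x‖ ^ 2 ≤ (2 ^ p * (1 + ‖x‖ ^ p)) * ‖f x‖ ^ 2 := by gcongr
    _ = _ := by simp only [Pi.add_apply]; ring

/-- The product is dominated by |χ_k|² + |χ_{k'}|², so the weighted mass of single eigenfunctions
suffices. -/
theorem memLp_weighted_transition {V : R3 → ℝ} {χ : HilbertBasis ℕ ℂ L2} {E : ℕ → ℝ}
    (hV : IsConfining V) (hχ : IsEigenbasis V χ E) (s : ℝ) (k k' : ℕ) :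
    MemLp (weighted s (transition χ k k')) 1 := by
  have hw : ∀ k, Integrable (fun x => bracket x ^ s * ‖χ k x‖ ^ 2) := by
    intro k
    have hm : MemLp (χ k : R3 → ℂ) 2 := Lp.memLp _
    refine integrable_bracket_mul_of_moments hm (integrable_pow_mul_of_tailMass hm ?_) s
    intro δ hδ
    refine tailMass_double_le hV hm (E := E k) ?_ hδ
    intro φ h1 h2
    rw [hχ k φ h1 h2]
    refine integral_congr_ae ?_
    filter_upwards [Lp.coeFn_smul (E k : ℂ) (χ k)] with x hx
    rw [hx]; rfl
  have hm : ∀ k, AEStronglyMeasurable (χ k : R3 → ℂ) volume := fun k => (Lp.memLp _).1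
  rw [memLp_one_iff_integrable]
  refine ((hw k).add (hw k')).mono' ?_ (Eventually.of_forall fun x => ?_)
  · exact (Complex.continuous_ofReal.comp (continuous_bracket_rpow s)).aestronglyMeasurable.mul
      ((hm k').star.mul (hm k))
  · have hb : 0 < bracket x ^ s := Real.rpow_pos_of_pos (bracket_pos x) s
    simp only [weighted, transition, norm_mul, norm_star, Complex.norm_real, Pi.add_apply,
      Real.norm_of_nonneg hb.le]
    nlinarith [sq_nonneg (‖χ k x‖ - ‖χ k' x‖), mul_nonneg hb.le (sq_nonneg (‖χ k x‖ - ‖χ k' x‖)),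
      mul_nonneg hb.le (sq_nonneg ‖χ k x‖), mul_nonneg hb.le (sq_nonneg ‖χ k' x‖)]

end Moments

/-! ### Young's inequality in weighted spaces. -/

section Young

/-- Cauchy-Schwarz on f g = (f² g)^{1/2} g^{1/2}, then Tonelli. Working with values in [0, ∞] makes
existence of the convolution a consequence, not an assumption. -/
theorem lintegral_sq_lconvolution_le {f g : R3 → ℝ≥0∞} (hf : AEMeasurable f) (hg : AEMeasurable g) :
    AEMeasurable (fun x => ∫⁻ y, f y * g (x - y)) ∧
    ∫⁻ x, (∫⁻ y, f y * g (x - y)) ^ 2 ≤ (∫⁻ y, f y ^ 2) * (∫⁻ y, g y) ^ 2 := by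
  have hgp : AEMeasurable (fun p : R3 × R3 => g (p.1 - p.2)) (volume.prod volume) :=
    hg.comp_quasiMeasurePreserving (quasiMeasurePreserving_sub volume volume)
  have hfp : AEMeasurable (fun p : R3 × R3 => f p.2) (volume.prod volume) :=
    hf.comp_quasiMeasurePreserving Measure.quasiMeasurePreserving_snd
  refine ⟨(hfp.mul hgp).lintegral_prod_right', ?_⟩
  have hgx : ∀ x, AEMeasurable (fun y => g (x - y)) := fun x =>
    hg.comp_quasiMeasurePreserving (quasiMeasurePreserving_sub_left volume x)
  have hcs : ∀ x, (∫⁻ y, f y * g (x - y)) ^ 2 ≤ (∫⁻ y, f y ^ 2 * g (x - y)) * ∫⁻ y, g y := by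
    intro x
    have h := ENNReal.lintegral_mul_norm_pow_le (μ := volume) (p := 1 / 2) (q := 1 / 2)
      ((hf.pow_const 2).mul (hgx x)) (hgx x) (by norm_num) (by norm_num) (by norm_num)
    have e : ∀ y, (f y ^ 2 * g (x - y)) ^ (1 / 2 : ℝ) * g (x - y) ^ (1 / 2 : ℝ) =
        f y * g (x - y) := by
      intro y
      rw [ENNReal.mul_rpow_of_nonneg _ _ (by norm_num), mul_assoc,
        ← ENNReal.rpow_add_of_nonneg _ _ (by norm_num) (by norm_num), ← ENNReal.rpow_natCast,
        ← ENNReal.rpow_mul]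
      norm_num
    simp only [Pi.mul_apply, e] at h
    rw [lintegral_sub_left_eq_self g x] at h
    calc (∫⁻ y, f y * g (x - y)) ^ 2
        ≤ ((∫⁻ y, f y ^ 2 * g (x - y)) ^ (1 / 2 : ℝ) * (∫⁻ y, g y) ^ (1 / 2 : ℝ)) ^ 2 := by
          gcongr
      _ = _ := by
          rw [mul_pow, ← ENNReal.rpow_mul_natCast, ← ENNReal.rpow_mul_natCast]
          norm_num
  calc ∫⁻ x, (∫⁻ y, f y * g (x - y)) ^ 2
      ≤ ∫⁻ x, (∫⁻ y, f y ^ 2 * g (x - y)) * ∫⁻ y, g y := lintegral_mono hcs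
    _ = (∫⁻ x, ∫⁻ y, f y ^ 2 * g (x - y)) * ∫⁻ y, g y :=
        lintegral_mul_const'' _ ((hfp.pow_const 2).mul hgp).lintegral_prod_right'
    _ = (∫⁻ y, f y ^ 2 * ∫⁻ x, g x) * ∫⁻ y, g y := by
        rw [lintegral_lintegral_swap ((hfp.pow_const 2).mul hgp)]
        congr 2
        funext y
        rw [lintegral_const_mul'', lintegral_sub_right_eq_self g y]
        exact hg.comp_quasiMeasurePreserving (measurePreserving_sub_right volume y).quasiMeasurePreserving
    _ = _ := by
        rw [lintegral_mul_const'' _ (hf.pow_const 2)]; ring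

/-- Peetre's inequality, from 1 + (a + b)² ≤ 4 (1 + a²)(1 + b²). -/
theorem bracket_le_mul (x y : R3) : bracket x ≤ 2 * (bracket y * bracket (x - y)) := by
  have h : ‖x‖ ≤ ‖y‖ + ‖x - y‖ := by
    calc ‖x‖ = ‖y + (x - y)‖ := by congr 1; abel
      _ ≤ _ := norm_add_le _ _
  have h2 : (2 : ℝ) = Real.sqrt 4 := by rw [show (4 : ℝ) = 2 ^ 2 by norm_num]; simp
  rw [bracket, bracket, bracket, ← Real.sqrt_mul (by positivity), h2, ← Real.sqrt_mul (by norm_num)]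
  apply Real.sqrt_le_sqrt
  have := norm_nonneg x
  have : ‖x‖ ^ 2 ≤ (‖y‖ + ‖x - y‖) ^ 2 := by gcongr
  nlinarith [sq_nonneg (‖y‖ - ‖x - y‖), mul_nonneg (sq_nonneg ‖y‖) (sq_nonneg ‖x - y‖),
    sq_nonneg ‖y‖, sq_nonneg ‖x - y‖]

theorem bracket_rpow_le_mul {s : ℝ} (hs : 0 ≤ s) (x y : R3) :
    bracket x ^ s ≤ 2 ^ s * (bracket y ^ s * bracket (x - y) ^ s) := by
  have := bracket_pos y
  have := bracket_pos (x - y)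
  rw [← Real.mul_rpow (by positivity) (by positivity), ← Real.mul_rpow (by norm_num) (by positivity)]
  exact Real.rpow_le_rpow (bracket_pos x).le (bracket_le_mul x y) hs

theorem norm_weighted (s : ℝ) (f : R3 → ℂ) (x : R3) :
    ‖weighted s f x‖ = bracket x ^ s * ‖f x‖ := by
  rw [weighted, norm_mul, Complex.norm_real,
    Real.norm_of_nonneg (Real.rpow_nonneg (bracket_pos x).le s)]

theorem norm_le_norm_weighted {s : ℝ} (hs : 0 ≤ s) (f : R3 → ℂ) (x : R3) :
    ‖f x‖ ≤ ‖weighted s f x‖ := by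
  rw [norm_weighted]
  exact le_mul_of_one_le_left (norm_nonneg _) (Real.one_le_rpow (one_le_bracket x) hs)

theorem aestronglyMeasurable_of_weighted {s : ℝ} {f : R3 → ℂ}
    (h : AEStronglyMeasurable (weighted s f) volume) : AEStronglyMeasurable f volume := by
  have hc : Continuous fun x => ((bracket x ^ (-s) : ℝ) : ℂ) :=
    Complex.continuous_ofReal.comp (continuous_bracket_rpow (-s))
  refine (hc.aestronglyMeasurable.mul h).congr (Eventually.of_forall fun x => ?_)
  simp only [Pi.mul_apply, weighted]
  rw [← mul_assoc, ← Complex.ofReal_mul, ← Real.rpow_add (bracket_pos x)]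
  simp

theorem memLp_of_weighted {s : ℝ} (hs : 0 ≤ s) {f : R3 → ℂ} {p : ℝ≥0∞}
    (h : MemLp (weighted s f) p) : MemLp f p :=
  h.of_le (aestronglyMeasurable_of_weighted h.1)
    (Eventually.of_forall (norm_le_norm_weighted hs f))

/-- Distributing the weight by Peetre's inequality bounds the weighted convolution by 2^s times the
convolution of the weighted moduli. The latter is finite almost everywhere and, since the weights
are at least 1, dominates the unweighted integrand. -/
theorem weighted_conv {s : ℝ} (hs : 0 ≤ s) {w ρ : R3 → ℂ} (hw : MemWeightedL2 s w)
    (hρ : MemLp (weighted s ρ) 1) :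
    (∀ᵐ x, ConvolutionExistsAt w ρ x (ContinuousLinearMap.mul ℝ ℂ) volume) ∧
    MemLp (weighted s (conv w ρ)) 2 ∧
    weightedL2Norm s (conv w ρ) ≤ 2 ^ s * (weightedL2Norm s w * weightedL1Norm s ρ) := by
  have hwm := aestronglyMeasurable_of_weighted hw.1
  have hρm := aestronglyMeasurable_of_weighted hρ.1
  obtain ⟨hm, hY⟩ := lintegral_sq_lconvolution_le hw.1.enorm hρ.1.enorm
  set I : R3 → ℝ≥0∞ := fun x => ∫⁻ y, ‖weighted s w y‖ₑ * ‖weighted s ρ (x - y)‖ₑ with hI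
  have hsq : ∫⁻ x, ‖weighted s w x‖ₑ ^ 2 = eLpNorm (weighted s w) 2 volume ^ 2 := by
    rw [eLpNorm_eq_lintegral_rpow_enorm_toReal (by norm_num) (by norm_num),
      ← ENNReal.rpow_mul_natCast]
    norm_num
  rw [hsq, ← eLpNorm_one_eq_lintegral_enorm, ← mul_pow] at hY
  have hfin : eLpNorm (weighted s w) 2 volume * eLpNorm (weighted s ρ) 1 volume ≠ ⊤ :=
    ENNReal.mul_ne_top hw.2.ne hρ.2.ne
  have hae : ∀ᵐ x, I x < ⊤ := by
    have := ae_lt_top' (hm.pow_const 2) (hY.trans_lt (by simpa using hfin.lt_top)).ne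
    filter_upwards [this] with x hx
    simpa using hx
  have hconvm : AEStronglyMeasurable (conv w ρ) volume :=
    (hwm.convolution_integrand (ContinuousLinearMap.mul ℝ ℂ) hρm).integral_prod_right'
  have hwc : AEStronglyMeasurable (weighted s (conv w ρ)) volume :=
    (Complex.continuous_ofReal.comp (continuous_bracket_rpow s)).aestronglyMeasurable.mul hconvm
  have hpt : ∀ x, ‖weighted s (conv w ρ) x‖ₑ ≤ ENNReal.ofReal (2 ^ s) * I x := by
    intro x
    have h1 : ‖conv w ρ x‖ₑ ≤ ∫⁻ y, ‖w y * ρ (x - y)‖ₑ := enorm_integral_le_lintegral_enorm _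
    have e : ‖weighted s (conv w ρ) x‖ₑ = ENNReal.ofReal (bracket x ^ s) * ‖conv w ρ x‖ₑ := by
      rw [← ofReal_norm, norm_weighted,
        ENNReal.ofReal_mul (Real.rpow_nonneg (bracket_pos x).le s), ofReal_norm]
    rw [e, hI, ← lintegral_const_mul' _ _ ENNReal.ofReal_ne_top]
    refine (mul_le_mul_right h1 _).trans ?_
    rw [← lintegral_const_mul' _ _ ENNReal.ofReal_ne_top]
    refine lintegral_mono fun y => ?_
    simp only
    rw [← ofReal_norm, ← ofReal_norm, ← ofReal_norm, norm_weighted, norm_weighted, norm_mul]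
    have b1 := Real.rpow_nonneg (bracket_pos x).le s
    have b2 := Real.rpow_nonneg (bracket_pos y).le s
    have b3 := Real.rpow_nonneg (bracket_pos (x - y)).le s
    rw [← ENNReal.ofReal_mul b1, ← ENNReal.ofReal_mul (by positivity),
      ← ENNReal.ofReal_mul (by positivity)]
    refine ENNReal.ofReal_le_ofReal ?_
    calc bracket x ^ s * (‖w y‖ * ‖ρ (x - y)‖)
        ≤ (2 ^ s * (bracket y ^ s * bracket (x - y) ^ s)) * (‖w y‖ * ‖ρ (x - y)‖) := by
          gcongr; exact bracket_rpow_le_mul hs x y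
      _ = _ := by ring
  have hnorm : eLpNorm (weighted s (conv w ρ)) 2 volume ≤ ENNReal.ofReal (2 ^ s) *
      (eLpNorm (weighted s w) 2 volume * eLpNorm (weighted s ρ) 1 volume) := by
    rw [eLpNorm_eq_lintegral_rpow_enorm_toReal (by norm_num) (by norm_num)]
    have : ∫⁻ x, ‖weighted s (conv w ρ) x‖ₑ ^ (ENNReal.toReal 2) ≤ (ENNReal.ofReal (2 ^ s) *
        (eLpNorm (weighted s w) 2 volume * eLpNorm (weighted s ρ) 1 volume)) ^ 2 := by
      calc ∫⁻ x, ‖weighted s (conv w ρ) x‖ₑ ^ (ENNReal.toReal 2)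
          ≤ ∫⁻ x, ENNReal.ofReal (2 ^ s) ^ 2 * I x ^ 2 := by
            refine lintegral_mono fun x => ?_
            rw [← mul_pow]
            simp only [ENNReal.toReal_ofNat, ENNReal.rpow_ofNat]
            gcongr
            exact hpt x
        _ = ENNReal.ofReal (2 ^ s) ^ 2 * ∫⁻ x, I x ^ 2 :=
            lintegral_const_mul' _ _ (by simp)
        _ ≤ _ := by rw [mul_pow]; gcongr
    calc (∫⁻ x, ‖weighted s (conv w ρ) x‖ₑ ^ (ENNReal.toReal 2)) ^ (1 / ENNReal.toReal 2)
        ≤ ((ENNReal.ofReal (2 ^ s) *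
          (eLpNorm (weighted s w) 2 volume * eLpNorm (weighted s ρ) 1 volume)) ^ 2) ^
            (1 / ENNReal.toReal 2) := by gcongr
      _ = _ := by
          rw [← ENNReal.rpow_natCast, ← ENNReal.rpow_mul]; norm_num
  have hfin' : ENNReal.ofReal (2 ^ s) *
      (eLpNorm (weighted s w) 2 volume * eLpNorm (weighted s ρ) 1 volume) ≠ ⊤ :=
    ENNReal.mul_ne_top ENNReal.ofReal_ne_top hfin
  refine ⟨?_, ⟨hwc, hnorm.trans_lt hfin'.lt_top⟩, ?_⟩
  · filter_upwards [hae] with x hx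
    refine ⟨hwm.convolution_integrand_snd (ContinuousLinearMap.mul ℝ ℂ) hρm x, ?_⟩
    refine lt_of_le_of_lt (lintegral_mono fun y => ?_) hx
    simp only [ContinuousLinearMap.mul_apply', enorm_mul]
    gcongr
    · exact enorm_le_iff_norm_le.2 (norm_le_norm_weighted hs w y)
    · exact enorm_le_iff_norm_le.2 (norm_le_norm_weighted hs ρ (x - y))
  · have := ENNReal.toReal_mono hfin' hnorm
    rwa [ENNReal.toReal_mul, ENNReal.toReal_mul, ENNReal.toReal_ofReal (by positivity)] at this

end Young

/-! ### The Hartree coefficients. -/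

section Hartree

theorem integrable_transition (χ : HilbertBasis ℕ ℂ L2) (k k' : ℕ) :
    Integrable (transition χ k k') :=
  integrable_conj_mul (Lp.memLp (χ k')) (Lp.memLp (χ k))

/-- From 2|ab| ≤ |a|² + |b|² and the normalization of the basis. -/
theorem integral_norm_transition_le (χ : HilbertBasis ℕ ℂ L2) (k k' : ℕ) :
    ∫ x, ‖transition χ k k' x‖ ≤ 1 := by
  have hsq : ∀ k, ∫ x, ‖χ k x‖ ^ 2 = 1 := by
    intro k
    have h1 : inner ℂ (χ k) (χ k) = (1 : ℂ) := by
      rw [inner_self_eq_norm_sq_to_K, χ.orthonormal.1 k]; simp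
    rw [L2.inner_def] at h1
    have e : ∀ x, inner ℂ (χ k x) (χ k x) = ((‖χ k x‖ ^ 2 : ℝ) : ℂ) := fun x => by
      rw [inner_self_eq_norm_sq_to_K]; simp
    simp only [e] at h1
    rw [integral_complex_ofReal] at h1
    exact_mod_cast h1
  have hi : ∀ k, Integrable (fun x => ‖χ k x‖ ^ 2) := fun k =>
    (Lp.memLp (χ k)).integrable_norm_pow (by norm_num)
  calc ∫ x, ‖transition χ k k' x‖
      ≤ ∫ x, (1 / 2 * ‖χ k' x‖ ^ 2 + 1 / 2 * ‖χ k x‖ ^ 2) := by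
        refine integral_mono (integrable_transition χ k k').norm
          (((hi k').const_mul _).add ((hi k).const_mul _)) fun x => ?_
        simp only [transition, norm_mul, norm_star]
        nlinarith [sq_nonneg (‖χ k' x‖ - ‖χ k x‖)]
    _ = 1 := by
        rw [integral_add ((hi k').const_mul _) ((hi k).const_mul _), integral_const_mul,
          integral_const_mul, hsq, hsq]
        norm_num

theorem hartree_bound (χ : HilbertBasis ℕ ℂ L2) {v : R3 → ℂ} (hv : MemLp v ∞)
    (k k' j j' : ℕ) :
    ConvolutionExists v (transition χ j j') (ContinuousLinearMap.mul ℝ ℂ) volume ∧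
    Integrable (hartreeIntegrand v χ k k' j j') volume ∧
    ‖hartreeCoeff v χ k k' j j'‖ ≤ (eLpNorm v ∞ volume).toReal := by
  set N := (eLpNorm v ∞ volume).toReal with hN
  have hN0 : 0 ≤ N := ENNReal.toReal_nonneg
  have hvb : ∀ᵐ x, ‖v x‖ ≤ N := by
    have h := ae_le_eLpNormEssSup (f := v) (μ := volume)
    filter_upwards [h] with x hx
    rw [hN, eLpNorm_exponent_top, ← toReal_enorm]
    exact ENNReal.toReal_mono (by simpa using hv.2.ne) hx
  have hρ := integrable_transition χ j j'
  have hρx : ∀ x, Integrable (fun y => transition χ j j' (x - y)) := fun x => hρ.comp_sub_left x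
  have hex : ConvolutionExists v (transition χ j j') (ContinuousLinearMap.mul ℝ ℂ) volume :=
    fun x => (hρx x).bdd_mul hv.1 hvb
  have hcb : ∀ x, ‖conv v (transition χ j j') x‖ ≤ N := by
    intro x
    have h1 : ‖conv v (transition χ j j') x‖ ≤ ∫ y, N * ‖transition χ j j' (x - y)‖ := by
      refine norm_integral_le_of_norm_le ((hρx x).norm.const_mul N) ?_
      filter_upwards [hvb] with y hy
      rw [ContinuousLinearMap.mul_apply', norm_mul]
      gcongr
    rw [integral_const_mul, integral_sub_left_eq_self (fun y => ‖transition χ j j' y‖)] at h1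
    exact h1.trans (mul_le_of_le_one_right hN0 (integral_norm_transition_le χ j j'))
  have hcm : AEStronglyMeasurable (conv v (transition χ j j')) volume :=
    (hv.1.convolution_integrand (ContinuousLinearMap.mul ℝ ℂ) hρ.1).integral_prod_right'
  have hρ' := integrable_transition χ k k'
  have hst : Integrable (fun x => star (transition χ k k' x)) :=
    hρ'.mono hρ'.1.star (Eventually.of_forall fun x => by simp)
  refine ⟨hex, hst.mul_bdd hcm (Eventually.of_forall hcb), ?_⟩
  calc ‖hartreeCoeff v χ k k' j j'‖ ≤ ∫ x, ‖transition χ k k' x‖ * N := by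
        refine norm_integral_le_of_norm_le (hρ'.norm.mul_const N) (Eventually.of_forall fun x => ?_)
        rw [hartreeIntegrand, norm_mul, norm_star]
        gcongr
        exact hcb x
    _ ≤ N := by
        rw [integral_mul_const]
        exact mul_le_of_le_one_left hN0 (integral_norm_transition_le χ k k')

end Hartree

/-! ### The resolvent as a time integral of the propagator. -/

section TimeIntegral

theorem integral_Ioi_cexp_resolvent {lam ε : ℝ} (hε : 0 < ε) :
    ((lam : ℂ) + Complex.I * ε)⁻¹ =
      -Complex.I * ∫ t : ℝ in Set.Ioi 0, Complex.exp (Complex.I * (lam + Complex.I * ε) * t) := by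
  have hre : (Complex.I * (lam + Complex.I * ε)).re < 0 := by simpa using hε
  rw [integral_exp_mul_complex_Ioi hre]
  have h0 : ((lam : ℂ) + Complex.I * ε) ≠ 0 := by
    intro h
    rw [h] at hre
    simp at hre
  field_simp
  simp

/-- Fubini, justified by the majorant |H(x)| e^{-εt}. The damping and the phase carrying `a` are
split off, so the remaining factor depends on neither. -/
theorem integral_resolvent {X : Type*} [MeasurableSpace X] {μ : Measure X} [SFinite μ]
    {H : X → ℂ} (hH : Integrable H μ) {lam : X → ℝ} (hlam : Measurable lam) {ε : ℝ} (hε : 0 < ε)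
    (a : ℝ) :
    ∫ x, H x * ((lam x : ℂ) - a + Complex.I * ε)⁻¹ ∂μ =
      -Complex.I * ∫ t : ℝ in Set.Ioi 0, Complex.exp (((-ε * t : ℝ) : ℂ)) *
        (Complex.exp (((-a * t : ℝ) : ℂ) * Complex.I) *
          ∫ x, H x * Complex.exp (((lam x * t : ℝ) : ℂ) * Complex.I) ∂μ) := by
  have e1 : ∀ x, H x * ((lam x : ℂ) - a + Complex.I * ε)⁻¹ =
      -Complex.I * ∫ t : ℝ in Set.Ioi 0,
        H x * Complex.exp (Complex.I * ((lam x - a : ℝ) + Complex.I * ε) * t) := by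
    intro x
    have := integral_Ioi_cexp_resolvent (lam := lam x - a) hε
    rw [integral_const_mul, mul_left_comm, ← this]
    push_cast
    rfl
  simp only [e1]
  rw [integral_const_mul]
  congr 1
  have hmeas : Measurable (fun p : X × ℝ =>
      Complex.exp (Complex.I * (((lam p.1 - a : ℝ) : ℂ) + Complex.I * ε) * (p.2 : ℂ))) := by
    fun_prop
  have hnorm : ∀ (x : X) (t : ℝ),
      ‖Complex.exp (Complex.I * (((lam x - a : ℝ) : ℂ) + Complex.I * ε) * (t : ℂ))‖ =
        Real.exp (-ε * t) := by
    intro x t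
    rw [Complex.norm_exp]
    congr 1
    simp
  have hint : Integrable (Function.uncurry fun (x : X) (t : ℝ) =>
      H x * Complex.exp (Complex.I * ((lam x - a : ℝ) + Complex.I * ε) * t))
      (μ.prod (volume.restrict (Set.Ioi 0))) := by
    have h2 : Integrable (fun t : ℝ => Real.exp (-ε * t)) (volume.restrict (Set.Ioi 0)) :=
      exp_neg_integrableOn_Ioi 0 hε
    refine (hH.norm.mul_prod h2).mono' ?_ (Eventually.of_forall fun p => ?_)
    · exact (hH.1.comp_quasiMeasurePreserving Measure.quasiMeasurePreserving_fst).mul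
        hmeas.aestronglyMeasurable
    · simp only [Function.uncurry, norm_mul, hnorm]
      exact le_rfl
  rw [integral_integral_swap hint]
  refine integral_congr_ae (Eventually.of_forall fun t => ?_)
  simp only
  rw [← mul_assoc, ← integral_const_mul]
  refine integral_congr_ae (Eventually.of_forall fun x => ?_)
  simp only
  rw [← Complex.exp_add, mul_left_comm, ← Complex.exp_add]
  congr 2
  push_cast
  ring_nf
  simp only [Complex.I_sq]
  ring

theorem resolvent_limit {X : Type*} [MeasurableSpace X] {μ : Measure X} [SFinite μ]
    {H : X → ℂ} (hH : Integrable H μ) {lam : X → ℝ} (hlam : Measurable lam)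
    (hK : Integrable fun t : ℝ => ∫ x, H x * Complex.exp (((lam x * t : ℝ) : ℂ) * Complex.I) ∂μ)
    (a : ℝ) :
    (∃ L : ℂ, Tendsto (fun ε : ℝ => ∫ x, H x * ((lam x : ℂ) - a + Complex.I * ε)⁻¹ ∂μ)
      (𝓝[>] 0) (𝓝 L)) ∧
    ∀ ε : ℝ, 0 < ε → ‖∫ x, H x * ((lam x : ℂ) - a + Complex.I * ε)⁻¹ ∂μ‖ ≤
      ∫ t : ℝ, ‖∫ x, H x * Complex.exp (((lam x * t : ℝ) : ℂ) * Complex.I) ∂μ‖ := by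
  set K : ℝ → ℂ := fun t => ∫ x, H x * Complex.exp (((lam x * t : ℝ) : ℂ) * Complex.I) ∂μ with hKd
  have hbd : ∀ ε : ℝ, 0 < ε → ∀ t ∈ Set.Ioi (0 : ℝ), ‖Complex.exp (((-ε * t : ℝ) : ℂ)) *
      (Complex.exp (((-a * t : ℝ) : ℂ) * Complex.I) * K t)‖ ≤ ‖K t‖ := by
    intro ε hε t ht
    rw [norm_mul, norm_mul, Complex.norm_exp_ofReal_mul_I, one_mul, ← Complex.ofReal_exp,
      Complex.norm_real, Real.norm_of_nonneg (Real.exp_pos _).le]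
    refine mul_le_of_le_one_left (norm_nonneg _) (Real.exp_le_one_iff.2 ?_)
    have : 0 < ε * t := mul_pos hε ht
    linarith
  have hbd' : ∀ ε : ℝ, 0 < ε → ∀ᵐ t ∂(volume.restrict (Set.Ioi (0 : ℝ))),
      ‖Complex.exp (((-ε * t : ℝ) : ℂ)) *
      (Complex.exp (((-a * t : ℝ) : ℂ) * Complex.I) * K t)‖ ≤ ‖K t‖ := fun ε hε =>
    (ae_restrict_iff' measurableSet_Ioi).2 (Eventually.of_forall (hbd ε hε))
  constructor
  · refine ⟨-Complex.I * ∫ t : ℝ in Set.Ioi 0, Complex.exp (((-a * t : ℝ) : ℂ) * Complex.I) * K t, ?_⟩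
    have hlim : Tendsto (fun ε : ℝ => ∫ t : ℝ in Set.Ioi 0, Complex.exp (((-ε * t : ℝ) : ℂ)) *
        (Complex.exp (((-a * t : ℝ) : ℂ) * Complex.I) * K t)) (𝓝[>] 0)
        (𝓝 (∫ t : ℝ in Set.Ioi 0, Complex.exp (((-a * t : ℝ) : ℂ) * Complex.I) * K t)) := by
      refine tendsto_integral_filter_of_dominated_convergence (fun t => ‖K t‖) ?_ ?_
        hK.norm.integrableOn ?_
      · refine Eventually.of_forall fun ε => ?_
        refine AEStronglyMeasurable.mul ?_ (AEStronglyMeasurable.mul ?_ hK.1.restrict)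
        · exact (by fun_prop : Continuous fun t : ℝ =>
            Complex.exp (((-ε * t : ℝ) : ℂ))).aestronglyMeasurable
        · exact (by fun_prop : Continuous fun t : ℝ =>
            Complex.exp (((-a * t : ℝ) : ℂ) * Complex.I)).aestronglyMeasurable
      · filter_upwards [self_mem_nhdsWithin] with ε hε using hbd' ε hε
      · refine Eventually.of_forall fun t => ?_
        have hc : Continuous fun ε : ℝ => Complex.exp (((-ε * t : ℝ) : ℂ)) *
            (Complex.exp (((-a * t : ℝ) : ℂ) * Complex.I) * K t) := by fun_prop
        have := (hc.tendsto 0).mono_left (nhdsWithin_le_nhds (s := Set.Ioi 0))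
        simpa using this
    refine (hlim.const_mul (-Complex.I)).congr' ?_
    filter_upwards [self_mem_nhdsWithin] with ε hε
    exact (integral_resolvent hH hlam hε a).symm
  · intro ε hε
    rw [integral_resolvent hH hlam hε a, norm_mul, norm_neg, Complex.norm_I, one_mul]
    exact (norm_integral_le_of_norm_le hK.norm.integrableOn (hbd' ε hε)).trans
      (setIntegral_le_integral hK.norm (Eventually.of_forall fun _ => norm_nonneg _))

end TimeIntegral

/-! ### A Carlson-Beurling bound for the L¹ norm of a Fourier transform. -/

section OneDimensional

/-- With y = 1 + (2πt/κ)², use |F̂| ≤ c/(2y) + y|F̂|²/(2c). Here ∫ 1/y = κ/2, and by Plancherel ∫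
y|F̂|² = ‖F‖² + κ⁻²‖F'‖² ≤ 2A². -/
theorem lintegral_fourier_le {F : ℝ → ℂ} (hF : Differentiable ℝ F) (h1 : Integrable F)
    (h2 : MemLp F 2) (h1' : Integrable (deriv F)) (h2' : MemLp (deriv F) 2) {κ A : ℝ}
    (hκ : 0 < κ) (hA : 0 < A) (hFA : ∫ r, ‖F r‖ ^ 2 ≤ A ^ 2)
    (hFA' : ∫ r, ‖deriv F r‖ ^ 2 ≤ κ ^ 2 * A ^ 2) :
    ∫⁻ t, ‖𝓕 F t‖ₑ ≤ ENNReal.ofReal (Real.sqrt κ * A) := by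
  have hsκ : 0 < Real.sqrt κ := Real.sqrt_pos.2 hκ
  have hss : Real.sqrt κ * Real.sqrt κ = κ := Real.mul_self_sqrt hκ.le
  -- The minimizer of cκ/4 + A²/c, whose minimum is √κ A.
  set c : ℝ := 2 * A / Real.sqrt κ with hc
  have hc0 : 0 < c := by positivity
  have hder : ∀ t, ‖𝓕 (deriv F) t‖ ^ 2 = (2 * Real.pi * t) ^ 2 * ‖𝓕 F t‖ ^ 2 := by
    intro t
    rw [Real.fourier_deriv h1 hF h1', norm_smul, mul_pow]
    congr 1
    simp [mul_pow, abs_of_pos Real.pi_pos]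
  have i1 : Integrable (fun t => ‖𝓕 F t‖ ^ 2) :=
    (memLp_fourier h1 h2).integrable_norm_pow (by norm_num)
  have i2 : Integrable (fun t => ‖𝓕 (deriv F) t‖ ^ 2) :=
    (memLp_fourier h1' h2').integrable_norm_pow (by norm_num)
  have hk0 : 2 * Real.pi / κ ≠ 0 := by positivity
  have i3 : Integrable (fun t : ℝ => (1 + (2 * Real.pi / κ * t) ^ 2)⁻¹) :=
    integrable_inv_one_add_sq.comp_mul_left' hk0
  have v3 : ∫ t : ℝ, (1 + (2 * Real.pi / κ * t) ^ 2)⁻¹ = κ / 2 := by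
    rw [Measure.integral_comp_mul_left (fun t : ℝ => (1 + t ^ 2)⁻¹),
      integral_univ_inv_one_add_sq, abs_of_pos (by positivity), smul_eq_mul]
    field_simp
  have hpt : ∀ t, ‖𝓕 F t‖ ≤ c / 2 * (1 + (2 * Real.pi / κ * t) ^ 2)⁻¹ +
      (1 / (2 * c) * ‖𝓕 F t‖ ^ 2 + 1 / (2 * c * κ ^ 2) * ‖𝓕 (deriv F) t‖ ^ 2) := by
    intro t
    rw [hder]
    set y := 1 + (2 * Real.pi / κ * t) ^ 2 with hy
    have hy0 : 0 < y := by positivity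
    have e : 1 / (2 * c) * ‖𝓕 F t‖ ^ 2 +
        1 / (2 * c * κ ^ 2) * ((2 * Real.pi * t) ^ 2 * ‖𝓕 F t‖ ^ 2) =
        1 / (2 * c) * (y * ‖𝓕 F t‖ ^ 2) := by
      rw [hy]; field_simp
    rw [e]
    have := sq_nonneg (c - y * ‖𝓕 F t‖)
    have hid : c / 2 * y⁻¹ + 1 / (2 * c) * (y * ‖𝓕 F t‖ ^ 2) - ‖𝓕 F t‖ =
        (c - y * ‖𝓕 F t‖) ^ 2 / (2 * c * y) := by
      field_simp
      ring
    have : 0 ≤ (c - y * ‖𝓕 F t‖) ^ 2 / (2 * c * y) := by positivity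
    linarith
  have hI := (i3.const_mul (c / 2)).add
    ((i1.const_mul (1 / (2 * c))).add (i2.const_mul (1 / (2 * c * κ ^ 2))))
  calc ∫⁻ t, ‖𝓕 F t‖ₑ = ∫⁻ t, ENNReal.ofReal ‖𝓕 F t‖ := by simp
    _ ≤ ∫⁻ t, ENNReal.ofReal (c / 2 * (1 + (2 * Real.pi / κ * t) ^ 2)⁻¹ +
      (1 / (2 * c) * ‖𝓕 F t‖ ^ 2 + 1 / (2 * c * κ ^ 2) * ‖𝓕 (deriv F) t‖ ^ 2)) :=
        lintegral_mono fun t => ENNReal.ofReal_le_ofReal (hpt t)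
    _ = ENNReal.ofReal (∫ t, (c / 2 * (1 + (2 * Real.pi / κ * t) ^ 2)⁻¹ +
      (1 / (2 * c) * ‖𝓕 F t‖ ^ 2 + 1 / (2 * c * κ ^ 2) * ‖𝓕 (deriv F) t‖ ^ 2))) :=
        (ofReal_integral_eq_lintegral_ofReal hI
          (Eventually.of_forall fun t => (norm_nonneg _).trans (hpt t))).symm
    _ ≤ _ := by
        refine ENNReal.ofReal_le_ofReal ?_
        have hI2 : Integrable (fun t => 1 / (2 * c) * ‖𝓕 F t‖ ^ 2 +
          1 / (2 * c * κ ^ 2) * ‖𝓕 (deriv F) t‖ ^ 2) :=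
          (i1.const_mul (1 / (2 * c))).add (i2.const_mul (1 / (2 * c * κ ^ 2)))
        rw [integral_add (i3.const_mul _) hI2, integral_add (i1.const_mul _) (i2.const_mul _),
          integral_const_mul, integral_const_mul, integral_const_mul, v3,
          integral_norm_sq_fourier h1 h2, integral_norm_sq_fourier h1' h2']
        calc c / 2 * (κ / 2) + (1 / (2 * c) * (∫ x, ‖F x‖ ^ 2)
              + 1 / (2 * c * κ ^ 2) * ∫ x, ‖deriv F x‖ ^ 2)
            ≤ c / 2 * (κ / 2) + (1 / (2 * c) * A ^ 2 + 1 / (2 * c * κ ^ 2) * (κ ^ 2 * A ^ 2)) := by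
              gcongr
          _ = c * κ / 4 + A ^ 2 / c := by field_simp; ring
          _ = Real.sqrt κ * A := by
              rw [hc]
              nth_rewrite 2 [← hss]
              field_simp
              ring

end OneDimensional

/-! ### Estimates for radial profiles at length scale R. -/

section Radial

/-- Bounds on the half-line for a function `u` with derivative `u'`, at length scale `R`. -/
structure RadialBound (u u' : ℝ → ℂ) (R Q : ℝ) : Prop where
  hasDerivAt : ∀ r, HasDerivAt u (u' r) r
  continuous_deriv : Continuous u'
  integrableOn_sq : IntegrableOn (fun r => r ^ 2 * ‖u r‖ ^ 2) (Set.Ioi 0)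
  integrableOn_deriv : IntegrableOn (fun r => r ^ 2 * ‖u' r‖ ^ 2) (Set.Ioi 0)
  integrableOn_self : IntegrableOn (fun r => ‖u r‖ ^ 2) (Set.Ioi 0)
  sq_le : ∫ r in Set.Ioi 0, r ^ 2 * ‖u r‖ ^ 2 ≤ Q ^ 2
  deriv_le : ∫ r in Set.Ioi 0, r ^ 2 * ‖u' r‖ ^ 2 ≤ R ^ 2 * Q ^ 2
  self_le : ∫ r in Set.Ioi 0, ‖u r‖ ^ 2 ≤ R ^ 2 * Q ^ 2

variable {u u' v v' : ℝ → ℂ} {R Q R₁ R₂ Q₁ Q₂ : ℝ}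

theorem RadialBound.continuous (h : RadialBound u u' R Q) : Continuous u :=
  continuous_iff_continuousAt.2 fun r => (h.hasDerivAt r).continuousAt

/-- u + r u' is the derivative of r u(r). The unweighted bound on u in `RadialBound` is there for
its first term. -/
theorem RadialBound.deriv_mul (h : RadialBound u u' R Q) :
    IntegrableOn (fun r : ℝ => ‖u r + r * u' r‖ ^ 2) (Set.Ioi 0) ∧
    ∫ r in Set.Ioi 0, ‖u r + (r : ℝ) * u' r‖ ^ 2 ≤ 4 * R ^ 2 * Q ^ 2 := by
  have hpt : ∀ r : ℝ, ‖u r + r * u' r‖ ^ 2 ≤ 2 * ‖u r‖ ^ 2 + 2 * (r ^ 2 * ‖u' r‖ ^ 2) := by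
    intro r
    have h1 := norm_add_le (u r) (r * u' r)
    have h2 : ‖(r : ℂ) * u' r‖ ^ 2 = r ^ 2 * ‖u' r‖ ^ 2 := by
      rw [norm_mul, mul_pow, Complex.norm_real, Real.norm_eq_abs, sq_abs]
    rw [← h2]
    have h3 : ‖u r + r * u' r‖ ^ 2 ≤ (‖u r‖ + ‖(r : ℂ) * u' r‖) ^ 2 := by gcongr
    nlinarith [sq_nonneg (‖u r‖ - ‖(r : ℂ) * u' r‖)]
  have hi := (h.integrableOn_self.const_mul 2).add (h.integrableOn_deriv.const_mul 2)
  have hc : Continuous fun r : ℝ => ‖u r + r * u' r‖ ^ 2 := by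
    have := h.continuous
    have := h.continuous_deriv
    fun_prop
  have hI : IntegrableOn (fun r : ℝ => ‖u r + r * u' r‖ ^ 2) (Set.Ioi 0) :=
    hi.mono' hc.aestronglyMeasurable.restrict (Eventually.of_forall fun r => by
      rw [Real.norm_of_nonneg (by positivity)]; exact hpt r)
  refine ⟨hI, (integral_mono hI hi hpt).trans ?_⟩
  simp only [Pi.add_apply]
  rw [integral_add (h.integrableOn_self.const_mul 2) (h.integrableOn_deriv.const_mul 2),
    integral_const_mul, integral_const_mul]
  linarith [h.self_le, h.deriv_le]

/-- One-dimensional Sobolev bound: integrate the derivative of |r u|² from 0, where it vanishes, and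
balance |r u| against its derivative with weight 2R. -/
theorem RadialBound.sup_le (h : RadialBound u u' R Q) (hR : 0 < R) {r : ℝ} (hr : 0 < r) :
    r ^ 2 * ‖u r‖ ^ 2 ≤ 4 * R * Q ^ 2 := by
  obtain ⟨hI, hle⟩ := h.deriv_mul
  have hu := h.continuous
  have hu' := h.continuous_deriv
  have hd : ∀ x : ℝ, HasDerivAt (fun x : ℝ => (x : ℂ) * u x) (u x + x * u' x) x := by
    intro x
    have h1 : HasDerivAt (fun x : ℝ => (x : ℂ)) 1 x := Complex.ofRealCLM.hasDerivAt
    exact (h1.mul (h.hasDerivAt x)).congr_deriv (by simp)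
  have hsq : ∀ x : ℝ, HasDerivAt (fun x : ℝ => ‖(x : ℂ) * u x‖ ^ 2)
      (2 * inner ℝ ((x : ℂ) * u x) (u x + x * u' x)) x := fun x => (hd x).norm_sq
  have hnorm : ∀ x : ℝ, ‖(x : ℂ) * u x‖ ^ 2 = x ^ 2 * ‖u x‖ ^ 2 := by
    intro x
    rw [norm_mul, mul_pow, Complex.norm_real, Real.norm_eq_abs, sq_abs]
  have hftc := intervalIntegral.integral_eq_sub_of_hasDerivAt (a := 0) (b := r)
    (fun x _ => hsq x) ((by fun_prop : Continuous fun x : ℝ =>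
      2 * inner ℝ ((x : ℂ) * u x) (u x + x * u' x)).intervalIntegrable _ _)
  have hpt : ∀ x : ℝ, 2 * inner ℝ ((x : ℂ) * u x) (u x + x * u' x) ≤
      2 * R * (x ^ 2 * ‖u x‖ ^ 2) + 1 / (2 * R) * ‖u x + x * u' x‖ ^ 2 := by
    intro x
    rw [← hnorm]
    have h1 := real_inner_le_norm ((x : ℂ) * u x) (u x + x * u' x)
    set p := ‖(x : ℂ) * u x‖
    set q := ‖u x + x * u' x‖
    have h2 : 2 * R * p ^ 2 + 1 / (2 * R) * q ^ 2 - 2 * (p * q) =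
        (2 * R * p - q) ^ 2 / (2 * R) := by field_simp; ring
    have h3 : 0 ≤ (2 * R * p - q) ^ 2 / (2 * R) := by positivity
    linarith
  have hi : IntegrableOn (fun x => 2 * R * (x ^ 2 * ‖u x‖ ^ 2) +
      1 / (2 * R) * ‖u x + x * u' x‖ ^ 2) (Set.Ioi 0) :=
    (h.integrableOn_sq.const_mul (2 * R)).add (hI.const_mul (1 / (2 * R)))
  simp only [hnorm] at hftc
  rw [intervalIntegral.integral_of_le hr.le] at hftc
  have hsub : Set.Ioc 0 r ⊆ Set.Ioi (0 : ℝ) := fun x hx => hx.1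
  calc r ^ 2 * ‖u r‖ ^ 2
      = ∫ x in Set.Ioc 0 r, 2 * inner ℝ ((x : ℂ) * u x) (u x + x * u' x) := by
        rw [hftc]; simp
    _ ≤ ∫ x in Set.Ioc 0 r, (2 * R * (x ^ 2 * ‖u x‖ ^ 2) +
          1 / (2 * R) * ‖u x + x * u' x‖ ^ 2) := by
        refine integral_mono ?_ (hi.mono_set hsub) hpt
        exact (by fun_prop : Continuous fun x : ℝ =>
          2 * inner ℝ ((x : ℂ) * u x) (u x + x * u' x)).integrableOn_Ioc
    _ ≤ ∫ x in Set.Ioi 0, (2 * R * (x ^ 2 * ‖u x‖ ^ 2) +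
          1 / (2 * R) * ‖u x + x * u' x‖ ^ 2) :=
        setIntegral_mono_set hi (Eventually.of_forall fun x => by
          simp only [Pi.zero_apply]; positivity) hsub.eventuallyLE
    _ = 2 * R * (∫ x in Set.Ioi 0, x ^ 2 * ‖u x‖ ^ 2) +
          1 / (2 * R) * ∫ x in Set.Ioi 0, ‖u x + (x : ℝ) * u' x‖ ^ 2 := by
        rw [integral_add (h.integrableOn_sq.const_mul _) (hI.const_mul _), integral_const_mul,
          integral_const_mul]
    _ ≤ 2 * R * Q ^ 2 + 1 / (2 * R) * (4 * R ^ 2 * Q ^ 2) := by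
        gcongr
        exact h.sq_le
    _ = 4 * R * Q ^ 2 := by field_simp; ring

/-- The square of the positive part is differentiable at 0 as well, so extending the radial profile
by zero creates no jump and no boundary term. -/
theorem hasDerivAt_max_sq (r : ℝ) :
    HasDerivAt (fun r : ℝ => (max r 0) ^ 2) (2 * max r 0) r := by
  rcases lt_trichotomy r 0 with hr | rfl | hr
  · rw [max_eq_right hr.le, mul_zero]
    refine (hasDerivAt_const r (0 : ℝ)).congr_of_eventuallyEq ?_
    filter_upwards [Iio_mem_nhds hr] with x hx
    rw [max_eq_right (le_of_lt hx)]; simp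
  · rw [hasDerivAt_iff_tendsto_slope]
    have hc : Tendsto (fun x : ℝ => max x 0) (𝓝[≠] 0) (𝓝 (2 * max 0 0)) := by
      have : Continuous fun x : ℝ => max x 0 := by fun_prop
      simpa using (this.tendsto 0).mono_left nhdsWithin_le_nhds
    refine hc.congr' ?_
    filter_upwards [self_mem_nhdsWithin] with x hx
    have hx0 : x ≠ 0 := hx
    rw [slope_def_field]
    rcases le_total x 0 with h | h
    · simp [max_eq_right h]
    · simp only [max_eq_left h, max_self, sub_zero]
      field_simp
      ring
  · rw [max_eq_left hr.le]
    refine ((hasDerivAt_pow 2 r).congr_of_eventuallyEq ?_).congr_deriv (by simp)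
    filter_upwards [Ioi_mem_nhds hr] with x hx
    rw [max_eq_left (le_of_lt hx)]

/-- The radial profile `r² conj(u) v` on the positive half-line, extended by zero. -/
noncomputable def radialProfile (u v : ℝ → ℂ) (r : ℝ) : ℂ :=
  (((max r 0) ^ 2 : ℝ) : ℂ) * (star (u r) * v r)

theorem hasDerivAt_radialProfile (hu : ∀ r, HasDerivAt u (u' r) r)
    (hv : ∀ r, HasDerivAt v (v' r) r) (r : ℝ) :
    HasDerivAt (radialProfile u v) (((2 * max r 0 : ℝ) : ℂ) * (star (u r) * v r) +
      (((max r 0) ^ 2 : ℝ) : ℂ) * (star (u' r) * v r + star (u r) * v' r)) r :=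
  ((hasDerivAt_max_sq r).ofReal_comp).mul ((hu r).star.mul (hv r))

/-- On the half-line F = conj(ru)(rv). Placing one factor in L^∞ and the other in L² gives ‖F‖² of
order min(R₁,R₂) and ‖F'‖² of order R₁R₂ max(R₁,R₂), both times (Q₁Q₂)². Their ratio is max(R₁,R₂)²,
so κ is the larger radius. -/
theorem lintegral_fourier_radialProfile_le (hu : RadialBound u u' R₁ Q₁)
    (hv : RadialBound v v' R₂ Q₂) (hR₁ : 0 < R₁) (hR₂ : 0 < R₂) (hQ₁ : 0 < Q₁) (hQ₂ : 0 < Q₂) :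
    ∫⁻ t, ‖𝓕 (radialProfile u v) t‖ₑ ≤ ENNReal.ofReal (8 * Real.sqrt (R₁ * R₂) * (Q₁ * Q₂)) := by
  set F := radialProfile u v with hF
  set F' : ℝ → ℂ := fun r => ((2 * max r 0 : ℝ) : ℂ) * (star (u r) * v r) +
      (((max r 0) ^ 2 : ℝ) : ℂ) * (star (u' r) * v r + star (u r) * v' r) with hF'
  have hd : ∀ r, HasDerivAt F (F' r) r := hasDerivAt_radialProfile hu.hasDerivAt hv.hasDerivAt
  have hderiv : deriv F = F' := funext fun r => (hd r).deriv
  have hdiff : Differentiable ℝ F := fun r => (hd r).differentiableAt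
  have hcu := hu.continuous
  have hcv := hv.continuous
  have hcu' := hu.continuous_deriv
  have hcv' := hv.continuous_deriv
  have hFc : Continuous F := hdiff.continuous
  have hF'c : Continuous F' := by fun_prop
  have hFz : ∀ r, r ∉ Set.Ioi (0 : ℝ) → F r = 0 := fun r hr => by
    rw [hF, radialProfile, max_eq_right (not_lt.1 (Set.mem_Ioi.not.1 hr))]; simp
  have hF'z : ∀ r, r ∉ Set.Ioi (0 : ℝ) → F' r = 0 := fun r hr => by
    simp only [hF', max_eq_right (not_lt.1 (Set.mem_Ioi.not.1 hr))]; simp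
  have hFn : ∀ r, r ∈ Set.Ioi (0 : ℝ) → ‖F r‖ = (r * ‖u r‖) * (r * ‖v r‖) := fun r hr => by
    have hr : 0 < r := hr
    rw [hF, radialProfile, max_eq_left hr.le, norm_mul, norm_mul, norm_star, Complex.norm_real,
      Real.norm_of_nonneg (by positivity)]
    ring
  have hF'n : ∀ r, r ∈ Set.Ioi (0 : ℝ) → ‖F' r‖ ≤
      ‖u r + r * u' r‖ * (r * ‖v r‖) + (r * ‖u r‖) * ‖v r + r * v' r‖ := fun r hr => by
    have hr : 0 < r := hr
    have e : F' r = star (u r + r * u' r) * (r * v r) + star (r * u r) * (v r + r * v' r) := by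
      simp only [hF', max_eq_left hr.le]
      simp
      ring
    rw [e]
    refine (norm_add_le _ _).trans (le_of_eq ?_)
    simp only [norm_mul, norm_star, Complex.norm_real, Real.norm_of_nonneg hr.le]
  obtain ⟨iDu, leDu⟩ := hu.deriv_mul
  obtain ⟨iDv, leDv⟩ := hv.deriv_mul
  have su := fun {r} (hr : r ∈ Set.Ioi (0 : ℝ)) => hu.sup_le hR₁ hr
  have sv := fun {r} (hr : r ∈ Set.Ioi (0 : ℝ)) => hv.sup_le hR₂ hr
  set m := min R₁ R₂ with hm
  set κ := max R₁ R₂ with hκ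
  have hm0 : 0 < m := lt_min hR₁ hR₂
  have hκ0 : 0 < κ := lt_max_of_lt_left hR₁
  have hmκ : m * κ = R₁ * R₂ := min_mul_max _ _
  -- Transfers pointwise bounds on the half-line to the whole line for functions vanishing off it.
  have on_Ioi : ∀ {f g : ℝ → ℝ}, Continuous f → (∀ r, 0 ≤ f r) →
      (∀ r, r ∉ Set.Ioi (0 : ℝ) → f r = 0) → IntegrableOn g (Set.Ioi 0) →
      (∀ r, r ∈ Set.Ioi (0 : ℝ) → f r ≤ g r) →
      Integrable f ∧ ∫ r, f r ≤ ∫ r in Set.Ioi 0, g r := by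
    intro f g hfc hf0 hfz hg hfg
    have hi : IntegrableOn f (Set.Ioi 0) :=
      Integrable.mono' hg hfc.aestronglyMeasurable.restrict
        ((ae_restrict_iff' measurableSet_Ioi).2 (Eventually.of_forall fun r hr => by
          rw [Real.norm_of_nonneg (hf0 r)]; exact hfg r hr))
    refine ⟨(integrableOn_iff_integrable_of_support_subset
      (Function.support_subset_iff'.2 hfz)).1 hi, ?_⟩
    rw [← setIntegral_eq_integral_of_forall_compl_eq_zero hfz]
    exact setIntegral_mono_on hi hg measurableSet_Ioi hfg
  have hsq_u := hu.sq_le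
  have hsq_v := hv.sq_le
  -- Two bounds for ‖F‖², according to which factor is taken in supremum; together they give the
  -- smaller radius.
  have F2a := on_Ioi (f := fun r => ‖F r‖ ^ 2)
    (g := fun r => 4 * R₁ * Q₁ ^ 2 * (r ^ 2 * ‖v r‖ ^ 2)) (by fun_prop)
    (fun r => by positivity) (fun r hr => by simp [hFz r hr])
    (hv.integrableOn_sq.const_mul _) (fun r hr => by
      rw [hFn r hr, mul_pow, mul_pow, mul_pow]
      exact mul_le_mul_of_nonneg_right (su hr) (by positivity))
  have F2b := on_Ioi (f := fun r => ‖F r‖ ^ 2)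
    (g := fun r => 4 * R₂ * Q₂ ^ 2 * (r ^ 2 * ‖u r‖ ^ 2)) (by fun_prop)
    (fun r => by positivity) (fun r hr => by simp [hFz r hr])
    (hu.integrableOn_sq.const_mul _) (fun r hr => by
      rw [hFn r hr, mul_comm (r * ‖u r‖), mul_pow, mul_pow, mul_pow]
      exact mul_le_mul_of_nonneg_right (sv hr) (by positivity))
  have iD : IntegrableOn (fun r : ℝ => 8 * R₂ * Q₂ ^ 2 * ‖u r + (r : ℝ) * u' r‖ ^ 2 +
      8 * R₁ * Q₁ ^ 2 * ‖v r + (r : ℝ) * v' r‖ ^ 2) (Set.Ioi 0) :=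
    (iDu.const_mul _).add (iDv.const_mul _)
  have F'2 := on_Ioi (f := fun r => ‖F' r‖ ^ 2)
    (g := fun r => 8 * R₂ * Q₂ ^ 2 * ‖u r + (r : ℝ) * u' r‖ ^ 2 +
      8 * R₁ * Q₁ ^ 2 * ‖v r + (r : ℝ) * v' r‖ ^ 2) (by fun_prop)
    (fun r => by positivity) (fun r hr => by simp [hF'z r hr])
    iD (fun r hr => by
      have h1 := hF'n r hr
      have h2 := su hr
      have h3 := sv hr
      rw [← mul_pow] at h2 h3
      set p := ‖u r + r * u' r‖
      set q := ‖v r + r * v' r‖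
      set x := r * ‖u r‖
      set y := r * ‖v r‖
      have h4 : ‖F' r‖ ^ 2 ≤ (p * y + x * q) ^ 2 := by gcongr
      have h5 := mul_le_mul_of_nonneg_left h3 (sq_nonneg p)
      have h6 := mul_le_mul_of_nonneg_left h2 (sq_nonneg q)
      nlinarith [sq_nonneg (p * y - x * q)])
  have F1 := on_Ioi (f := fun r => ‖F r‖)
    (g := fun r => r ^ 2 * ‖u r‖ ^ 2 + r ^ 2 * ‖v r‖ ^ 2) (by fun_prop)
    (fun r => by positivity) (fun r hr => by simp [hFz r hr])
    (hu.integrableOn_sq.add hv.integrableOn_sq) (fun r hr => by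
      rw [hFn r hr, ← mul_pow, ← mul_pow]
      nlinarith [sq_nonneg (r * ‖u r‖ - r * ‖v r‖), sq_nonneg (r * ‖u r‖), sq_nonneg (r * ‖v r‖)])
  have F'1 := on_Ioi (f := fun r => ‖F' r‖)
    (g := fun r => (‖u r + (r : ℝ) * u' r‖ ^ 2 + r ^ 2 * ‖v r‖ ^ 2) +
      (r ^ 2 * ‖u r‖ ^ 2 + ‖v r + (r : ℝ) * v' r‖ ^ 2)) (by fun_prop)
    (fun r => by positivity) (fun r hr => by simp [hF'z r hr])
    ((iDu.add hv.integrableOn_sq).add (hu.integrableOn_sq.add iDv)) (fun r hr => by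
      refine (hF'n r hr).trans ?_
      rw [← mul_pow, ← mul_pow]
      set p := ‖u r + r * u' r‖
      set q := ‖v r + r * v' r‖
      set x := r * ‖u r‖
      set y := r * ‖v r‖
      nlinarith [sq_nonneg (p - y), sq_nonneg (x - q), sq_nonneg p, sq_nonneg q, sq_nonneg x,
        sq_nonneg y])
  have e1 : Integrable F := (integrable_norm_iff hFc.aestronglyMeasurable).1 F1.1
  have e1' : Integrable F' := (integrable_norm_iff hF'c.aestronglyMeasurable).1 F'1.1
  have e2 : MemLp F 2 := (memLp_two_iff_integrable_sq_norm hFc.aestronglyMeasurable).2 F2a.1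
  have e2' : MemLp F' 2 := (memLp_two_iff_integrable_sq_norm hF'c.aestronglyMeasurable).2 F'2.1
  have hsm : 0 < Real.sqrt m := Real.sqrt_pos.2 hm0
  have hA2 : (8 * Real.sqrt m * (Q₁ * Q₂)) ^ 2 = 64 * m * (Q₁ ^ 2 * Q₂ ^ 2) := by
    rw [mul_pow, mul_pow, Real.sq_sqrt hm0.le]; ring
  -- A is dictated by the derivative: 32 R₁R₂(R₁ + R₂) ≤ 64 R₁R₂ κ = 64 m κ², using mκ = R₁R₂. The
  -- bound on ‖F‖² then has room to spare.
  have res := lintegral_fourier_le hdiff e1 e2 (by rwa [hderiv]) (by rwa [hderiv]) hκ0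
    (A := 8 * Real.sqrt m * (Q₁ * Q₂)) (by positivity) ?_ ?_
  · refine res.trans (le_of_eq ?_)
    rw [← hmκ, Real.sqrt_mul hm0.le]
    congr 1; ring
  · rw [hA2]
    have hQQ : 0 < Q₁ ^ 2 * Q₂ ^ 2 := by positivity
    have h1 := F2a.2
    have h2 := F2b.2
    simp only [integral_const_mul] at h1 h2
    have h3 : ∫ r, ‖F r‖ ^ 2 ≤ 4 * R₁ * (Q₁ ^ 2 * Q₂ ^ 2) :=
      h1.trans ((mul_le_mul_of_nonneg_left hsq_v (by positivity)).trans (le_of_eq (by ring)))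
    have h4 : ∫ r, ‖F r‖ ^ 2 ≤ 4 * R₂ * (Q₁ ^ 2 * Q₂ ^ 2) :=
      h2.trans ((mul_le_mul_of_nonneg_left hsq_u (by positivity)).trans (le_of_eq (by ring)))
    have h5 : ∫ r, ‖F r‖ ^ 2 ≤ 4 * m * (Q₁ ^ 2 * Q₂ ^ 2) := by
      rcases min_choice R₁ R₂ with h | h <;> rw [hm, h] <;> assumption
    have : 0 < m * (Q₁ ^ 2 * Q₂ ^ 2) := by positivity
    linarith
  · rw [hA2, hderiv]
    have h1 := F'2.2
    rw [integral_add (iDu.const_mul _) (iDv.const_mul _), integral_const_mul,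
      integral_const_mul] at h1
    have h2 : R₁ + R₂ ≤ 2 * κ := by linarith [le_max_left R₁ R₂, le_max_right R₁ R₂]
    calc ∫ r, ‖F' r‖ ^ 2 ≤ 8 * R₂ * Q₂ ^ 2 * (4 * R₁ ^ 2 * Q₁ ^ 2) +
          8 * R₁ * Q₁ ^ 2 * (4 * R₂ ^ 2 * Q₂ ^ 2) := h1.trans (by gcongr)
      _ = 32 * (R₁ * R₂) * (R₁ + R₂) * (Q₁ ^ 2 * Q₂ ^ 2) := by ring
      _ ≤ 32 * (R₁ * R₂) * (2 * κ) * (Q₁ ^ 2 * Q₂ ^ 2) := by gcongr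
      _ = κ ^ 2 * (64 * m * (Q₁ ^ 2 * Q₂ ^ 2)) := by rw [← hmκ]; ring

end Radial

/-! ### Polar coordinates in ℝ³. -/

section Polar

/-- The unit sphere of `ℝ³`. -/
abbrev S2 : Type := Metric.sphere (0 : R3) 1

/-- The surface measure of the unit sphere. -/
noncomputable abbrev sphereMeasure : Measure S2 := (volume : Measure R3).toSphere

/-- The measure `r² dr` on the positive half-line. -/
noncomputable def radialMeasure : Measure ℝ :=
  (volume.restrict (Set.Ioi 0)).withDensity fun r => ENNReal.ofReal (r ^ 2)

instance : SFinite radialMeasure := by unfold radialMeasure; infer_instance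

theorem map_volumeIoiPow :
    Measure.map Subtype.val (Measure.volumeIoiPow 2) = radialMeasure := by
  ext s hs
  rw [Measure.map_apply measurable_subtype_coe hs, Measure.volumeIoiPow,
    withDensity_apply _ (measurable_subtype_coe hs),
    setLIntegral_subtype measurableSet_Ioi _ fun a : ℝ => ENNReal.ofReal (a ^ 2),
    radialMeasure, withDensity_apply _ hs, Measure.restrict_restrict hs,
    Subtype.image_preimage_coe, Set.inter_comm]

/-- Polar coordinates are a measure-preserving homeomorphism off the origin, which is a null set.
Allowing r in all of ℝ is harmless, as `radialMeasure` is carried by r > 0. -/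
theorem measurePreserving_polar :
    MeasurePreserving (fun p : S2 × ℝ => p.2 • (p.1 : R3)) (sphereMeasure.prod radialMeasure)
      volume := by
  have h1 := (Measure.measurePreserving_homeomorphUnitSphereProd (volume : Measure R3))
  have hdim : Module.finrank ℝ R3 - 1 = 2 := by simp
  rw [hdim] at h1
  have h2 := h1.symm (homeomorphUnitSphereProd R3).toMeasurableEquiv
  have h3 : MeasurePreserving (Subtype.val : ({0}ᶜ : Set R3) → R3)
      (Measure.comap Subtype.val volume) volume := by
    refine ⟨measurable_subtype_coe, ?_⟩
    rw [map_comap_subtype_coe (measurableSet_singleton _).compl]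
    exact Measure.restrict_eq_self_of_ae_mem (by simp [ae_iff])
  have h4 := h3.comp h2
  have h5 : MeasurePreserving (Prod.map id Subtype.val : S2 × Set.Ioi (0 : ℝ) → S2 × ℝ)
      (sphereMeasure.prod (Measure.volumeIoiPow 2)) (sphereMeasure.prod radialMeasure) := by
    refine (MeasurePreserving.id _).prod ⟨measurable_subtype_coe, map_volumeIoiPow⟩
  have hm : Measurable (fun p : S2 × ℝ => p.2 • (p.1 : R3)) := by fun_prop
  refine ⟨hm, ?_⟩
  rw [← h5.map_eq, Measure.map_map hm h5.measurable, ← h4.map_eq]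
  rfl

theorem integral_radialMeasure {F : Type*} [NormedAddCommGroup F] [NormedSpace ℝ F] (f : ℝ → F) :
    ∫ r, f r ∂radialMeasure = ∫ r in Set.Ioi 0, r ^ 2 • f r := by
  rw [radialMeasure, integral_withDensity_eq_integral_toReal_smul (by fun_prop)
    (Eventually.of_forall fun _ => ENNReal.ofReal_lt_top)]
  congr 1
  funext r
  rw [ENNReal.toReal_ofReal (sq_nonneg r)]

theorem integrable_radialMeasure {F : Type*} [NormedAddCommGroup F] [NormedSpace ℝ F] {f : ℝ → F} :
    Integrable f radialMeasure ↔ IntegrableOn (fun r => r ^ 2 • f r) (Set.Ioi 0) := by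
  rw [radialMeasure, integrable_withDensity_iff_integrable_smul' (by fun_prop)
    (Eventually.of_forall fun _ => ENNReal.ofReal_lt_top), IntegrableOn]
  simp only [ENNReal.toReal_ofReal (sq_nonneg _)]

theorem integral_polar {F : Type*} [NormedAddCommGroup F] [NormedSpace ℝ F] {f : R3 → F}
    (hf : Integrable f) :
    Integrable (fun p : S2 × ℝ => f (p.2 • (p.1 : R3))) (sphereMeasure.prod radialMeasure) ∧
    ∫ x, f x = ∫ θ : S2, ∫ r, f (r • (θ : R3)) ∂radialMeasure ∂sphereMeasure := by
  have hp := measurePreserving_polar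
  have hi : Integrable (fun p : S2 × ℝ => f (p.2 • (p.1 : R3)))
      (sphereMeasure.prod radialMeasure) := hp.integrable_comp_of_integrable hf
  refine ⟨hi, ?_⟩
  rw [← integral_prod (fun p : S2 × ℝ => f (p.2 • (p.1 : R3))) hi]
  conv_lhs => rw [← hp.map_eq]
  rw [integral_map hp.measurable.aemeasurable]
  rw [hp.map_eq]
  exact hf.1

end Polar

/-! ### Fourier transforms of functions supported in a ball. -/

section Localized

theorem integrable_of_support {g : R3 → ℂ} (hg : MemLp g 2) {R : ℝ}
    (hsupp : ∀ x, R < ‖x‖ → g x = 0) : Integrable g := by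
  have hsub : Function.support g ⊆ Metric.closedBall 0 R := by
    intro x hx
    rw [mem_closedBall_zero_iff]
    by_contra h
    exact hx (hsupp x (not_le.1 h))
  rw [← integrableOn_iff_integrable_of_support_subset hsub]
  have : IsFiniteMeasure (volume.restrict (Metric.closedBall (0 : R3) R)) :=
    ⟨by rw [Measure.restrict_apply_univ]; exact measure_closedBall_lt_top⟩
  exact (hg.restrict _).integrable (by norm_num)

/-- The volume of the unit ball of `ℝ³`. -/
noncomputable def ballVolume : ℝ := (volume : Measure R3).real (Metric.ball 0 1)

theorem ballVolume_pos : 0 < ballVolume :=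
  ENNReal.toReal_pos (Metric.measure_ball_pos _ _ one_pos).ne' measure_ball_lt_top.ne

/-- Cauchy-Schwarz on the ball, in the form ∫ (|g| - n/W)² ≥ 0 with n the L¹ norm, W the volume and
n/W the mean of |g|. -/
theorem sq_integral_norm_le {g : R3 → ℂ} (hg : MemLp g 2) {R : ℝ} (hR : 0 < R)
    (hsupp : ∀ x, R < ‖x‖ → g x = 0) :
    (∫ x, ‖g x‖) ^ 2 ≤ ballVolume * R ^ 3 * ∫ x, ‖g x‖ ^ 2 := by
  have h1 := (integrable_of_support hg hsupp).norm
  have h2 : Integrable (fun x => ‖g x‖ ^ 2) := hg.integrable_norm_pow (by norm_num)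
  set n := ∫ x, ‖g x‖ with hn
  set W := ballVolume * R ^ 3 with hW
  have hW0 : 0 < W := mul_pos ballVolume_pos (by positivity)
  have hvol : ∫ x : R3, (Metric.closedBall (0 : R3) R).indicator (fun _ => (n / W) ^ 2) x
      = W * (n / W) ^ 2 := by
    rw [integral_indicator measurableSet_closedBall, setIntegral_const, smul_eq_mul,
      Measure.addHaar_real_closedBall _ _ hR.le]
    simp only [finrank_euclideanSpace, Fintype.card_fin]
    rw [hW, ballVolume]; ring
  have hi : Integrable ((Metric.closedBall (0 : R3) R).indicator fun _ => (n / W) ^ 2) :=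
    (integrable_indicator_iff measurableSet_closedBall).2
      (integrableOn_const measure_closedBall_lt_top.ne)
  have key : ∫ x, 2 * (n / W) * ‖g x‖ ≤
      ∫ x, (‖g x‖ ^ 2 + (Metric.closedBall (0 : R3) R).indicator (fun _ => (n / W) ^ 2) x) := by
    refine integral_mono (h1.const_mul _) (h2.add hi) fun x => ?_
    simp only
    by_cases hx : x ∈ Metric.closedBall (0 : R3) R
    · rw [Set.indicator_of_mem hx]
      nlinarith [sq_nonneg (‖g x‖ - n / W)]
    · rw [mem_closedBall_zero_iff, not_le] at hx
      rw [hsupp x hx]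
      simp only [norm_zero, mul_zero]
      have : 0 ≤ (Metric.closedBall (0 : R3) R).indicator (fun _ => (n / W) ^ 2) x :=
        Set.indicator_nonneg (fun _ _ => sq_nonneg _) x
      linarith
  rw [integral_const_mul, integral_add h2 hi, hvol, ← hn] at key
  have e : 2 * (n / W) * n - W * (n / W) ^ 2 = n ^ 2 / W := by field_simp; ring
  have : n ^ 2 / W ≤ ∫ x, ‖g x‖ ^ 2 := by linarith
  rw [div_le_iff₀ hW0] at this
  linarith

theorem norm_fourier_le (g : R3 → ℂ) (ξ : R3) : ‖𝓕 g ξ‖ ≤ ∫ x, ‖g x‖ :=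
  VectorFourier.norm_fourierIntegral_le_integral_norm _ _ _ _ _

/-- Multiplication by `-2πi x·v`. -/
noncomputable def positionMul (v : R3) (g : R3 → ℂ) (x : R3) : ℂ :=
  -(2 * Real.pi * Complex.I) * (inner ℝ x v : ℝ) * g x

theorem norm_positionMul_le {g : R3 → ℂ} {R : ℝ} (hR : 0 < R)
    (hsupp : ∀ x, R < ‖x‖ → g x = 0) (v x : R3) :
    ‖positionMul v g x‖ ≤ 2 * Real.pi * (R * ‖v‖) * ‖g x‖ := by
  by_cases hx : R < ‖x‖
  · rw [positionMul, hsupp x hx, mul_zero, norm_zero]; positivity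
  · have h1 : ‖inner ℝ x v‖ ≤ R * ‖v‖ :=
      (norm_inner_le_norm x v).trans (by gcongr; exact not_lt.1 hx)
    simp only [positionMul, norm_mul, norm_neg, Complex.norm_real, Complex.norm_I,
      Complex.norm_ofNat, mul_one, Real.norm_of_nonneg Real.pi_pos.le]
    gcongr

theorem memLp_positionMul {g : R3 → ℂ} (hg : MemLp g 2) {R : ℝ} (hR : 0 < R)
    (hsupp : ∀ x, R < ‖x‖ → g x = 0) (v : R3) : MemLp (positionMul v g) 2 :=
  hg.of_le_mul ((by fun_prop : Continuous fun x : R3 =>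
      -(2 * Real.pi * Complex.I) * ((inner ℝ x v : ℝ) : ℂ)).aestronglyMeasurable.mul hg.1)
    (Eventually.of_forall (norm_positionMul_le hR hsupp v))

theorem positionMul_support {g : R3 → ℂ} {R : ℝ} (hsupp : ∀ x, R < ‖x‖ → g x = 0) (v x : R3)
    (hx : R < ‖x‖) : positionMul v g x = 0 := by
  rw [positionMul, hsupp x hx, mul_zero]

theorem hasFDerivAt_fourier_of_support {g : R3 → ℂ} (hg : MemLp g 2) {R : ℝ}
    (hsupp : ∀ x, R < ‖x‖ → g x = 0) (ξ : R3) :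
    ∃ D : R3 →L[ℝ] ℂ, HasFDerivAt (𝓕 g) D ξ ∧ ∀ v, D v = 𝓕 (positionMul v g) ξ := by
  have h1 := integrable_of_support hg hsupp
  have h2 : Integrable (fun x => ‖x‖ * ‖g x‖) := by
    refine (h1.norm.const_mul R).mono' (continuous_norm.aestronglyMeasurable.mul h1.1.norm)
      (Eventually.of_forall fun x => ?_)
    rw [Real.norm_of_nonneg (by positivity)]
    by_cases hx : R < ‖x‖
    · rw [hsupp x hx]; simp
    · gcongr; exact not_lt.1 hx
  refine ⟨_, Real.hasFDerivAt_fourier h1 h2 ξ, fun v => ?_⟩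
  have h3 : Integrable (VectorFourier.fourierSMulRight (innerSL ℝ) g) := by
    refine (h2.const_mul (2 * Real.pi * ‖(innerSL ℝ : R3 →L[ℝ] R3 →L[ℝ] ℝ)‖)).mono'
      h1.1.fourierSMulRight (Eventually.of_forall fun x => ?_)
    refine (VectorFourier.norm_fourierSMulRight_le _ g x).trans (le_of_eq (by ring))
  rw [Real.fourier_continuousLinearMap_apply h3]
  have e : (fun x => VectorFourier.fourierSMulRight (innerSL ℝ) g x v) = positionMul v g := by
    funext x
    rw [VectorFourier.fourierSMulRight_apply, positionMul,
      show ((innerSL ℝ) x) v = inner ℝ x v from rfl, Complex.real_smul, smul_eq_mul]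
    ring
  rw [e]

end Localized

/-! ### Radial bounds for the Fourier transform along almost every ray. -/

section SphericalBounds

theorem continuous_fourier {g : R3 → ℂ} (hg : Integrable g) : Continuous (𝓕 g) :=
  VectorFourier.fourierIntegral_continuous Real.continuous_fourierChar continuous_inner hg

/-- The directional derivative is linear in the unit vector θ, so Cauchy-Schwarz bounds it by the
full gradient. The right side no longer depends on θ except through ξ, so it can be integrated in
polar coordinates. -/
theorem norm_sq_fourier_positionMul_le {g : R3 → ℂ} (hg : MemLp g 2) {R : ℝ}
    (hsupp : ∀ x, R < ‖x‖ → g x = 0) (θ : S2) (ξ : R3) :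
    ‖𝓕 (positionMul θ g) ξ‖ ^ 2 ≤
      ∑ l, ‖𝓕 (positionMul (EuclideanSpace.basisFun (Fin 3) ℝ l) g) ξ‖ ^ 2 := by
  obtain ⟨D, -, hD⟩ := hasFDerivAt_fourier_of_support hg hsupp ξ
  simp only [← hD]
  have h1 : D θ = ∑ l, (θ : R3) l • D (EuclideanSpace.basisFun (Fin 3) ℝ l) := by
    conv_lhs => rw [← (EuclideanSpace.basisFun (Fin 3) ℝ).sum_repr (θ : R3)]
    simp only [map_sum, map_smul]
    rfl
  have h2 : ‖D θ‖ ≤ ∑ l, |(θ : R3) l| * ‖D (EuclideanSpace.basisFun (Fin 3) ℝ l)‖ := by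
    rw [h1]
    refine (norm_sum_le _ _).trans (le_of_eq ?_)
    simp only [norm_smul, Real.norm_eq_abs]
  have h3 : ∑ l, |(θ : R3) l| ^ 2 = 1 := by
    have := EuclideanSpace.real_norm_sq_eq (θ : R3)
    rw [norm_eq_of_mem_sphere θ] at this
    simp only [sq_abs]
    linarith
  calc ‖D θ‖ ^ 2 ≤ (∑ l, |(θ : R3) l| * ‖D (EuclideanSpace.basisFun (Fin 3) ℝ l)‖) ^ 2 := by
        gcongr
    _ ≤ (∑ l, |(θ : R3) l| ^ 2) * ∑ l, ‖D (EuclideanSpace.basisFun (Fin 3) ℝ l)‖ ^ 2 :=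
        Finset.sum_mul_sq_le_sq_mul_sq _ _ _
    _ = _ := by rw [h3, one_mul]

/-- The constant in the spherical bounds. -/
noncomputable def sphericalConst : ℝ :=
  1 + 12 * Real.pi ^ 2 + ballVolume * sphereMeasure.real Set.univ

theorem sphericalConst_pos : 0 < sphericalConst := by
  have := ballVolume_pos
  unfold sphericalConst
  positivity

/-- q(θ) collects the mass of ĝ on the ray, R⁻² times that of its gradient, and a constant. Averaged
over θ these give, by Plancherel and |x| ≤ R on the support, the three terms of `sphericalConst`.
The constant term also makes q positive. -/
theorem exists_radialBound {g : R3 → ℂ} (hg : MemLp g 2) {R : ℝ} (hR : 0 < R)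
    (hsupp : ∀ x, R < ‖x‖ → g x = 0) (hpos : 0 < ∫ x, ‖g x‖ ^ 2) :
    ∃ q : S2 → ℝ, Integrable q sphereMeasure ∧ (∀ θ, 0 < q θ) ∧
      (∫ θ : S2, q θ ∂sphereMeasure) ≤ sphericalConst * ∫ x, ‖g x‖ ^ 2 ∧
      ∀ᵐ (θ : S2) ∂sphereMeasure, RadialBound (fun r => 𝓕 g (r • (θ : R3)))
        (fun r => 𝓕 (positionMul θ g) (r • (θ : R3))) R (Real.sqrt (q θ)) := by
  set N := ∫ x, ‖g x‖ ^ 2 with hN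
  have hB := ballVolume_pos
  have hg1 := integrable_of_support hg hsupp
  set e : Fin 3 → R3 := fun l => EuclideanSpace.basisFun (Fin 3) ℝ l with he
  have hp2 := fun v => memLp_positionMul hg hR hsupp v
  have hp1 := fun v => integrable_of_support (hp2 v) (positionMul_support hsupp v)
  have hgn : Integrable (fun x => ‖g x‖ ^ 2) := hg.integrable_norm_pow (by norm_num)
  have hA : Integrable (fun ξ => ‖𝓕 g ξ‖ ^ 2) :=
    (memLp_fourier hg1 hg).integrable_norm_pow (by norm_num)
  have hBl : ∀ l ∈ (Finset.univ : Finset (Fin 3)),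
      Integrable (fun ξ => ‖𝓕 (positionMul (e l) g) ξ‖ ^ 2) := fun l _ =>
    (memLp_fourier (hp1 _) (hp2 _)).integrable_norm_pow (by norm_num)
  have hBi : Integrable (fun ξ => ∑ l, ‖𝓕 (positionMul (e l) g) ξ‖ ^ 2) :=
    integrable_finsetSum _ hBl
  obtain ⟨iA, eA⟩ := integral_polar hA
  obtain ⟨iB, eB⟩ := integral_polar hBi
  set a : S2 → ℝ := fun θ => ∫ r, ‖𝓕 g (r • (θ : R3))‖ ^ 2 ∂radialMeasure with ha
  set b : S2 → ℝ := fun θ =>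
    ∫ r, ∑ l, ‖𝓕 (positionMul (e l) g) (r • (θ : R3))‖ ^ 2 ∂radialMeasure with hb
  have ia : Integrable a sphereMeasure := iA.integral_prod_left
  have ib : Integrable b sphereMeasure := iB.integral_prod_left
  have va : (∫ θ : S2, a θ ∂sphereMeasure) = N := by
    rw [ha, ← eA, integral_norm_sq_fourier hg1 hg]
  have vb : (∫ θ : S2, b θ ∂sphereMeasure) ≤ 12 * Real.pi ^ 2 * R ^ 2 * N := by
    rw [hb, ← eB, integral_finsetSum _ hBl]
    have hl : ∀ l ∈ (Finset.univ : Finset (Fin 3)),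
        ∫ ξ, ‖𝓕 (positionMul (e l) g) ξ‖ ^ 2 ≤ 4 * Real.pi ^ 2 * R ^ 2 * N := by
      intro l _
      rw [integral_norm_sq_fourier (hp1 _) (hp2 _), hN, ← integral_const_mul]
      refine integral_mono ((hp2 _).integrable_norm_pow (by norm_num)) (hgn.const_mul _)
        fun x => ?_
      have h1 := norm_positionMul_le hR hsupp (e l) x
      have h2 : ‖e l‖ = 1 := (EuclideanSpace.basisFun (Fin 3) ℝ).orthonormal.1 l
      rw [h2, mul_one] at h1
      calc ‖positionMul (e l) g x‖ ^ 2 ≤ (2 * Real.pi * R * ‖g x‖) ^ 2 := by gcongr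
        _ = _ := by ring
    refine (Finset.sum_le_sum hl).trans (le_of_eq ?_)
    simp
    ring
  have ha0 : ∀ θ, 0 ≤ a θ := fun θ => integral_nonneg fun r => by positivity
  have hb0 : ∀ θ, 0 ≤ b θ := fun θ => integral_nonneg fun r => by positivity
  have iq1 : Integrable (fun θ => a θ + (R ^ 2)⁻¹ * b θ) sphereMeasure := ia.add (ib.const_mul _)
  have hBN : 0 < ballVolume * N := mul_pos hB hpos
  have hq0 : ∀ θ, 0 < a θ + (R ^ 2)⁻¹ * b θ + ballVolume * N := fun θ => by
    have := ha0 θ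
    have := hb0 θ
    positivity
  refine ⟨fun θ => a θ + (R ^ 2)⁻¹ * b θ + ballVolume * N, iq1.add (integrable_const _), hq0, ?_, ?_⟩
  · rw [integral_add iq1 (integrable_const _), integral_add ia (ib.const_mul _),
      integral_const_mul, va, integral_const, smul_eq_mul]
    calc N + (R ^ 2)⁻¹ * ((∫ θ : S2, b θ ∂sphereMeasure)) + sphereMeasure.real Set.univ * (ballVolume * N)
        ≤ N + (R ^ 2)⁻¹ * (12 * Real.pi ^ 2 * R ^ 2 * N) +
          sphereMeasure.real Set.univ * (ballVolume * N) := by gcongr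
      _ = _ := by rw [sphericalConst]; field_simp
  · filter_upwards [iA.prod_right_ae, iB.prod_right_ae] with θ hθA hθB
    rw [integrable_radialMeasure] at hθA hθB
    simp only [smul_eq_mul] at hθA hθB
    have ea : a θ = ∫ r in Set.Ioi 0, r ^ 2 * ‖𝓕 g (r • (θ : R3))‖ ^ 2 := by
      simp only [ha]; rw [integral_radialMeasure]; rfl
    have eb : b θ = ∫ r in Set.Ioi 0,
        r ^ 2 * ∑ l, ‖𝓕 (positionMul (e l) g) (r • (θ : R3))‖ ^ 2 := by
      simp only [hb]; rw [integral_radialMeasure]; rfl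
    have hc : Continuous fun r : ℝ => 𝓕 g (r • (θ : R3)) :=
      (continuous_fourier hg1).comp (by fun_prop)
    have hc' : Continuous fun r : ℝ => 𝓕 (positionMul θ g) (r • (θ : R3)) :=
      (continuous_fourier (hp1 _)).comp (by fun_prop)
    have hsqq := Real.sq_sqrt (hq0 θ).le
    have hder : ∀ r : ℝ, r ^ 2 * ‖𝓕 (positionMul θ g) (r • (θ : R3))‖ ^ 2 ≤
        r ^ 2 * ∑ l, ‖𝓕 (positionMul (e l) g) (r • (θ : R3))‖ ^ 2 := fun r =>
      mul_le_mul_of_nonneg_left (norm_sq_fourier_positionMul_le hg hsupp θ _) (sq_nonneg r)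
    have iD : IntegrableOn (fun r : ℝ => r ^ 2 * ‖𝓕 (positionMul θ g) (r • (θ : R3))‖ ^ 2)
        (Set.Ioi 0) :=
      Integrable.mono' hθB
        ((by fun_prop : Continuous fun r : ℝ =>
          r ^ 2 * ‖𝓕 (positionMul θ g) (r • (θ : R3))‖ ^ 2).aestronglyMeasurable.restrict)
        (Eventually.of_forall fun r => by rw [Real.norm_of_nonneg (by positivity)]; exact hder r)
    have hRi : 0 < R⁻¹ := inv_pos.2 hR
    have hsup : ∀ ξ, ‖𝓕 g ξ‖ ^ 2 ≤ ballVolume * R ^ 3 * N := fun ξ => by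
      have h1 := norm_fourier_le g ξ
      have h2 : ‖𝓕 g ξ‖ ^ 2 ≤ (∫ x, ‖g x‖) ^ 2 := by gcongr
      exact h2.trans (sq_integral_norm_le hg hR hsupp)
    -- Low frequencies r ≤ 1/R use the uniform bound on ĝ, contributing |B|R³N · R⁻¹ = R² |B|N;
    -- beyond 1/R the weight satisfies 1 ≤ R²r².
    have hself : ∀ r ∈ Set.Ioi (0 : ℝ), ‖𝓕 g (r • (θ : R3))‖ ^ 2 ≤
        (Set.Ioc 0 R⁻¹).indicator (fun _ => ballVolume * R ^ 3 * N) r +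
          R ^ 2 * (r ^ 2 * ‖𝓕 g (r • (θ : R3))‖ ^ 2) := by
      intro r hr
      have hr : 0 < r := hr
      by_cases h : r ≤ R⁻¹
      · rw [Set.indicator_of_mem (Set.mem_Ioc.2 ⟨hr, h⟩)]
        exact (hsup _).trans (le_add_of_nonneg_right (by positivity))
      · rw [Set.indicator_of_notMem fun h' => h h'.2, zero_add, ← mul_assoc, ← mul_pow]
        have : 1 ≤ R * r := by
          have := (not_le.1 h).le
          rwa [inv_le_iff_one_le_mul₀' hR] at this
        refine le_mul_of_one_le_left (by positivity) (one_le_pow₀ this)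
    have iI : Integrable ((Set.Ioc 0 R⁻¹).indicator (fun _ : ℝ => ballVolume * R ^ 3 * N)) :=
      (integrable_indicator_iff measurableSet_Ioc).2 (integrableOn_const (by simp))
    have iG : IntegrableOn (fun r : ℝ =>
        (Set.Ioc 0 R⁻¹).indicator (fun _ => ballVolume * R ^ 3 * N) r +
          R ^ 2 * (r ^ 2 * ‖𝓕 g (r • (θ : R3))‖ ^ 2)) (Set.Ioi 0) :=
      iI.integrableOn.add (hθA.const_mul _)
    have iS : IntegrableOn (fun r : ℝ => ‖𝓕 g (r • (θ : R3))‖ ^ 2) (Set.Ioi 0) :=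
      Integrable.mono' iG
        ((by fun_prop : Continuous fun r : ℝ =>
          ‖𝓕 g (r • (θ : R3))‖ ^ 2).aestronglyMeasurable.restrict)
        ((ae_restrict_iff' measurableSet_Ioi).2 (Eventually.of_forall fun r hr => by
          rw [Real.norm_of_nonneg (by positivity)]; exact hself r hr))
    refine ⟨fun r => ?_, hc', hθA, iD, iS, ?_, ?_, ?_⟩
    · obtain ⟨D, hD, hDv⟩ := hasFDerivAt_fourier_of_support hg hsupp (r • (θ : R3))
      rw [← hDv]
      have h1 : HasDerivAt (fun r : ℝ => r • (θ : R3)) (θ : R3) r := by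
        simpa using (hasDerivAt_id r).smul_const (θ : R3)
      exact hD.comp_hasDerivAt r h1
    · rw [hsqq, ← ea]
      have := mul_nonneg (inv_nonneg.2 (sq_nonneg R)) (hb0 θ)
      linarith
    · rw [hsqq]
      refine (integral_mono iD hθB hder).trans ?_
      rw [← eb]
      have e1 : R ^ 2 * (a θ + (R ^ 2)⁻¹ * b θ + ballVolume * N) =
          b θ + R ^ 2 * (a θ + ballVolume * N) := by field_simp; ring
      rw [e1]
      have := ha0 θ
      have : 0 ≤ R ^ 2 * (a θ + ballVolume * N) := by positivity
      linarith
    · rw [hsqq]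
      refine (setIntegral_mono_on iS iG measurableSet_Ioi hself).trans ?_
      rw [integral_add iI.integrableOn (hθA.const_mul _), integral_const_mul, ← ea,
        setIntegral_indicator measurableSet_Ioc,
        Set.inter_eq_right.2 Set.Ioc_subset_Ioi_self, setIntegral_const,
        Real.volume_real_Ioc_of_le hRi.le, smul_eq_mul]
      have e1 : R ^ 2 * (a θ + (R ^ 2)⁻¹ * b θ + ballVolume * N) =
          b θ + ((R⁻¹ - 0) * (ballVolume * R ^ 3 * N) + R ^ 2 * a θ) := by field_simp; ring
      rw [e1]
      linarith [hb0 θ]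

end SphericalBounds

/-! ### Time integrability of the half-wave pairing. -/

section Pairing

/-- The pairing `⟨g, e^{it|∇|} h⟩`, computed on the Fourier side. -/
noncomputable def wavePairing (g h : R3 → ℂ) (t : ℝ) : ℂ :=
  ∫ ξ, star (𝓕 g ξ) * 𝓕 h ξ * Complex.exp (((2 * Real.pi * ‖ξ‖ * t : ℝ) : ℂ) * Complex.I)

/-- The propagator depends on |ξ| only, so on each ray it is a one-dimensional character. The sign
of e^{+2πi rt} accounts for the argument -t. -/
theorem wavePairing_eq {g h : R3 → ℂ} (hg1 : Integrable g) (hg : MemLp g 2) (hh1 : Integrable h)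
    (hh : MemLp h 2) (t : ℝ) :
    wavePairing g h t = ∫ θ : S2,
      𝓕 (radialProfile (fun r => 𝓕 g (r • (θ : R3))) (fun r => 𝓕 h (r • (θ : R3)))) (-t)
        ∂sphereMeasure := by
  have hi : Integrable (fun ξ => star (𝓕 g ξ) * 𝓕 h ξ *
      Complex.exp (((2 * Real.pi * ‖ξ‖ * t : ℝ) : ℂ) * Complex.I)) :=
    (integrable_conj_mul (memLp_fourier hg1 hg) (memLp_fourier hh1 hh)).mul_bdd (c := 1)
      (by fun_prop : Continuous fun ξ : R3 =>
        Complex.exp (((2 * Real.pi * ‖ξ‖ * t : ℝ) : ℂ) * Complex.I)).aestronglyMeasurable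
      (Eventually.of_forall fun ξ => (Complex.norm_exp_ofReal_mul_I _).le)
  rw [wavePairing, (integral_polar hi).2]
  refine integral_congr_ae (Eventually.of_forall fun θ => ?_)
  simp only
  have hz : ∀ r : ℝ, r ∉ Set.Ioi (0 : ℝ) →
      Complex.exp (((-2 * Real.pi * r * -t : ℝ) : ℂ) * Complex.I) •
        radialProfile (fun r => 𝓕 g (r • (θ : R3))) (fun r => 𝓕 h (r • (θ : R3))) r = 0 := by
    intro r hr
    rw [radialProfile, max_eq_right (not_lt.1 (Set.mem_Ioi.not.1 hr))]
    simp
  rw [integral_radialMeasure, Real.fourier_real_eq_integral_exp_smul,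
    ← setIntegral_eq_integral_of_forall_compl_eq_zero hz]
  refine setIntegral_congr_fun measurableSet_Ioi fun r hr => ?_
  have hr : 0 < r := hr
  simp only [radialProfile, max_eq_left hr.le, norm_smul, norm_eq_of_mem_sphere θ,
    Real.norm_of_nonneg hr.le, smul_eq_mul, Complex.real_smul]
  rw [show 2 * Real.pi * (r * 1) * t = -2 * Real.pi * r * -t by ring]
  push_cast
  ring

theorem stronglyMeasurable_fourier_radialProfile {U W : R3 → ℂ} (hU : Continuous U)
    (hW : Continuous W) :
    StronglyMeasurable (fun p : ℝ × S2 =>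
      𝓕 (radialProfile (fun r => U (r • (p.2 : R3))) (fun r => W (r • (p.2 : R3)))) (-p.1)) := by
  simp only [Real.fourier_real_eq_integral_exp_smul, radialProfile]
  refine StronglyMeasurable.integral_prod_right
    (f := fun (p : ℝ × S2) (r : ℝ) => Complex.exp (((-2 * Real.pi * r * -p.1 : ℝ) : ℂ) * Complex.I) •
      ((((max r 0) ^ 2 : ℝ) : ℂ) * (star (U (r • (p.2 : R3))) * W (r • (p.2 : R3))))) ?_
  exact Continuous.stronglyMeasurable (by fun_prop)

/-- Tonelli exchanges t and θ. Weighting √q₁ √q₂ ≤ (n₂/n₁ q₁ + n₁/n₂ q₂)/2 by the norms makes the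
sphere integral proportional to n₁n₂; this requires both norms to be positive. -/
theorem lintegral_wavePairing_le {g h : R3 → ℂ} (hg : MemLp g 2) (hh : MemLp h 2)
    {R₁ R₂ : ℝ} (hR₁ : 0 < R₁) (hR₂ : 0 < R₂) (hgs : ∀ x, R₁ < ‖x‖ → g x = 0)
    (hhs : ∀ x, R₂ < ‖x‖ → h x = 0) (hgp : 0 < ∫ x, ‖g x‖ ^ 2) (hhp : 0 < ∫ x, ‖h x‖ ^ 2) :
    ∫⁻ t, ‖wavePairing g h t‖ₑ ≤ ENNReal.ofReal (8 * sphericalConst * Real.sqrt (R₁ * R₂) *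
      (Real.sqrt (∫ x, ‖g x‖ ^ 2) * Real.sqrt (∫ x, ‖h x‖ ^ 2))) := by
  have hg1 := integrable_of_support hg hgs
  have hh1 := integrable_of_support hh hhs
  obtain ⟨q₁, iq₁, pq₁, leq₁, ae₁⟩ := exists_radialBound hg hR₁ hgs hgp
  obtain ⟨q₂, iq₂, pq₂, leq₂, ae₂⟩ := exists_radialBound hh hR₂ hhs hhp
  set n₁ := Real.sqrt (∫ x, ‖g x‖ ^ 2) with hn₁
  set n₂ := Real.sqrt (∫ x, ‖h x‖ ^ 2) with hn₂
  have hn₁0 : 0 < n₁ := Real.sqrt_pos.2 hgp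
  have hn₂0 : 0 < n₂ := Real.sqrt_pos.2 hhp
  have hs₁ : ∫ x, ‖g x‖ ^ 2 = n₁ ^ 2 := (Real.sq_sqrt hgp.le).symm
  have hs₂ : ∫ x, ‖h x‖ ^ 2 = n₂ ^ 2 := (Real.sq_sqrt hhp.le).symm
  rw [hs₁] at leq₁
  rw [hs₂] at leq₂
  have hsm := stronglyMeasurable_fourier_radialProfile (continuous_fourier hg1)
    (continuous_fourier hh1)
  set Φ : ℝ × S2 → ℂ := fun p => 𝓕 (radialProfile (fun r => 𝓕 g (r • (p.2 : R3)))
    (fun r => 𝓕 h (r • (p.2 : R3)))) (-p.1) with hΦ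
  have hpt : ∀ᵐ (θ : S2) ∂sphereMeasure, ∫⁻ t, ‖Φ (t, θ)‖ₑ ≤
      ENNReal.ofReal (8 * Real.sqrt (R₁ * R₂) *
        (n₂ / n₁ / 2 * q₁ θ + n₁ / n₂ / 2 * q₂ θ)) := by
    filter_upwards [ae₁, ae₂] with θ h1 h2
    have hq1 := Real.sqrt_pos.2 (pq₁ θ)
    have hq2 := Real.sqrt_pos.2 (pq₂ θ)
    have := lintegral_fourier_radialProfile_le h1 h2 hR₁ hR₂ hq1 hq2
    simp only [hΦ]
    rw [lintegral_neg_eq_self (fun t => ‖𝓕 (radialProfile (fun r => 𝓕 g (r • (θ : R3)))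
      (fun r => 𝓕 h (r • (θ : R3)))) t‖ₑ)]
    refine this.trans (ENNReal.ofReal_le_ofReal ?_)
    gcongr
    set x := Real.sqrt (q₁ θ)
    set y := Real.sqrt (q₂ θ)
    have e1 : q₁ θ = x ^ 2 := (Real.sq_sqrt (pq₁ θ).le).symm
    have e2 : q₂ θ = y ^ 2 := (Real.sq_sqrt (pq₂ θ).le).symm
    rw [e1, e2]
    have e3 : n₂ / n₁ / 2 * x ^ 2 + n₁ / n₂ / 2 * y ^ 2 - x * y =
        (n₂ * x - n₁ * y) ^ 2 / (2 * n₁ * n₂) := by field_simp; ring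
    have : 0 ≤ (n₂ * x - n₁ * y) ^ 2 / (2 * n₁ * n₂) := by positivity
    linarith
  have iq : Integrable (fun θ => 8 * Real.sqrt (R₁ * R₂) *
      (n₂ / n₁ / 2 * q₁ θ + n₁ / n₂ / 2 * q₂ θ)) sphereMeasure :=
    ((iq₁.const_mul _).add (iq₂.const_mul _)).const_mul _
  calc ∫⁻ t, ‖wavePairing g h t‖ₑ
      ≤ ∫⁻ t, ∫⁻ θ : S2, ‖Φ (t, θ)‖ₑ ∂sphereMeasure := by
        refine lintegral_mono fun t => ?_
        rw [wavePairing_eq hg1 hg hh1 hh]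
        exact enorm_integral_le_lintegral_enorm _
    _ = ∫⁻ θ : S2, (∫⁻ t, ‖Φ (t, θ)‖ₑ) ∂sphereMeasure :=
        lintegral_lintegral_swap hsm.enorm.aemeasurable
    _ ≤ ∫⁻ θ : S2, ENNReal.ofReal (8 * Real.sqrt (R₁ * R₂) *
        (n₂ / n₁ / 2 * q₁ θ + n₁ / n₂ / 2 * q₂ θ)) ∂sphereMeasure := lintegral_mono_ae hpt
    _ = ENNReal.ofReal (∫ θ : S2, 8 * Real.sqrt (R₁ * R₂) *
        (n₂ / n₁ / 2 * q₁ θ + n₁ / n₂ / 2 * q₂ θ) ∂sphereMeasure) :=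
        (ofReal_integral_eq_lintegral_ofReal iq (Eventually.of_forall fun θ => by
          have := (pq₁ θ).le
          have := (pq₂ θ).le
          simp only [Pi.zero_apply]
          positivity)).symm
    _ ≤ _ := by
        refine ENNReal.ofReal_le_ofReal ?_
        rw [integral_const_mul, integral_add (iq₁.const_mul _) (iq₂.const_mul _),
          integral_const_mul, integral_const_mul]
        calc 8 * Real.sqrt (R₁ * R₂) * (n₂ / n₁ / 2 * (∫ θ : S2, q₁ θ ∂sphereMeasure) +
              n₁ / n₂ / 2 * (∫ θ : S2, q₂ θ ∂sphereMeasure))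
            ≤ 8 * Real.sqrt (R₁ * R₂) * (n₂ / n₁ / 2 * (sphericalConst * n₁ ^ 2) +
              n₁ / n₂ / 2 * (sphericalConst * n₂ ^ 2)) := by gcongr
          _ = _ := by field_simp; ring

/-- Adds the degenerate case: a function of zero norm has identically vanishing transform, hence
zero pairing. -/
theorem integrable_wavePairing {g h : R3 → ℂ} (hg : MemLp g 2) (hh : MemLp h 2)
    {R₁ R₂ : ℝ} (hR₁ : 0 < R₁) (hR₂ : 0 < R₂) (hgs : ∀ x, R₁ < ‖x‖ → g x = 0)
    (hhs : ∀ x, R₂ < ‖x‖ → h x = 0) :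
    Integrable (wavePairing g h) ∧
    ∫ t, ‖wavePairing g h t‖ ≤ 8 * sphericalConst * Real.sqrt (R₁ * R₂) *
      (Real.sqrt (∫ x, ‖g x‖ ^ 2) * Real.sqrt (∫ x, ‖h x‖ ^ 2)) := by
  have hg1 := integrable_of_support hg hgs
  have hh1 := integrable_of_support hh hhs
  have hC := sphericalConst_pos
  have hzero : ∀ {f : R3 → ℂ}, MemLp f 2 → ¬ 0 < ∫ x, ‖f x‖ ^ 2 → 𝓕 f = 0 := by
    intro f hf hn
    have h0 : ∫ x, ‖f x‖ ^ 2 = 0 :=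
      le_antisymm (not_lt.1 hn) (integral_nonneg fun x => by positivity)
    rw [integral_eq_zero_iff_of_nonneg (fun x => by positivity)
      (hf.integrable_norm_pow (by norm_num))] at h0
    funext ξ
    rw [Real.fourier_eq]
    refine integral_eq_zero_of_ae ?_
    filter_upwards [h0] with x hx
    have : f x = 0 := by simpa using hx
    simp [this]
  have htriv : (wavePairing g h = 0) → Integrable (wavePairing g h) ∧
      ∫ t, ‖wavePairing g h t‖ ≤ 8 * sphericalConst * Real.sqrt (R₁ * R₂) *
      (Real.sqrt (∫ x, ‖g x‖ ^ 2) * Real.sqrt (∫ x, ‖h x‖ ^ 2)) := by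
    intro h0
    rw [h0]
    refine ⟨integrable_zero _ _ _, ?_⟩
    simp only [Pi.zero_apply, norm_zero, integral_zero]
    positivity
  by_cases hgp : 0 < ∫ x, ‖g x‖ ^ 2
  · by_cases hhp : 0 < ∫ x, ‖h x‖ ^ 2
    · have hle := lintegral_wavePairing_le hg hh hR₁ hR₂ hgs hhs hgp hhp
      have hm : AEStronglyMeasurable (wavePairing g h) volume := by
        have h1 : Continuous fun p : ℝ × R3 => star (𝓕 g p.2) * 𝓕 h p.2 *
            Complex.exp (((2 * Real.pi * ‖p.2‖ * p.1 : ℝ) : ℂ) * Complex.I) := by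
          have := continuous_fourier hg1
          have := continuous_fourier hh1
          fun_prop
        exact (StronglyMeasurable.integral_prod_right
          (f := fun (t : ℝ) (ξ : R3) => star (𝓕 g ξ) * 𝓕 h ξ *
            Complex.exp (((2 * Real.pi * ‖ξ‖ * t : ℝ) : ℂ) * Complex.I))
          h1.stronglyMeasurable).aestronglyMeasurable
      refine ⟨⟨hm, hle.trans_lt ENNReal.ofReal_lt_top⟩, ?_⟩
      rw [integral_norm_eq_lintegral_enorm hm]
      exact ENNReal.toReal_le_of_le_ofReal (by positivity) hle
    · refine htriv (funext fun t => ?_)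
      simp [wavePairing, hzero hh hhp]
  · refine htriv (funext fun t => ?_)
    simp [wavePairing, hzero hg hgp]

theorem resolvent_pairing_of_support {g h : R3 → ℂ} (hg : MemLp g 2) (hh : MemLp h 2)
    {R₁ R₂ : ℝ} (hR₁ : 0 < R₁) (hR₂ : 0 < R₂) (hgs : ∀ x, R₁ < ‖x‖ → g x = 0)
    (hhs : ∀ x, R₂ < ‖x‖ → h x = 0) (a : ℝ) :
    (∃ L : ℂ, Tendsto (fun ε : ℝ => ∫ ξ, star (𝓕 g ξ) * 𝓕 h ξ *
      (((2 * Real.pi * ‖ξ‖ : ℝ) : ℂ) - a + Complex.I * ε)⁻¹) (𝓝[>] 0) (𝓝 L)) ∧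
    ∀ ε : ℝ, 0 < ε → ‖∫ ξ, star (𝓕 g ξ) * 𝓕 h ξ *
      (((2 * Real.pi * ‖ξ‖ : ℝ) : ℂ) - a + Complex.I * ε)⁻¹‖ ≤
      8 * sphericalConst * Real.sqrt (R₁ * R₂) *
      (Real.sqrt (∫ x, ‖g x‖ ^ 2) * Real.sqrt (∫ x, ‖h x‖ ^ 2)) := by
  obtain ⟨hK, hKle⟩ := integrable_wavePairing hg hh hR₁ hR₂ hgs hhs
  have hH : Integrable (fun ξ => star (𝓕 g ξ) * 𝓕 h ξ) :=
    integrable_conj_mul (memLp_fourier (integrable_of_support hg hgs) hg)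
      (memLp_fourier (integrable_of_support hh hhs) hh)
  obtain ⟨h1, h2⟩ := resolvent_limit hH (lam := fun ξ : R3 => 2 * Real.pi * ‖ξ‖) (by fun_prop) hK a
  exact ⟨h1, fun ε hε => (h2 ε hε).trans hKle⟩

end Pairing

/-! ### From Fourier integrals to the resolvent on L², and summation of limits. -/

section Resolvent

theorem resolvent_multiplier_star (a ε : ℝ) (ξ : R3) :
    star ((((2 * Real.pi * ‖ξ‖ : ℝ) : ℂ) - (a : ℂ) + Complex.I * (ε : ℂ))⁻¹) =
      (((2 * Real.pi * ‖ξ‖ : ℝ) : ℂ) - (a : ℂ) - Complex.I * (ε : ℂ))⁻¹ := by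
  simp [sub_eq_add_neg]

theorem fourier_halfWaveResolvent {a ε : ℝ} (hε : 0 < ε) (h : L2) :
    ((𝓕 (halfWaveResolvent a ε h) : L2) : R3 → ℂ) =ᵐ[volume] fun ξ =>
      (((2 * Real.pi * ‖ξ‖ : ℝ) : ℂ) - (a : ℂ) + Complex.I * (ε : ℂ))⁻¹ * (𝓕 h : L2) ξ := by
  have hm := memLp_halfWave_mul (a := a) hε h
  have e : (𝓕 (halfWaveResolvent a ε h) : L2) = hm.toLp _ := by
    rw [halfWaveResolvent, fourierMultiplier, FourierTransform.fourier_fourierInv_eq, toL2,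
      dif_pos hm]
  rw [e]
  exact hm.coeFn_toLp

theorem inner_halfWaveResolvent {a ε : ℝ} (hε : 0 < ε) (g h : L2) :
    inner ℂ g (halfWaveResolvent a ε h) = ∫ ξ, star ((𝓕 g : L2) ξ) * (𝓕 h : L2) ξ *
      (((2 * Real.pi * ‖ξ‖ : ℝ) : ℂ) - a + Complex.I * ε)⁻¹ := by
  rw [← Lp.inner_fourier_eq, L2.inner_def]
  refine integral_congr_ae ?_
  filter_upwards [fourier_halfWaveResolvent (a := a) hε h] with ξ hξ
  rw [hξ, RCLike.inner_apply]
  simp only [RCLike.star_def]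
  ring

/-- The adjoint has the conjugate multiplier. Its purpose is to show that the pairing is linear and
continuous in h, so that it can be summed termwise. -/
theorem exists_adjoint_halfWaveResolvent {a ε : ℝ} (hε : 0 < ε) (g : L2) :
    ∃ y : L2, ∀ h : L2, inner ℂ g (halfWaveResolvent a ε h) = inner ℂ y h := by
  have hm := memLp_halfWave_mul (a := a) hε g
  have hm' : MemLp (fun ξ : R3 => star ((((2 * Real.pi * ‖ξ‖ : ℝ) : ℂ) - (a : ℂ)
      + Complex.I * (ε : ℂ))⁻¹) * (𝓕 g : L2) ξ) 2 := by
    refine hm.of_le (AEStronglyMeasurable.mul ?_ (Lp.memLp (𝓕 g : L2)).1)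
      (Eventually.of_forall fun ξ => by rw [norm_mul, norm_mul, norm_star])
    simp only [resolvent_multiplier_star]
    exact (by fun_prop : Measurable fun ξ : R3 =>
      (((2 * Real.pi * ‖ξ‖ : ℝ) : ℂ) - (a : ℂ) - Complex.I * (ε : ℂ))⁻¹).aestronglyMeasurable
  refine ⟨𝓕⁻ (hm'.toLp _), fun h => ?_⟩
  rw [inner_halfWaveResolvent hε, ← Lp.inner_fourier_eq (𝓕⁻ (hm'.toLp _)),
    FourierTransform.fourier_fourierInv_eq, L2.inner_def]
  refine integral_congr_ae ?_
  filter_upwards [hm'.coeFn_toLp] with ξ hξ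
  rw [hξ, RCLike.inner_apply, map_mul]
  simp only [RCLike.star_def, RCLike.conj_conj]
  ring

theorem resolvent_toLp_of_support {g h : R3 → ℂ} (hg : MemLp g 2) (hh : MemLp h 2)
    {R₁ R₂ : ℝ} (hR₁ : 0 < R₁) (hR₂ : 0 < R₂) (hgs : ∀ x, R₁ < ‖x‖ → g x = 0)
    (hhs : ∀ x, R₂ < ‖x‖ → h x = 0) (a : ℝ) :
    (∃ L : ℂ, Tendsto (fun ε : ℝ => inner ℂ (hg.toLp g) (halfWaveResolvent a ε (hh.toLp h)))
      (𝓝[>] 0) (𝓝 L)) ∧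
    ∀ ε : ℝ, 0 < ε → ‖inner ℂ (hg.toLp g) (halfWaveResolvent a ε (hh.toLp h))‖ ≤
      8 * sphericalConst * Real.sqrt (R₁ * R₂) *
      (Real.sqrt (∫ x, ‖g x‖ ^ 2) * Real.sqrt (∫ x, ‖h x‖ ^ 2)) := by
  obtain ⟨⟨L, hL⟩, hb⟩ := resolvent_pairing_of_support hg hh hR₁ hR₂ hgs hhs a
  have e : ∀ ε : ℝ, 0 < ε → inner ℂ (hg.toLp g) (halfWaveResolvent a ε (hh.toLp h)) =
      ∫ ξ, star (𝓕 g ξ) * 𝓕 h ξ * (((2 * Real.pi * ‖ξ‖ : ℝ) : ℂ) - a + Complex.I * ε)⁻¹ := by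
    intro ε hε
    rw [inner_halfWaveResolvent hε]
    refine integral_congr_ae ?_
    filter_upwards [fourier_toLp_ae_eq (integrable_of_support hg hgs) hg,
      fourier_toLp_ae_eq (integrable_of_support hh hhs) hh] with ξ h1 h2
    rw [h1, h2]
  refine ⟨⟨L, hL.congr' ?_⟩, fun ε hε => by rw [e ε hε]; exact hb ε hε⟩
  filter_upwards [self_mem_nhdsWithin] with ε hε
  exact (e ε hε).symm

/-- Tannery's theorem with a geometric majorant independent of ε. -/
theorem series_limit {f : ℝ → ℕ → ℂ} {S : ℝ → ℂ} {A q : ℝ} (hq0 : 0 ≤ q) (hq1 : q < 1)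
    (hsum : ∀ ε, 0 < ε → HasSum (f ε) (S ε)) (hb : ∀ ε, 0 < ε → ∀ j, ‖f ε j‖ ≤ A * q ^ j)
    (hlim : ∀ j, ∃ L, Tendsto (fun ε => f ε j) (𝓝[>] 0) (𝓝 L)) :
    (∃ L, Tendsto S (𝓝[>] 0) (𝓝 L)) ∧ ∀ ε, 0 < ε → ‖S ε‖ ≤ A * (1 - q)⁻¹ := by
  have hgeo := (hasSum_geometric_of_lt_one hq0 hq1).mul_left A
  constructor
  · choose L hL using hlim
    refine ⟨∑' j, L j, ?_⟩
    refine (tendsto_tsum_of_dominated_convergence hgeo.summable hL ?_).congr' ?_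
    · filter_upwards [self_mem_nhdsWithin] with ε hε using hb ε hε
    · filter_upwards [self_mem_nhdsWithin] with ε hε using (hsum ε hε).tsum_eq
  · intro ε hε
    rw [← (hsum ε hε).tsum_eq]
    exact tsum_of_norm_bounded hgeo (hb ε hε)

end Resolvent

/-! ### Dyadic decomposition and limiting absorption in L²_s. -/

section Dyadic

/-- The dyadic shell `2^j ≤ ⟨x⟩ < 2^{j+1}`. -/
def shell (j : ℕ) : Set R3 := {x | 2 ^ j ≤ bracket x ∧ bracket x < 2 ^ (j + 1)}

theorem measurableSet_shell (j : ℕ) : MeasurableSet (shell j) :=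
  (isClosed_le continuous_const continuous_bracket).measurableSet.inter
    (isOpen_lt continuous_bracket continuous_const).measurableSet

theorem norm_le_bracket (x : R3) : ‖x‖ ≤ bracket x :=
  Real.le_sqrt_of_sq_le (by linarith)

theorem toReal_eLpNorm_two {f : R3 → ℂ} (hf : MemLp f 2) :
    (eLpNorm f 2 volume).toReal = Real.sqrt (∫ x, ‖f x‖ ^ 2) := by
  rw [hf.eLpNorm_eq_integral_rpow_norm (by norm_num) (by norm_num),
    ENNReal.toReal_ofReal (by positivity), Real.sqrt_eq_rpow]
  simp

/-- On A the weight ⟨x⟩^s is at least 2^{sN}. -/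
theorem sqrt_integral_indicator_le {s : ℝ} (hs : 0 ≤ s) {g : R3 → ℂ} (hg : MemWeightedL2 s g)
    {A : Set R3} (hA : MeasurableSet A) {N : ℕ} (hN : ∀ x ∈ A, 2 ^ N ≤ bracket x) :
    Real.sqrt (∫ x, ‖A.indicator g x‖ ^ 2) ≤ ((2 ^ s)⁻¹) ^ N * weightedL2Norm s g := by
  have h2 : (0 : ℝ) < 2 ^ s := by positivity
  have hg2 : MemLp g 2 := memLp_of_weighted hs hg
  rw [weightedL2Norm, toReal_eLpNorm_two hg]
  refine Real.sqrt_le_iff.2 ⟨by positivity, ?_⟩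
  rw [mul_pow, Real.sq_sqrt (integral_nonneg fun x => by positivity), ← integral_const_mul]
  refine integral_mono ((hg2.indicator hA).integrable_norm_pow (by norm_num))
    ((hg.integrable_norm_pow (by norm_num)).const_mul _) fun x => ?_
  by_cases hx : x ∈ A
  · simp only [Set.indicator_of_mem hx]
    rw [← mul_pow]
    gcongr
    rw [norm_weighted, ← mul_assoc]
    refine le_mul_of_one_le_left (norm_nonneg _) ?_
    rw [inv_pow, ← div_eq_inv_mul, one_le_div (by positivity), ← Real.rpow_mul_natCast (by norm_num),
      mul_comm, Real.rpow_natCast_mul (by norm_num)]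
    exact Real.rpow_le_rpow (by positivity) (hN x hx) hs
  · simp only [Set.indicator_of_notMem hx]
    rw [norm_zero, zero_pow two_ne_zero]
    positivity

theorem norm_toLp_eq {f : R3 → ℂ} (hf : MemLp f 2) :
    ‖hf.toLp f‖ = Real.sqrt (∫ x, ‖f x‖ ^ 2) := by
  rw [Lp.norm_toLp, toReal_eLpNorm_two hf]

/-- Since ⟨x⟩ ≥ 1, the shells partition ℝ³ and partial sums are truncations to ⟨x⟩ < 2^N; the
remainder has norm at most 2^{-sN} times the weighted norm. -/
theorem hasSum_shell {s : ℝ} (hs : 0 < s) {g : R3 → ℂ} (hg : MemWeightedL2 s g)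
    (hg2 : MemLp g 2) :
    HasSum (fun j => (hg2.indicator (measurableSet_shell j)).toLp ((shell j).indicator g))
      (hg2.toLp g) := by
  have h2 : (1 : ℝ) < 2 ^ s := Real.one_lt_rpow (by norm_num) hs
  have hr0 : (0 : ℝ) ≤ (2 ^ s)⁻¹ := by positivity
  have hr1 : ((2 : ℝ) ^ s)⁻¹ < 1 := inv_lt_one_of_one_lt₀ h2
  have hmB : ∀ N : ℕ, MeasurableSet {x : R3 | bracket x < 2 ^ N} := fun N =>
    (isOpen_lt continuous_bracket continuous_const).measurableSet
  have hsummable : Summable fun j =>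
      (hg2.indicator (measurableSet_shell j)).toLp ((shell j).indicator g) := by
    refine Summable.of_norm_bounded
      ((summable_geometric_of_lt_one hr0 hr1).mul_right (weightedL2Norm s g)) fun j => ?_
    rw [norm_toLp_eq]
    exact sqrt_integral_indicator_le hs.le hg (measurableSet_shell j) fun x hx => hx.1
  rw [hsummable.hasSum_iff_tendsto_nat]
  have hpartial : ∀ N, ∑ j ∈ Finset.range N,
      (hg2.indicator (measurableSet_shell j)).toLp ((shell j).indicator g) =
      (hg2.indicator (hmB N)).toLp ({x : R3 | bracket x < 2 ^ N}.indicator g) := by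
    intro N
    induction N with
    | zero =>
      rw [Finset.sum_range_zero, ← MemLp.toLp_zero (MemLp.zero : MemLp (0 : R3 → ℂ) 2 volume)]
      refine MemLp.toLp_congr _ _ (Eventually.of_forall fun x =>
        (Set.indicator_of_notMem (fun hx => ?_) g).symm)
      have : bracket x < 2 ^ 0 := hx
      linarith [one_le_bracket x]
    | succ N ih =>
      rw [Finset.sum_range_succ, ih, ← MemLp.toLp_add]
      refine MemLp.toLp_congr _ _ (Eventually.of_forall fun x => ?_)
      have hmono : (2 : ℝ) ^ N ≤ 2 ^ (N + 1) := pow_le_pow_right₀ (by norm_num) (by omega)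
      simp only [Pi.add_apply, Set.indicator, shell, Set.mem_ofPred_eq]
      by_cases h1 : bracket x < 2 ^ N
      · simp [h1, h1.trans_le hmono, not_le.2 h1]
      · by_cases h2 : bracket x < 2 ^ (N + 1)
        · simp [h1, h2, not_lt.1 h1]
        · simp [h1, h2]
  simp only [hpartial]
  rw [tendsto_iff_norm_sub_tendsto_zero]
  have hdiff : ∀ N, ‖(hg2.indicator (hmB N)).toLp ({x : R3 | bracket x < 2 ^ N}.indicator g) -
      hg2.toLp g‖ ≤ ((2 ^ s)⁻¹) ^ N * weightedL2Norm s g := by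
    intro N
    rw [norm_sub_rev, ← MemLp.toLp_sub, norm_toLp_eq]
    have e : g - {x : R3 | bracket x < 2 ^ N}.indicator g =
        ({x : R3 | bracket x < 2 ^ N}ᶜ).indicator g := by
      rw [Set.indicator_compl]
    rw [e]
    exact sqrt_integral_indicator_le hs.le hg (hmB N).compl fun x hx => not_lt.1 hx
  refine squeeze_zero (fun N => norm_nonneg _) hdiff ?_
  simpa using (tendsto_pow_atTop_nhds_zero_of_lt_one hr0 hr1).mul_const (weightedL2Norm s g)

/-- The ratio of the dyadic series. -/
noncomputable def dyadicRatio (s : ℝ) : ℝ := Real.sqrt 2 * (2 ^ s)⁻¹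

theorem dyadicRatio_nonneg (s : ℝ) : 0 ≤ dyadicRatio s := by unfold dyadicRatio; positivity

theorem dyadicRatio_lt_one {s : ℝ} (hs : 1 / 2 < s) : dyadicRatio s < 1 := by
  rw [dyadicRatio, ← div_eq_mul_inv, div_lt_one (by positivity), Real.sqrt_eq_rpow]
  exact Real.rpow_lt_rpow_of_exponent_lt (by norm_num) hs

/-- Sum the bounds for compactly supported pieces over pairs of shells: first over the shells of g
with that of h fixed, by continuity of the inner product, then over those of h by means of the
adjoint. -/
theorem limiting_absorption {s : ℝ} (hs : 1 / 2 < s) {g h : R3 → ℂ} (hg : MemWeightedL2 s g)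
    (hh : MemWeightedL2 s h) (hg2 : MemLp g 2) (hh2 : MemLp h 2) (a : ℝ) :
    (∃ L : ℂ, Tendsto (fun ε : ℝ => inner ℂ (hg2.toLp g) (halfWaveResolvent a ε (hh2.toLp h)))
      (𝓝[>] 0) (𝓝 L)) ∧
    ∀ ε : ℝ, 0 < ε → ‖inner ℂ (hg2.toLp g) (halfWaveResolvent a ε (hh2.toLp h))‖ ≤
      16 * sphericalConst * (1 - dyadicRatio s)⁻¹ ^ 2 *
        (weightedL2Norm s g * weightedL2Norm s h) := by
  have hs0 : 0 < s := by linarith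
  have hq0 := dyadicRatio_nonneg s
  have hq1 := dyadicRatio_lt_one hs
  have hC := sphericalConst_pos
  set n₁ := weightedL2Norm s g with hn₁
  set n₂ := weightedL2Norm s h with hn₂
  have hn₁0 : 0 ≤ n₁ := ENNReal.toReal_nonneg
  have hn₂0 : 0 ≤ n₂ := ENNReal.toReal_nonneg
  set G : ℕ → L2 := fun j =>
    (hg2.indicator (measurableSet_shell j)).toLp ((shell j).indicator g) with hG
  set K : ℕ → L2 := fun j =>
    (hh2.indicator (measurableSet_shell j)).toLp ((shell j).indicator h) with hK
  have hsG : HasSum G (hg2.toLp g) := hasSum_shell hs0 hg hg2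
  have hsK : HasSum K (hh2.toLp h) := hasSum_shell hs0 hh hh2
  have hsupp : ∀ (f : R3 → ℂ) (j : ℕ) (x : R3), 2 ^ (j + 1) < ‖x‖ →
      (shell j).indicator f x = 0 := fun f j x hx =>
    Set.indicator_of_notMem (fun h' => by linarith [h'.2, norm_le_bracket x]) f
  have hpiece := fun j k => resolvent_toLp_of_support (hg2.indicator (measurableSet_shell j))
    (hh2.indicator (measurableSet_shell k)) (R₁ := 2 ^ (j + 1)) (R₂ := 2 ^ (k + 1))
    (by positivity) (by positivity) (hsupp g j) (hsupp h k) a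
  have hbound : ∀ (k : ℕ) (ε : ℝ), 0 < ε → ∀ j, ‖inner ℂ (G j) (halfWaveResolvent a ε (K k))‖ ≤
      16 * sphericalConst * dyadicRatio s ^ k * (n₁ * n₂) * dyadicRatio s ^ j := by
    intro k ε hε j
    have h1 := sqrt_integral_indicator_le hs0.le hg (measurableSet_shell j) fun x hx => hx.1
    have h2 := sqrt_integral_indicator_le hs0.le hh (measurableSet_shell k) fun x hx => hx.1
    -- Shell j lies in the ball of radius 2^{j+1}; the two extra powers of 2 under the root turn 8
    -- into 16.
    have h3 : Real.sqrt (2 ^ (j + 1) * 2 ^ (k + 1)) = 2 * (Real.sqrt 2 ^ j * Real.sqrt 2 ^ k) := by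
      rw [← pow_add, Real.sqrt_eq_iff_mul_self_eq (by positivity) (by positivity), ← pow_add]
      have : Real.sqrt 2 ^ (j + k) * Real.sqrt 2 ^ (j + k) = 2 ^ (j + k) := by
        rw [← mul_pow, Real.mul_self_sqrt (by norm_num)]
      calc (2 : ℝ) ^ (j + 1 + (k + 1)) = 4 * 2 ^ (j + k) := by ring
        _ = 4 * (Real.sqrt 2 ^ (j + k) * Real.sqrt 2 ^ (j + k)) := by rw [this]
        _ = _ := by ring
    calc ‖inner ℂ (G j) (halfWaveResolvent a ε (K k))‖
        ≤ 8 * sphericalConst * Real.sqrt (2 ^ (j + 1) * 2 ^ (k + 1)) *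
          (Real.sqrt (∫ x, ‖(shell j).indicator g x‖ ^ 2) *
            Real.sqrt (∫ x, ‖(shell k).indicator h x‖ ^ 2)) := (hpiece j k).2 ε hε
      _ ≤ 8 * sphericalConst * Real.sqrt (2 ^ (j + 1) * 2 ^ (k + 1)) *
          ((((2 ^ s)⁻¹) ^ j * n₁) * (((2 ^ s)⁻¹) ^ k * n₂)) := by gcongr
      _ = _ := by
        rw [h3, dyadicRatio, mul_pow, mul_pow]; ring
  have hstep : ∀ k, (∃ L : ℂ, Tendsto (fun ε : ℝ =>
      inner ℂ (hg2.toLp g) (halfWaveResolvent a ε (K k))) (𝓝[>] 0) (𝓝 L)) ∧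
      ∀ ε : ℝ, 0 < ε → ‖inner ℂ (hg2.toLp g) (halfWaveResolvent a ε (K k))‖ ≤
        16 * sphericalConst * dyadicRatio s ^ k * (n₁ * n₂) * (1 - dyadicRatio s)⁻¹ := by
    intro k
    exact series_limit (f := fun ε j => inner ℂ (G j) (halfWaveResolvent a ε (K k))) hq0 hq1
      (fun ε _ => (innerSLFlip ℂ (halfWaveResolvent a ε (K k))).hasSum hsG)
      (hbound k) fun j => (hpiece j k).1
  have hfinal := series_limit
    (f := fun ε k => inner ℂ (hg2.toLp g) (halfWaveResolvent a ε (K k)))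
    (S := fun ε => inner ℂ (hg2.toLp g) (halfWaveResolvent a ε (hh2.toLp h)))
    (A := 16 * sphericalConst * (n₁ * n₂) * (1 - dyadicRatio s)⁻¹) hq0 hq1
    (fun ε hε => by
      obtain ⟨y, hy⟩ := exists_adjoint_halfWaveResolvent (a := a) hε (hg2.toLp g)
      simp only [hy]
      exact (innerSL ℂ y).hasSum hsK)
    (fun ε hε k => ((hstep k).2 ε hε).trans (le_of_eq (by ring))) fun k => (hstep k).1
  refine ⟨hfinal.1, fun ε hε => (hfinal.2 ε hε).trans (le_of_eq (by ring))⟩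

end Dyadic

end ResonantCoefficients

/-! ### Assembly of the three assertions. -/

theorem mainTheorem7 (s : ℝ) (hs : 1 / 2 < s) :
    ∃ C : ℝ, 0 < C ∧
      ∀ (V : ResonantCoefficients.R3 → ℝ)
        (χ : HilbertBasis ℕ ℂ ResonantCoefficients.L2) (E : ℕ → ℝ),
        ResonantCoefficients.IsConfining V → ResonantCoefficients.IsEigenbasis V χ E →
        -- the weighted `L¹` norms are finite
        (∀ k k' : ℕ,
          MemLp (ResonantCoefficients.weighted s (ResonantCoefficients.transition χ k k'))
            1 volume) ∧
        -- the resonant coefficients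
        (∀ w : ResonantCoefficients.R3 → ℂ, ResonantCoefficients.MemWeightedL2 s w →
          (∀ k k' : ℕ,
            (∀ᵐ x ∂(volume : Measure ResonantCoefficients.R3),
              ConvolutionExistsAt w (ResonantCoefficients.transition χ k k') x
                (ContinuousLinearMap.mul ℝ ℂ) volume) ∧
            MemLp (ResonantCoefficients.conv w (ResonantCoefficients.transition χ k k'))
              2 volume) ∧
          ∀ k k' j j' : ℕ, E j - E j' ≠ 0 →
            (∃ L : ℂ,
              Tendsto (fun η : ℝ => ResonantCoefficients.resonantCoeff w χ E k k' j j' η)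
                (𝓝[>] 0) (𝓝 L) ∧
              ‖L‖ ≤ C * ResonantCoefficients.weightedL2Norm s w ^ 2
                * ResonantCoefficients.weightedL1Norm s
                    (ResonantCoefficients.transition χ k k')
                * ResonantCoefficients.weightedL1Norm s
                    (ResonantCoefficients.transition χ j j')) ∧
            ∀ η : ℝ, 0 < η →
              ‖ResonantCoefficients.resonantCoeff w χ E k k' j j' η‖
                ≤ C * ResonantCoefficients.weightedL2Norm s w ^ 2
                  * ResonantCoefficients.weightedL1Norm s
                      (ResonantCoefficients.transition χ k k')
                  * ResonantCoefficients.weightedL1Norm s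
                      (ResonantCoefficients.transition χ j j')) ∧
        -- the Hartree coefficients
        (∀ v : ResonantCoefficients.R3 → ℂ, MemLp v ∞ volume →
          ∀ k k' j j' : ℕ,
            ConvolutionExists v (ResonantCoefficients.transition χ j j')
              (ContinuousLinearMap.mul ℝ ℂ) volume ∧
            Integrable (ResonantCoefficients.hartreeIntegrand v χ k k' j j') volume ∧
            ‖ResonantCoefficients.hartreeCoeff v χ k k' j j'‖
              ≤ (eLpNorm v ∞ volume).toReal) := by
  have hs0 : 0 ≤ s := by linarith
  have hC := ResonantCoefficients.sphericalConst_pos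
  have hq : 0 < 1 - ResonantCoefficients.dyadicRatio s :=
    sub_pos.2 (ResonantCoefficients.dyadicRatio_lt_one hs)
  set C₀ := 16 * ResonantCoefficients.sphericalConst *
    (1 - ResonantCoefficients.dyadicRatio s)⁻¹ ^ 2 with hC₀
  have hC₀p : 0 < C₀ := by positivity
  -- Each of the two convolutions loses a factor 2^s in the weighted Young inequality.
  refine ⟨C₀ * (2 ^ s) ^ 2, by positivity, fun V χ E hV hχ => ?_⟩
  have hρ := ResonantCoefficients.memLp_weighted_transition hV hχ s
  refine ⟨hρ, fun w hw => ?_, fun v hv k k' j j' =>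
    ResonantCoefficients.hartree_bound χ hv k k' j j'⟩
  have hY := fun k k' => ResonantCoefficients.weighted_conv hs0 hw (hρ k k')
  have hconv := fun k k' => ResonantCoefficients.memLp_of_weighted hs0 (hY k k').2.1
  refine ⟨fun k k' => ⟨(hY k k').1, hconv k k'⟩, fun k k' j j' _ => ?_⟩
  obtain ⟨⟨L, hL⟩, hb⟩ := ResonantCoefficients.limiting_absorption hs (hY k k').2.1 (hY j j').2.1
    (hconv k k') (hconv j j') (E j - E j')
  have hrc : ∀ η : ℝ, ResonantCoefficients.resonantCoeff w χ E k k' j j' η =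
      inner ℂ ((hconv k k').toLp _) (ResonantCoefficients.halfWaveResolvent (E j - E j') (η ^ 2)
        ((hconv j j').toLp _)) := by
    intro η
    rw [ResonantCoefficients.resonantCoeff, ResonantCoefficients.toL2,
      ResonantCoefficients.toL2, dif_pos (hconv k k'), dif_pos (hconv j j')]
  have hbound : ∀ η : ℝ, 0 < η → ‖ResonantCoefficients.resonantCoeff w χ E k k' j j' η‖
      ≤ C₀ * (2 ^ s) ^ 2 * ResonantCoefficients.weightedL2Norm s w ^ 2
        * ResonantCoefficients.weightedL1Norm s (ResonantCoefficients.transition χ k k')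
        * ResonantCoefficients.weightedL1Norm s (ResonantCoefficients.transition χ j j') := by
    intro η hη
    rw [hrc]
    refine (hb (η ^ 2) (by positivity)).trans ?_
    have h1 := (hY k k').2.2
    have h2 := (hY j j').2.2
    have h0 : 0 ≤ ResonantCoefficients.weightedL2Norm s (ResonantCoefficients.conv w
      (ResonantCoefficients.transition χ j j')) := ENNReal.toReal_nonneg
    have h3 : 0 ≤ ResonantCoefficients.weightedL2Norm s w := ENNReal.toReal_nonneg
    have h4 : 0 ≤ ResonantCoefficients.weightedL1Norm s
      (ResonantCoefficients.transition χ k k') := ENNReal.toReal_nonneg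
    calc _ ≤ C₀ * ((2 ^ s * (ResonantCoefficients.weightedL2Norm s w *
            ResonantCoefficients.weightedL1Norm s (ResonantCoefficients.transition χ k k'))) *
          (2 ^ s * (ResonantCoefficients.weightedL2Norm s w *
            ResonantCoefficients.weightedL1Norm s (ResonantCoefficients.transition χ j j')))) := by
          gcongr
      _ = _ := by ring
  -- The regularization is ε = η², so the limit in ε transfers along η ↦ η².
  have hsq : Tendsto (fun η : ℝ => η ^ 2) (𝓝[>] 0) (𝓝[>] 0) := by
    refine tendsto_nhdsWithin_iff.2 ⟨?_, ?_⟩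
    · have : Tendsto (fun η : ℝ => η ^ 2) (𝓝 0) (𝓝 (0 ^ 2)) := (continuous_pow 2).tendsto 0
      rw [zero_pow two_ne_zero] at this
      exact this.mono_left nhdsWithin_le_nhds
    · filter_upwards [self_mem_nhdsWithin] with η hη
      exact pow_pos (Set.mem_Ioi.1 hη) 2
  have hlim : Tendsto (fun η : ℝ => ResonantCoefficients.resonantCoeff w χ E k k' j j' η)
      (𝓝[>] 0) (𝓝 L) := by
    simp only [hrc]
    exact hL.comp hsq
  refine ⟨⟨L, hlim, le_of_tendsto hlim.norm ?_⟩, hbound⟩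
  filter_upwards [self_mem_nhdsWithin] with η hη using hbound η hη
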